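/- Work in the holomorphic category. Let $\mathbb{P}^{n|1}$ ($n\ge 0$) be the complex projective superspace, i.e. the complex supermanifold $(\mathbb{P}^n,\ \mathcal{O}=\mathcal{O}_{\mathbb{P}^n}\oplus\Pi\mathcal{O}_{\mathbb{P}^n}(-1))$, with affine coordinates $z_1,\dots,z_n|\theta$ on the standard charts ($z_\ell=X_\ell/X_i$, $\theta=\varepsilon/X_i$). Let $\mathcal{T}$ be its tangent sheaf, $\mathcal{T}^*$ the dual sheaf, $\Pi$ the parity change, $\mathrm{Sym}^\bullet$ the supersymmetric powers over $\mathcal{O}$ (zero in negative degree), and $\mathcal{B}er=(\mathrm{Ber}\,\Pi\mathcal{T}^*)^*$ the Berezinian sheaf, generated on a chart by $\mathcal{D}[dz|d\theta]$. Write $dz_\ell$ (odd) and $d\theta$ (even) for the local generators of $\Pi\mathcal{T}^*$. For $d\in\mathbb{Z}$ let $\Omega^{d;0}$ be the sheaf of superforms of degree $d$ extended by the inverse forms, i.e. the degree-$d$ part of $\mathrm{Sym}^\bullet\Pi\mathcal{T}^*$ with $d\theta$ inverted; on a chart it is freely generated over $\mathcal{O}$ by the $dz_{i_1}\cdots dz_{i_r}\,d\theta^{j}$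 with $i_1<\dots<i_r$, $j\in\mathbb{Z}$, $r+j=d$. It contains the superforms $\mathrm{Sym}^{d}\,\Pi\mathcal{T}^*$ (the part with $j\ge0$). For $k\in\mathbb{Z}$ let $\Omega^{k;1}=\mathcal{B}er\otimes\mathrm{Sym}^{n-k}\Pi\mathcal{T}$ be the sheaf of integral forms, where for $0\le s\le n$, $a\ge 0$, $s-a=k$ and a permutation $\tau$ of $\{1,\dots,n\}$ the integral form $dz_{\tau(1)}\cdots dz_{\tau(s)}\,\delta^{(a)}(d\theta)$ stands for the section $$\mathrm{sgn}(\tau)\,\mathcal{D}[dz|d\theta]\otimes \pi\partial_{z_{\tau(n)}}\odot\cdots\odot\pi\partial_{z_{\tau(s+1)}}\odot(\pi\partial_\theta)^{\odot a}.$$ Then there are odd morphisms of sheaves of $\mathcal{O}$-modules $\Theta:\Omega^{k;1}\to\Omega^{k-1;0}$, $k\in\mathbb{Z}$, given on each standard chart by $$\Theta\bigl(dz_{\tau(1)}\cdots dz_{\tau(s)}\,\delta^{(a)}(d\theta)\bigr)=(-1)^a\,a!\;\frac{dz_{\tau(1)}\cdots dz_{\tau(s)}}{d\theta^{\,a+1}},$$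 and $\Theta$ is an isomorphism up to parity (an odd isomorphism) for $k\le 0$ and injective for $0<k\le n$. Moreover there are (even) isomorphisms of sheaves of $\mathcal{O}$-modules $$\Omega^{k-1;0}\;\cong\;\begin{cases}\mathrm{Sym}^{k-1}\,\Pi\mathcal{T}^* & k>n,\\[2pt] \bigl(\Pi\mathcal{B}er\otimes\mathrm{Sym}^{n-k}\,\Pi\mathcal{T}\bigr)\oplus\mathrm{Sym}^{k-1}\,\Pi\mathcal{T}^* & 0<k\le n,\\[2pt] \Pi\mathcal{B}er\otimes\mathrm{Sym}^{n-k}\,\Pi\mathcal{T} & k\le 0,\end{cases}$$ which are the natural inclusion on the summand $\mathrm{Sym}^{k-1}\Pi\mathcal{T}^*$ and under which $\Theta$ becomes the parity inversion $s\mapsto\pi s$ for $k\le0$ and the injection $s\mapsto(\pi s,0)$ for $0<k\le n$, where $\pi(D\otimes P)=\pi D\otimes P$. -/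

import Mathlib

open TopologicalSpace

noncomputable section

namespace SuperProj

/-! ### The complex projective superspace of dimension `n|1` -/

/-- Complex projective space of dimension `n`, the reduced space of the projective superspace. -/
abbrev Pn (n : ℕ) : Type := Projectivization ℂ (Fin (n + 1) → ℂ)

/-- The quotient topology from `ℂⁿ⁺¹ ∖ {0}`. -/
instance (n : ℕ) : TopologicalSpace (Pn n) :=
  TopologicalSpace.coinduced
    (fun v : {v : Fin (n + 1) → ℂ // v ≠ 0} => Projectivization.mk ℂ v.1 v.2) inferInstance

variable {n : ℕ}

/-- The open cone in `ℂⁿ⁺¹ ∖ {0}` lying over an open set of projective space. -/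
def cone (V : Opens (Pn n)) : Set (Fin (n + 1) → ℂ) :=
  {v | ∃ h : v ≠ 0, Projectivization.mk ℂ v h ∈ V}

lemma cone_mono {V W : Opens (Pn n)} (h : W ≤ V) : cone W ⊆ cone V :=
  fun _ hv => ⟨hv.1, h hv.2⟩

/-- The sections over `V` of the structure sheaf `⋀ 𝒪(-1) = 𝒪 ⊕ Π𝒪(-1)` of the projective
superspace: expressions `f + g ε` with `ε` the odd homogeneous coordinate (`ε² = 0`), where `f` and
`g` are holomorphic functions on the cone over `V`, homogeneous of degree `0` and `-1`. -/
def ringO (V : Opens (Pn n)) : Subalgebra ℂ (cone V → DualNumber ℂ) where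
  carrier := {F |
    (∃ f : (Fin (n + 1) → ℂ) → ℂ, AnalyticOnNhd ℂ f (cone V) ∧ ∀ v : cone V, (F v).fst = f v) ∧
    (∃ g : (Fin (n + 1) → ℂ) → ℂ, AnalyticOnNhd ℂ g (cone V) ∧ ∀ v : cone V, (F v).snd = g v) ∧
    ∀ (v w : cone V) (t : ℂ), (w : Fin (n + 1) → ℂ) = t • (v : Fin (n + 1) → ℂ) →
      (F w).fst = (F v).fst ∧ t * (F w).snd = (F v).snd}
  mul_mem' := by
    rintro F G ⟨⟨f, hf, hf'⟩, ⟨f₁, hf₁, hf₁'⟩, hF⟩ ⟨⟨g, hg, hg'⟩, ⟨g₁, hg₁, hg₁'⟩, hG⟩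
    refine ⟨⟨f * g, hf.mul hg, fun v => ?_⟩, ⟨f * g₁ + g * f₁, (hf.mul hg₁).add (hg.mul hf₁),
      fun v => ?_⟩, fun v w t h => ⟨?_, ?_⟩⟩
    · simp [hf', hg']
    · simp [hf', hg', hf₁', hg₁', mul_comm]
    · simp [(hF v w t h).1, (hG v w t h).1]
    · simp only [Pi.mul_apply, TrivSqZeroExt.snd_mul, smul_eq_mul, MulOpposite.smul_eq_mul_unop,
        MulOpposite.unop_op, (hF v w t h).1, (hG v w t h).1, ← (hF v w t h).2, ← (hG v w t h).2]
      ring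
  add_mem' := by
    rintro F G ⟨⟨f, hf, hf'⟩, ⟨f₁, hf₁, hf₁'⟩, hF⟩ ⟨⟨g, hg, hg'⟩, ⟨g₁, hg₁, hg₁'⟩, hG⟩
    refine ⟨⟨f + g, hf.add hg, fun v => ?_⟩, ⟨f₁ + g₁, hf₁.add hg₁,
      fun v => ?_⟩, fun v w t h => ⟨?_, ?_⟩⟩
    · simp [hf', hg']
    · simp [hf₁', hg₁']
    · simp [(hF v w t h).1, (hG v w t h).1]
    · simp [mul_add, (hF v w t h).2, (hG v w t h).2]
  algebraMap_mem' c := by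
    refine ⟨⟨fun _ => c, analyticOnNhd_const, fun v => ?_⟩,
      ⟨fun _ => 0, analyticOnNhd_const, fun v => ?_⟩, fun v w t h => ⟨?_, ?_⟩⟩ <;>
    simp [TrivSqZeroExt.algebraMap_eq_inl]

/-- The ring of sections of the structure sheaf over `V`. -/
def O (V : Opens (Pn n)) : Type := ringO V

instance (V : Opens (Pn n)) : CommRing (O V) := inferInstanceAs (CommRing (ringO V))

instance (V : Opens (Pn n)) : Algebra ℂ (O V) := inferInstanceAs (Algebra ℂ (ringO V))

@[ext] lemma O.ext {V : Opens (Pn n)} {a b : O V} (h : ∀ v, a.1 v = b.1 v) : a = b :=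
  Subtype.ext (funext h)

/-- Restriction of sections of the structure sheaf. -/
def resO {V W : Opens (Pn n)} (h : W ≤ V) : O V →ₐ[ℂ] O W where
  toFun F := ⟨fun v => F.1 ⟨v.1, cone_mono h v.2⟩, by
    obtain ⟨⟨f, hf, hf'⟩, ⟨g, hg, hg'⟩, hF⟩ := F.2
    exact ⟨⟨f, hf.mono (cone_mono h), fun v => hf' _⟩, ⟨g, hg.mono (cone_mono h), fun v => hg' _⟩,
      fun v w t hvw => hF _ _ t hvw⟩⟩
  map_one' := rfl
  map_mul' _ _ := rfl
  map_zero' := rfl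
  map_add' _ _ := rfl
  commutes' _ := rfl

/-- The parity involution `f + g ε ↦ f - g ε` of the structure sheaf; a section `a` is even when
`sg V a = a` and odd when `sg V a = -a`. -/
def sg (V : Opens (Pn n)) : O V →ₐ[ℂ] O V where
  toFun F := ⟨fun v => TrivSqZeroExt.inl (F.1 v).fst - TrivSqZeroExt.inr (F.1 v).snd, by
    obtain ⟨⟨f, hf, hf'⟩, ⟨g, hg, hg'⟩, hF⟩ := F.2
    refine ⟨⟨f, hf, fun v => by simp [hf']⟩, ⟨-g, hg.neg, fun v => by simp [hg']⟩,
      fun v w t hvw => ⟨by simp [(hF v w t hvw).1], by simp [(hF v w t hvw).2]⟩⟩⟩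
  map_one' := O.ext fun v => by
    change TrivSqZeroExt.inl (1 : DualNumber ℂ).fst - TrivSqZeroExt.inr (1 : DualNumber ℂ).snd = 1
    simp
  map_mul' F G := O.ext fun v => by
    change TrivSqZeroExt.inl (F.1 v * G.1 v).fst - TrivSqZeroExt.inr (F.1 v * G.1 v).snd =
      (TrivSqZeroExt.inl (F.1 v).fst - TrivSqZeroExt.inr (F.1 v).snd) *
      (TrivSqZeroExt.inl (G.1 v).fst - TrivSqZeroExt.inr (G.1 v).snd)
    ext <;> simp; ring
  map_zero' := O.ext fun v => by
    change TrivSqZeroExt.inl (0 : DualNumber ℂ).fst - TrivSqZeroExt.inr (0 : DualNumber ℂ).snd = 0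
    simp
  map_add' F G := O.ext fun v => by
    change TrivSqZeroExt.inl (F.1 v + G.1 v).fst - TrivSqZeroExt.inr (F.1 v + G.1 v).snd =
      (TrivSqZeroExt.inl (F.1 v).fst - TrivSqZeroExt.inr (F.1 v).snd) +
      (TrivSqZeroExt.inl (G.1 v).fst - TrivSqZeroExt.inr (G.1 v).snd)
    ext <;> simp; ring
  commutes' c := O.ext fun v => by
    change TrivSqZeroExt.inl (algebraMap ℂ (DualNumber ℂ) c).fst -
      TrivSqZeroExt.inr (algebraMap ℂ (DualNumber ℂ) c).snd = algebraMap ℂ (DualNumber ℂ) c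
    simp [TrivSqZeroExt.algebraMap_eq_inl]

lemma sg_fst {V : Opens (Pn n)} (a : O V) (v : cone V) : ((sg V a).1 v).fst = (a.1 v).fst := by
  change (TrivSqZeroExt.inl (a.1 v).fst - TrivSqZeroExt.inr (a.1 v).snd : DualNumber ℂ).fst = _
  simp

lemma sg_snd {V : Opens (Pn n)} (a : O V) (v : cone V) : ((sg V a).1 v).snd = -(a.1 v).snd := by
  change (TrivSqZeroExt.inl (a.1 v).fst - TrivSqZeroExt.inr (a.1 v).snd : DualNumber ℂ).snd = _
  simp

lemma sg_sg (V : Opens (Pn n)) (a : O V) : sg V (sg V a) = a :=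
  O.ext fun v => by ext <;> simp [sg_fst, sg_snd]

lemma res_sg {V W : Opens (Pn n)} (h : W ≤ V) (a : O V) : resO h (sg V a) = sg W (resO h a) := rfl

lemma res_res_O {V W U : Opens (Pn n)} (h : W ≤ V) (h' : U ≤ W) (a : O V) :
    resO h' (resO h a) = resO (h'.trans h) a := rfl

/-- The standard affine chart `Xᵢ ≠ 0`. -/
def chart (i : Fin (n + 1)) : Opens (Pn n) where
  carrier := {p | ∀ (v : Fin (n + 1) → ℂ) (h : v ≠ 0), Projectivization.mk ℂ v h = p → v i ≠ 0}
  is_open' := by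
    rw [isOpen_coinduced]
    have : (fun v : {v : Fin (n + 1) → ℂ // v ≠ 0} => Projectivization.mk ℂ v.1 v.2) ⁻¹'
        {p | ∀ (v : Fin (n + 1) → ℂ) (h : v ≠ 0), Projectivization.mk ℂ v h = p → v i ≠ 0}
        = {v | v.1 i ≠ 0} := by
      ext ⟨v, hv⟩
      simp only [Set.mem_preimage, Set.mem_ofPred_eq]
      refine ⟨fun H => H v hv rfl, fun H w hw hwv => ?_⟩
      obtain ⟨c, hc⟩ := (Projectivization.mk_eq_mk_iff ℂ w v hw hv).1 hwv
      rw [← hc]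
      simpa [Units.smul_def] using H
    rw [this]
    exact isOpen_ne_fun ((continuous_apply i).comp continuous_subtype_val) continuous_const

lemma cone_ne {V : Opens (Pn n)} {i : Fin (n + 1)} (h : V ≤ chart i) {v : Fin (n + 1) → ℂ}
    (hv : v ∈ cone V) : v i ≠ 0 := h hv.2 v hv.1 rfl

/-- The even affine coordinates `z_ℓ = X_ℓ / X_i` (`ℓ ≠ i`) on an open set of the chart `i`. -/
def coordZ {V : Opens (Pn n)} {i : Fin (n + 1)} (h : V ≤ chart i) (l : Fin n) : O V :=
  ⟨fun v => TrivSqZeroExt.inl (v.1 (i.succAbove l) / v.1 i), by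
    refine ⟨⟨fun v => v (i.succAbove l) / v i, ?_, fun v => by simp⟩,
      ⟨fun _ => 0, analyticOnNhd_const, fun v => by simp⟩, fun v w t hvw => ⟨?_, by simp⟩⟩
    · intro v hv
      exact ((ContinuousLinearMap.proj (R := ℂ) (φ := fun _ => ℂ) (i.succAbove l)).analyticAt v).div
        ((ContinuousLinearMap.proj (R := ℂ) (φ := fun _ => ℂ) i).analyticAt v) (cone_ne h hv)
    · have h1 : w.1 i ≠ 0 := cone_ne h w.2
      have h2 : v.1 i ≠ 0 := cone_ne h v.2
      rw [hvw] at h1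
      have ht : t ≠ 0 := by rintro rfl; simp at h1
      simp only [TrivSqZeroExt.fst_inl, hvw, Pi.smul_apply, smul_eq_mul]
      field_simp⟩

/-- The odd affine coordinate `θ = ε / X_i` on an open set of the chart `i`. -/
def coordT {V : Opens (Pn n)} {i : Fin (n + 1)} (h : V ≤ chart i) : O V :=
  ⟨fun v => TrivSqZeroExt.inr (1 / v.1 i), by
    refine ⟨⟨fun _ => 0, analyticOnNhd_const, fun v => by simp⟩,
      ⟨fun v => 1 / v i, ?_, fun v => by simp⟩, fun v w t hvw => ⟨by simp, ?_⟩⟩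
    · intro v hv
      exact analyticAt_const.div
        ((ContinuousLinearMap.proj (R := ℂ) (φ := fun _ => ℂ) i).analyticAt v) (cone_ne h hv)
    · have h1 : w.1 i ≠ 0 := cone_ne h w.2
      have h2 : v.1 i ≠ 0 := cone_ne h v.2
      rw [hvw] at h1
      have ht : t ≠ 0 := by rintro rfl; simp at h1
      simp only [TrivSqZeroExt.snd_inr, hvw, Pi.smul_apply, smul_eq_mul]
      field_simp⟩

/-! ### Sheaves of supermodules -/

/-- A presheaf of supermodules over the structure sheaf. The `ℤ/2`-grading is recorded by the parity
involution `par` (`+1` on even sections, `-1` on odd ones). -/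
structure SMod (n : ℕ) where
  obj : Opens (Pn n) → Type
  grp : ∀ V, AddCommGroup (obj V)
  mod : ∀ V, Module (O V) (obj V)
  par : ∀ V, obj V →+ obj V
  res : ∀ {V W : Opens (Pn n)}, W ≤ V → obj V →+ obj W
  par_par : ∀ V s, par V (par V s) = s
  par_smul : ∀ V (a : O V) (s : obj V), par V (a • s) = sg V a • par V s
  res_par : ∀ {V W : Opens (Pn n)} (h : W ≤ V) s, res h (par V s) = par W (res h s)
  res_smul : ∀ {V W : Opens (Pn n)} (h : W ≤ V) (a : O V) (s : obj V),
    res h (a • s) = resO h a • res h s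
  res_self : ∀ V s, res (le_refl V) s = s
  res_res : ∀ {V W U : Opens (Pn n)} (h : W ≤ V) (h' : U ≤ W) s,
    res h' (res h s) = res (h'.trans h) s

attribute [instance] SMod.grp SMod.mod

/-- The open subsets of `V`. -/
abbrev Sub (V : Opens (Pn n)) : Type := {W : Opens (Pn n) // W ≤ V}

/-- The open subsets of `V` that are contained in some standard affine chart. -/
abbrev SubC (V : Opens (Pn n)) : Type := {W : Opens (Pn n) // W ≤ V ∧ ∃ i, W ≤ chart i}

/-- Sections over `V` of a sheaf given by its values on the opens contained in a standard affine
chart: compatible families of sections on all such opens of `V`. -/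
def glueSec (F : SMod n) (V : Opens (Pn n)) : AddSubgroup (∀ W : SubC V, F.obj W.1) where
  carrier := {s | ∀ (W U : SubC V) (h : U.1 ≤ W.1), F.res h (s W) = s U}
  add_mem' := by
    intro s t hs ht W U h
    simp [hs W U h, ht W U h]
  zero_mem' := by intro W U h; simp
  neg_mem' := by
    intro s hs W U h
    simp [hs W U h]

/-- The sheaf on the projective superspace with the prescribed sections on the opens contained in a
standard affine chart. All presheaves below to which it is applied are free of finite rank, hence
already sheaves, on these opens, so that this is the associated sheaf. -/
def glue (F : SMod n) : SMod n where
  obj V := glueSec F V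
  grp _ := inferInstance
  mod V :=
    { smul := fun a s => ⟨fun W => resO W.2.1 a • s.1 W, by
        intro W U h
        rw [F.res_smul, s.2 W U h]; rfl⟩
      one_smul := fun s => Subtype.ext (by
        funext W; change resO W.2.1 1 • s.1 W = _; rw [map_one, one_smul])
      mul_smul := fun a b s => Subtype.ext (by
        funext W
        change resO W.2.1 (a * b) • s.1 W = resO W.2.1 a • resO W.2.1 b • s.1 W
        rw [map_mul, mul_smul])
      smul_zero := fun a => Subtype.ext (by
        funext W; change resO W.2.1 a • (0 : F.obj W.1) = 0; rw [smul_zero])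
      smul_add := fun a s t => Subtype.ext (by
        funext W
        change resO W.2.1 a • (s.1 W + t.1 W) = _; rw [smul_add]; rfl)
      add_smul := fun a b s => Subtype.ext (by
        funext W
        change resO W.2.1 (a + b) • s.1 W = _; rw [map_add, add_smul]; rfl)
      zero_smul := fun s => Subtype.ext (by
        funext W; change resO W.2.1 0 • s.1 W = 0; rw [map_zero, zero_smul]) }
  par V :=
    { toFun := fun s => ⟨fun W => F.par W.1 (s.1 W), by
        intro W U h
        rw [F.res_par, s.2 W U h]⟩
      map_zero' := Subtype.ext (by funext W; exact map_zero (F.par W.1))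
      map_add' := fun s t => Subtype.ext (by funext W; exact map_add (F.par W.1) _ _) }
  res h :=
    { toFun := fun s => ⟨fun W => s.1 ⟨W.1, W.2.1.trans h, W.2.2⟩, by
        intro W U h'
        exact s.2 ⟨W.1, W.2.1.trans h, W.2.2⟩ ⟨U.1, U.2.1.trans h, U.2.2⟩ h'⟩
      map_zero' := rfl
      map_add' := fun _ _ => rfl }
  par_par V s := Subtype.ext (by funext W; exact F.par_par W.1 (s.1 W))
  par_smul V a s := Subtype.ext (by
    funext W; exact F.par_smul W.1 (resO W.2.1 a) (s.1 W))
  res_par _ _ := rfl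
  res_smul _ _ _ := rfl
  res_self _ _ := rfl
  res_res _ _ _ := rfl

/-- A section over `V` of the presheaf restricts to a section of the glued sheaf. -/
def toGlue (F : SMod n) (V : Opens (Pn n)) (s : F.obj V) : (glue F).obj V :=
  (⟨fun W => F.res W.2.1 s, by
    intro W U h
    exact F.res_res W.2.1 h s⟩ : glueSec F V)

/-- Morphisms of sheaves of supermodules, even (parity preserving) and linear. -/
structure EvenHom (F G : SMod n) where
  app : ∀ V, F.obj V →+ G.obj V
  app_smul : ∀ V (a : O V) (s : F.obj V), app V (a • s) = a • app V s
  app_par : ∀ V (s : F.obj V), app V (F.par V s) = G.par V (app V s)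
  app_res : ∀ {V W : Opens (Pn n)} (h : W ≤ V) (s : F.obj V),
    app W (F.res h s) = G.res h (app V s)

/-- Odd morphisms of sheaves of supermodules: they reverse the parity and are linear up to the
Koszul sign `φ(a s) = (-1)^{|a|} a φ(s)`. -/
structure OddHom (F G : SMod n) where
  app : ∀ V, F.obj V →+ G.obj V
  app_smul : ∀ V (a : O V) (s : F.obj V), app V (a • s) = sg V a • app V s
  app_par : ∀ V (s : F.obj V), app V (F.par V s) = - G.par V (app V s)
  app_res : ∀ {V W : Opens (Pn n)} (h : W ≤ V) (s : F.obj V),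
    app W (F.res h s) = G.res h (app V s)

/-- The parity shift `ΠF`: the same abelian groups `{πs}`, with the opposite parity and
`a • πs = (-1)^{|a|} π(a • s)`. -/
def shift (F : SMod n) : SMod n where
  obj := F.obj
  grp := F.grp
  mod V := Module.compHom (F.obj V) (sg V).toRingHom
  par V := -(F.par V)
  res := F.res
  par_par V s := by simp [F.par_par]
  par_smul V a s := by
    change -(F.par V (sg V a • s)) = sg V (sg V a) • (-(F.par V s))
    rw [F.par_smul, smul_neg]
  res_par h s := by simp [F.res_par]
  res_smul h a s := F.res_smul h (sg _ a) s
  res_self := F.res_self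
  res_res := F.res_res

/-- The parity-changing map `s ↦ πs`. -/
def pi (F : SMod n) (V : Opens (Pn n)) : F.obj V →+ (shift F).obj V := AddMonoidHom.id _

/-- Direct sum. -/
def sum (F G : SMod n) : SMod n where
  obj V := F.obj V × G.obj V
  grp _ := inferInstance
  mod _ := inferInstance
  par V := (F.par V).prodMap (G.par V)
  res h := (F.res h).prodMap (G.res h)
  par_par V s := Prod.ext (F.par_par V s.1) (G.par_par V s.2)
  par_smul V a s := Prod.ext (F.par_smul V a s.1) (G.par_smul V a s.2)
  res_par h s := Prod.ext (F.res_par h s.1) (G.res_par h s.2)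
  res_smul h a s := Prod.ext (F.res_smul h a s.1) (G.res_smul h a s.2)
  res_self V s := Prod.ext (F.res_self V s.1) (G.res_self V s.2)
  res_res h h' s := Prod.ext (F.res_res h h' s.1) (G.res_res h h' s.2)

/-! ### Tangent and cotangent sheaves -/

lemma odd_mul_sg {V : Opens (Pn n)} {x : O V} (hx : sg V x = -x) (a : O V) :
    x * sg V a = x * a := by
  have h0 : ∀ v, (x.1 v).fst = 0 := by
    intro v
    have h : ((sg V x).1 v).fst = (-(x.1 v)).fst := by rw [hx]; rfl
    rw [sg_fst, TrivSqZeroExt.fst_neg] at h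
    exact self_eq_neg.1 h
  refine O.ext fun v => ?_
  change x.1 v * (TrivSqZeroExt.inl (a.1 v).fst - TrivSqZeroExt.inr (a.1 v).snd) = x.1 v * a.1 v
  ext <;> simp [h0]

/-- Sections over `V` of the tangent sheaf: superderivations of the structure sheaf of `V`, that is,
`ℂ`-linear endomorphisms `D` of the sheaf `O` restricted to `V` whose even part `D₀` and odd part
`D₁` satisfy `Dₚ(ab) = Dₚ(a) b + (-1)^{p|a|} a Dₚ(b)`. In terms of `D = D₀ + D₁` and of
`sg ∘ D ∘ sg = D₀ - D₁` these are the two conditions below, for `a` even and for `a` odd. -/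
def tangentSec (V : Opens (Pn n)) : AddSubgroup (∀ W : Sub V, O W.1 →ₗ[ℂ] O W.1) where
  carrier := {D |
    (∀ (W U : Sub V) (h : U.1 ≤ W.1) (f : O W.1), resO h (D W f) = D U (resO h f)) ∧
    (∀ (W : Sub V) (a b : O W.1), sg W.1 a = a → D W (a * b) = D W a * b + a * D W b) ∧
    (∀ (W : Sub V) (a b : O W.1), sg W.1 a = -a →
      D W (a * b) = D W a * b + a * sg W.1 (D W (sg W.1 b)))}
  add_mem' := by
    rintro D E ⟨h1, h2, h3⟩ ⟨k1, k2, k3⟩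
    refine ⟨fun W U h f => ?_, fun W a b ha => ?_, fun W a b ha => ?_⟩
    · simp [h1 W U h f, k1 W U h f]
    · simp only [Pi.add_apply, LinearMap.add_apply, h2 W a b ha, k2 W a b ha]; ring
    · simp only [Pi.add_apply, LinearMap.add_apply, h3 W a b ha, k3 W a b ha, map_add]; ring
  zero_mem' := by
    refine ⟨fun W U h f => ?_, fun W a b ha => ?_, fun W a b ha => ?_⟩ <;> simp
  neg_mem' := by
    rintro D ⟨h1, h2, h3⟩
    refine ⟨fun W U h f => ?_, fun W a b ha => ?_, fun W a b ha => ?_⟩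
    · simp [h1 W U h f]
    · simp only [Pi.neg_apply, LinearMap.neg_apply, h2 W a b ha]; ring
    · simp only [Pi.neg_apply, LinearMap.neg_apply, h3 W a b ha, map_neg]; ring

/-- The tangent sheaf. -/
def tangent (n : ℕ) : SMod n where
  obj V := tangentSec V
  grp _ := inferInstance
  mod V :=
    { smul := fun a D => ⟨fun W => (LinearMap.mulLeft ℂ (resO W.2 a)) ∘ₗ D.1 W, by
        obtain ⟨h1, h2, h3⟩ := D.2
        refine ⟨fun W U h f => ?_, fun W x y hx => ?_, fun W x y hx => ?_⟩
        · simp only [LinearMap.comp_apply, LinearMap.mulLeft_apply, map_mul, h1 W U h f]; rfl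
        · simp only [LinearMap.comp_apply, LinearMap.mulLeft_apply, h2 W x y hx]; ring
        · simp only [LinearMap.comp_apply, LinearMap.mulLeft_apply, h3 W x y hx, map_mul]
          linear_combination (-(sg W.1 (D.1 W (sg W.1 y)))) * odd_mul_sg hx (resO W.2 a)⟩
      one_smul := fun D => Subtype.ext (by
        funext W; ext1 f; change resO W.2 1 * D.1 W f = _; rw [map_one, one_mul])
      mul_smul := fun a b D => Subtype.ext (by
        funext W; ext1 f
        change resO W.2 (a * b) * D.1 W f = resO W.2 a * (resO W.2 b * D.1 W f)
        rw [map_mul, mul_assoc])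
      smul_zero := fun a => Subtype.ext (by
        funext W; ext1 f; change resO W.2 a * 0 = 0; rw [mul_zero])
      smul_add := fun a D E => Subtype.ext (by
        funext W; ext1 f
        exact mul_add (resO W.2 a) (D.1 W f) (E.1 W f))
      add_smul := fun a b D => Subtype.ext (by
        funext W; ext1 f
        change resO W.2 (a + b) * D.1 W f = resO W.2 a * D.1 W f + resO W.2 b * D.1 W f
        rw [map_add, add_mul])
      zero_smul := fun D => Subtype.ext (by
        funext W; ext1 f; change resO W.2 0 * D.1 W f = 0; rw [map_zero, zero_mul]) }
  par V :=
    { toFun := fun D => ⟨fun W => (sg W.1).toLinearMap ∘ₗ D.1 W ∘ₗ (sg W.1).toLinearMap, by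
        obtain ⟨h1, h2, h3⟩ := D.2
        refine ⟨fun W U h f => ?_, fun W x y hx => ?_, fun W x y hx => ?_⟩
        · simp only [LinearMap.comp_apply, AlgHom.toLinearMap_apply, res_sg, h1 W U h]
        · simp only [LinearMap.comp_apply, AlgHom.toLinearMap_apply, map_mul, hx, map_add,
            h2 W x _ hx, sg_sg]
        · simp only [LinearMap.comp_apply, AlgHom.toLinearMap_apply, map_mul, hx, map_add, map_neg,
            neg_mul, h3 W x _ hx, sg_sg]; ring⟩
      map_zero' := Subtype.ext (by funext W; ext1 f; exact map_zero (sg W.1))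
      map_add' := fun D E => Subtype.ext (by funext W; ext1 f; exact map_add (sg W.1) _ _) }
  res h :=
    { toFun := fun D => ⟨fun W => D.1 ⟨W.1, W.2.trans h⟩,
        fun W U h' => D.2.1 ⟨W.1, W.2.trans h⟩ ⟨U.1, U.2.trans h⟩ h',
        fun W => D.2.2.1 ⟨W.1, W.2.trans h⟩, fun W => D.2.2.2 ⟨W.1, W.2.trans h⟩⟩
      map_zero' := rfl
      map_add' := fun _ _ => rfl }
  par_par V D := Subtype.ext (by
    funext W
    refine LinearMap.ext fun f => ?_
    change sg W.1 (sg W.1 (D.1 W (sg W.1 (sg W.1 f)))) = _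
    rw [sg_sg, sg_sg])
  par_smul V a D := Subtype.ext (by
    funext W
    refine LinearMap.ext fun f => ?_
    exact map_mul (sg W.1) (resO W.2 a) _)
  res_par _ _ := rfl
  res_smul _ _ _ := rfl
  res_self _ _ := rfl
  res_res _ _ _ := rfl

/-- Sections over `V` of `ℋom(F, O)`: compatible families of linear maps `F(W) → O(W)`, `W ⊆ V`. -/
def dualSec (F : SMod n) (V : Opens (Pn n)) :
    AddSubgroup (∀ W : Sub V, F.obj W.1 →ₗ[O W.1] O W.1) where
  carrier := {φ | ∀ (W U : Sub V) (h : U.1 ≤ W.1) (s : F.obj W.1),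
      resO h (φ W s) = φ U (F.res h s)}
  add_mem' := by
    intro φ ψ hφ hψ W U h s
    simp [hφ W U h s, hψ W U h s]
  zero_mem' := by intro W U h s; simp
  neg_mem' := by intro φ hφ W U h s; simp [hφ W U h s]

/-- The dual sheaf `ℋom(F, O)`, with the parity involution `φ ↦ sg ∘ φ ∘ par`. -/
def dual (F : SMod n) : SMod n where
  obj V := dualSec F V
  grp _ := inferInstance
  mod V :=
    { smul := fun a φ => ⟨fun W => resO W.2 a • φ.1 W, by
        intro W U h s
        simp only [LinearMap.smul_apply, smul_eq_mul, map_mul, φ.2 W U h s]; rfl⟩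
      one_smul := fun φ => Subtype.ext (by
        funext W; change resO W.2 1 • φ.1 W = _; rw [map_one, one_smul])
      mul_smul := fun a b φ => Subtype.ext (by
        funext W
        change resO W.2 (a * b) • φ.1 W = resO W.2 a • resO W.2 b • φ.1 W
        rw [map_mul, mul_smul])
      smul_zero := fun a => Subtype.ext (by
        funext W; change resO W.2 a • (0 : F.obj W.1 →ₗ[O W.1] O W.1) = 0; rw [smul_zero])
      smul_add := fun a φ ψ => Subtype.ext (by
        funext W
        change resO W.2 a • (φ.1 W + ψ.1 W) = _; rw [smul_add]; rfl)
      add_smul := fun a b φ => Subtype.ext (by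
        funext W
        change resO W.2 (a + b) • φ.1 W = _; rw [map_add, add_smul]; rfl)
      zero_smul := fun φ => Subtype.ext (by
        funext W; change resO W.2 0 • φ.1 W = 0; rw [map_zero, zero_smul]) }
  par V :=
    { toFun := fun φ => ⟨fun W =>
        { toFun := fun s => sg W.1 (φ.1 W (F.par W.1 s))
          map_add' := fun s t => by simp
          map_smul' := fun a s => by simp [F.par_smul, sg_sg] }, by
        intro W U h s
        simp only [LinearMap.coe_mk, AddHom.coe_mk, res_sg, φ.2 W U h, F.res_par]⟩
      map_zero' := Subtype.ext (by
        funext W; exact LinearMap.ext fun s => map_zero (sg W.1))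
      map_add' := fun φ ψ => Subtype.ext (by
        funext W; exact LinearMap.ext fun s => map_add (sg W.1) _ _) }
  res h :=
    { toFun := fun φ => ⟨fun W => φ.1 ⟨W.1, W.2.trans h⟩,
        fun W U h' => φ.2 ⟨W.1, W.2.trans h⟩ ⟨U.1, U.2.trans h⟩ h'⟩
      map_zero' := rfl
      map_add' := fun _ _ => rfl }
  par_par V φ := Subtype.ext (by
    funext W
    refine LinearMap.ext fun s => ?_
    change sg W.1 (sg W.1 (φ.1 W (F.par W.1 (F.par W.1 s)))) = _
    rw [sg_sg, F.par_par])
  par_smul V a φ := Subtype.ext (by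
    funext W
    refine LinearMap.ext fun s => ?_
    exact map_mul (sg W.1) (resO W.2 a) _)
  res_par _ _ := rfl
  res_smul _ _ _ := rfl
  res_self _ _ := rfl
  res_res _ _ _ := rfl

/-- The action of a vector field on a function. -/
def act (V : Opens (Pn n)) (D : (tangent n).obj V) (f : O V) : O V :=
  (show tangentSec V from D).1 ⟨V, le_rfl⟩ f

/-- The value of a section of the dual sheaf on a section. -/
def pair (F : SMod n) (V : Opens (Pn n)) (φ : (dual F).obj V) (s : F.obj V) : O V :=
  (show dualSec F V from φ).1 ⟨V, le_rfl⟩ s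

/-- The differential `df ∈ T*`, `df(D) = D(f)`. -/
def diff (V : Opens (Pn n)) (f : O V) : (dual (tangent n)).obj V :=
  (⟨fun W =>
    { toFun := fun D => act W.1 D (resO W.2 f)
      map_add' := fun _ _ => rfl
      map_smul' := fun _ _ => rfl }, by
    intro W U h D
    exact (show tangentSec W.1 from D).2.1 ⟨W.1, le_rfl⟩ ⟨U.1, h⟩ h (resO W.2 f)⟩ :
    dualSec (tangent n) V)

/-- The sheaf of one-forms `ΠT*`. -/
abbrev OneForms (n : ℕ) : SMod n := shift (dual (tangent n))

/-- The sheaf `ΠT`. -/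
abbrev PiT (n : ℕ) : SMod n := shift (tangent n)

/-- The one-form `π(df)`: for an even coordinate `z` this is the odd form `dz`, for an odd
coordinate `θ` it is the even form `dθ`. -/
def d (V : Opens (Pn n)) (f : O V) : (OneForms n).obj V := pi _ V (diff V f)

/-! ### Symmetric superalgebras with some even elements inverted -/

section FormAlg

variable {A B : Type} [CommRing A] [Algebra ℂ A] [CommRing B] [Algebra ℂ B]
  {M N : Type} [AddCommGroup M] [Module A M] [AddCommGroup N] [Module B N]

/-- Generators: scalars, vectors, and inverses of the vectors in `S`. -/
inductive FormGen (A : Type) {M : Type} (S : Set M) : Type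
  | scal (a : A) : FormGen A S
  | vec (m : M) : FormGen A S
  | inv (s : S) : FormGen A S

open FormGen in
/-- The relations of the symmetric superalgebra of the supermodule `M` over `A`, with the elements
of `S` inverted. The parities are given by the involutions `σ` and `τ`, so that `x y = (-1)^{|x||y|} y x`
reads `x y = y x` for even `x` and `x y = y' x` for odd `x`, where `y'` is the image of `y` under the
parity involution. -/
inductive FormRel (σ : A →ₐ[ℂ] A) (τ : M →+ M) (S : Set M) :
    FreeAlgebra ℂ (FormGen A S) → FreeAlgebra ℂ (FormGen A S) → Prop
  | scal_const (c : ℂ) : FormRel σ τ S (FreeAlgebra.ι ℂ (scal (algebraMap ℂ A c)))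
      (algebraMap ℂ _ c)
  | scal_add (a b : A) : FormRel σ τ S (FreeAlgebra.ι ℂ (scal (a + b)))
      (FreeAlgebra.ι ℂ (scal a) + FreeAlgebra.ι ℂ (scal b))
  | scal_mul (a b : A) : FormRel σ τ S (FreeAlgebra.ι ℂ (scal (a * b)))
      (FreeAlgebra.ι ℂ (scal a) * FreeAlgebra.ι ℂ (scal b))
  | vec_add (x y : M) : FormRel σ τ S (FreeAlgebra.ι ℂ (vec (x + y)))
      (FreeAlgebra.ι ℂ (vec x) + FreeAlgebra.ι ℂ (vec y))
  | vec_smul (a : A) (x : M) : FormRel σ τ S (FreeAlgebra.ι ℂ (vec (a • x)))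
      (FreeAlgebra.ι ℂ (scal a) * FreeAlgebra.ι ℂ (vec x))
  | even_scal (a : A) (x : M) (ha : σ a = a) : FormRel σ τ S
      (FreeAlgebra.ι ℂ (scal a) * FreeAlgebra.ι ℂ (vec x))
      (FreeAlgebra.ι ℂ (vec x) * FreeAlgebra.ι ℂ (scal a))
  | odd_scal (a : A) (x : M) (ha : σ a = -a) : FormRel σ τ S
      (FreeAlgebra.ι ℂ (scal a) * FreeAlgebra.ι ℂ (vec x))
      (FreeAlgebra.ι ℂ (vec (τ x)) * FreeAlgebra.ι ℂ (scal a))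
  | even_vec (x y : M) (hx : τ x = x) : FormRel σ τ S
      (FreeAlgebra.ι ℂ (vec x) * FreeAlgebra.ι ℂ (vec y))
      (FreeAlgebra.ι ℂ (vec y) * FreeAlgebra.ι ℂ (vec x))
  | odd_vec (x y : M) (hx : τ x = -x) : FormRel σ τ S
      (FreeAlgebra.ι ℂ (vec x) * FreeAlgebra.ι ℂ (vec y))
      (FreeAlgebra.ι ℂ (vec (τ y)) * FreeAlgebra.ι ℂ (vec x))
  | inv_vec (s : S) : FormRel σ τ S
      (FreeAlgebra.ι ℂ (inv s) * FreeAlgebra.ι ℂ (vec s.1)) 1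
  | vec_inv (s : S) : FormRel σ τ S
      (FreeAlgebra.ι ℂ (vec s.1) * FreeAlgebra.ι ℂ (inv s)) 1

/-- The symmetric superalgebra of `M` over `A` with the elements of `S` inverted. -/
def FormAlg (σ : A →ₐ[ℂ] A) (τ : M →+ M) (S : Set M) : Type := RingQuot (FormRel σ τ S)

namespace FormAlg

variable (σ : A →ₐ[ℂ] A) (τ : M →+ M) (S : Set M)
  (σ' : B →ₐ[ℂ] B) (τ' : N →+ N) (S' : Set N)

instance : Ring (FormAlg σ τ S) := inferInstanceAs (Ring (RingQuot (FormRel σ τ S)))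

instance : Algebra ℂ (FormAlg σ τ S) := inferInstanceAs (Algebra ℂ (RingQuot (FormRel σ τ S)))

/-- The class of a generator. -/
def gen (x : FormGen A S) : FormAlg σ τ S :=
  RingQuot.mkAlgHom ℂ (FormRel σ τ S) (FreeAlgebra.ι ℂ x)

lemma rel {x y : FreeAlgebra ℂ (FormGen A S)} (h : FormRel σ τ S x y) :
    (RingQuot.mkAlgHom ℂ (FormRel σ τ S) x : FormAlg σ τ S) =
      RingQuot.mkAlgHom ℂ (FormRel σ τ S) y :=
  RingQuot.mkAlgHom_rel ℂ h

/-- The scalars. -/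
def scal : A →ₐ[ℂ] FormAlg σ τ S where
  toFun a := gen σ τ S (.scal a)
  map_one' := by
    have h := rel σ τ S (.scal_const 1)
    rw [map_one, map_one, map_one] at h
    exact h
  map_mul' a b := by
    have h := rel σ τ S (.scal_mul a b)
    rw [map_mul] at h
    exact h
  map_zero' := by
    have h := rel σ τ S (.scal_const 0)
    rw [map_zero, map_zero, map_zero] at h
    exact h
  map_add' a b := by
    have h := rel σ τ S (.scal_add a b)
    rw [map_add] at h
    exact h
  commutes' c := by
    have h := rel σ τ S (.scal_const c)
    rw [AlgHom.commutes] at h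
    exact h

/-- The vectors. -/
def vec : M →+ FormAlg σ τ S :=
  AddMonoidHom.mk' (fun m => gen σ τ S (.vec m)) (fun x y => by
    have h := rel σ τ S (.vec_add x y)
    rw [map_add] at h
    exact h)

/-- The inverses of the elements of `S`. -/
def inv (s : S) : FormAlg σ τ S := gen σ τ S (.inv s)

/-- Left multiplication by scalars. -/
instance : Module A (FormAlg σ τ S) := Module.compHom _ (scal σ τ S).toRingHom

lemma smul_def (a : A) (x : FormAlg σ τ S) : a • x = scal σ τ S a * x := rfl

variable {σ τ S σ' τ' S'}

lemma vec_smul (a : A) (x : M) : vec σ τ S (a • x) = a • vec σ τ S x := by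
  have h := rel σ τ S (.vec_smul a x)
  rw [map_mul] at h
  exact h

lemma even_scal {a : A} (ha : σ a = a) (x : M) :
    scal σ τ S a * vec σ τ S x = vec σ τ S x * scal σ τ S a := by
  have h := rel σ τ S (.even_scal a x ha)
  rw [map_mul, map_mul] at h
  exact h

lemma odd_scal {a : A} (ha : σ a = -a) (x : M) :
    scal σ τ S a * vec σ τ S x = vec σ τ S (τ x) * scal σ τ S a := by
  have h := rel σ τ S (.odd_scal a x ha)
  rw [map_mul, map_mul] at h
  exact h

lemma even_vec {x : M} (hx : τ x = x) (y : M) :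
    vec σ τ S x * vec σ τ S y = vec σ τ S y * vec σ τ S x := by
  have h := rel σ τ S (.even_vec x y hx)
  rw [map_mul, map_mul] at h
  exact h

lemma odd_vec {x : M} (hx : τ x = -x) (y : M) :
    vec σ τ S x * vec σ τ S y = vec σ τ S (τ y) * vec σ τ S x := by
  have h := rel σ τ S (.odd_vec x y hx)
  rw [map_mul, map_mul] at h
  exact h

lemma inv_vec (s : S) : inv σ τ S s * vec σ τ S s.1 = 1 := by
  have h := rel σ τ S (.inv_vec s)
  rw [map_mul, map_one] at h
  exact h

lemma vec_inv (s : S) : vec σ τ S s.1 * inv σ τ S s = 1 := by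
  have h := rel σ τ S (.vec_inv s)
  rw [map_mul, map_one] at h
  exact h

/-- Functoriality. -/
def map (f : A →ₐ[ℂ] B) (g : M →+ N) (hf : ∀ a, f (σ a) = σ' (f a)) (hg : ∀ x, g (τ x) = τ' (g x))
    (hfg : ∀ a x, g (a • x) = f a • g x) (hS : ∀ x ∈ S, g x ∈ S') :
    FormAlg σ τ S →ₐ[ℂ] FormAlg σ' τ' S' :=
  RingQuot.liftAlgHom ℂ ⟨FreeAlgebra.lift ℂ (fun x => match x with
    | .scal a => scal σ' τ' S' (f a)
    | .vec x => vec σ' τ' S' (g x)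
    | .inv s => inv σ' τ' S' ⟨g s.1, hS s.1 s.2⟩), by
    intro x y h
    cases h with
    | scal_const c => simp
    | scal_add a b => simp
    | scal_mul a b => simp
    | vec_add x y => simp
    | vec_smul a x => simp [hfg, vec_smul, smul_def]
    | even_scal a x ha => simpa using even_scal (by rw [← hf, ha]) (g x)
    | odd_scal a x ha => simpa [hg] using odd_scal (by rw [← hf, ha, map_neg]) (g x)
    | even_vec x y hx => simpa using even_vec (by rw [← hg, hx]) (g y)
    | odd_vec x y hx => simpa [hg] using odd_vec (by rw [← hg, hx, map_neg]) (g y)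
    | inv_vec s => simpa using inv_vec (⟨g s.1, hS s.1 s.2⟩ : S')
    | vec_inv s => simpa using vec_inv (⟨g s.1, hS s.1 s.2⟩ : S')⟩

section

variable (f : A →ₐ[ℂ] B) (g : M →+ N) (hf : ∀ a, f (σ a) = σ' (f a)) (hg : ∀ x, g (τ x) = τ' (g x))
    (hfg : ∀ a x, g (a • x) = f a • g x) (hS : ∀ x ∈ S, g x ∈ S')

lemma map_gen (x : FormGen A S) : map f g hf hg hfg hS (gen σ τ S x) =
    (match x with
    | .scal a => scal σ' τ' S' (f a)
    | .vec x => vec σ' τ' S' (g x)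
    | .inv s => inv σ' τ' S' ⟨g s.1, hS s.1 s.2⟩) := by
  unfold map gen
  erw [RingQuot.liftAlgHom_mkAlgHom_apply]
  simp

lemma map_scal (a : A) : map f g hf hg hfg hS (scal σ τ S a) = scal σ' τ' S' (f a) :=
  map_gen f g hf hg hfg hS (.scal a)

lemma map_vec (x : M) : map f g hf hg hfg hS (vec σ τ S x) = vec σ' τ' S' (g x) :=
  map_gen f g hf hg hfg hS (.vec x)

lemma map_inv (s : S) :
    map f g hf hg hfg hS (inv σ τ S s) = inv σ' τ' S' ⟨g s.1, hS s.1 s.2⟩ :=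
  map_gen f g hf hg hfg hS (.inv s)

end

lemma hom_ext {R : Type} [Ring R] [Algebra ℂ R] {φ ψ : FormAlg σ τ S →ₐ[ℂ] R}
    (h : ∀ x, φ (gen σ τ S x) = ψ (gen σ τ S x)) : φ = ψ := by
  apply RingQuot.ringQuot_ext'
  apply FreeAlgebra.hom_ext
  funext x
  exact h x

variable (σ τ S)

/-- The part of degree `d`: the span of the products of `r` vectors and `t` inverses, `r - t = d`. -/
def grade (d : ℤ) : Submodule A (FormAlg σ τ S) :=
  Submodule.span A {x | ∃ (l : List M) (t : List S), (l.length : ℤ) - t.length = d ∧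
    x = (l.map (vec σ τ S)).prod * (t.map (inv σ τ S)).prod}

variable {σ τ S}

lemma map_smul (f : A →ₐ[ℂ] B) (g : M →+ N) (hf : ∀ a, f (σ a) = σ' (f a))
    (hg : ∀ x, g (τ x) = τ' (g x)) (hfg : ∀ a x, g (a • x) = f a • g x) (hS : ∀ x ∈ S, g x ∈ S')
    (a : A) (x : FormAlg σ τ S) :
    map f g hf hg hfg hS (a • x) = f a • map f g hf hg hfg hS x := by
  rw [smul_def, smul_def, map_mul, map_scal]

lemma map_grade (f : A →ₐ[ℂ] B) (g : M →+ N) (hf : ∀ a, f (σ a) = σ' (f a))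
    (hg : ∀ x, g (τ x) = τ' (g x)) (hfg : ∀ a x, g (a • x) = f a • g x) (hS : ∀ x ∈ S, g x ∈ S')
    {d : ℤ} {x : FormAlg σ τ S} (hx : x ∈ grade σ τ S d) :
    map f g hf hg hfg hS x ∈ grade σ' τ' S' d := by
  induction hx using Submodule.span_induction with
  | mem x h =>
    obtain ⟨l, t, h, rfl⟩ := h
    refine Submodule.subset_span ⟨l.map g, t.map fun s => ⟨g s.1, hS s.1 s.2⟩, by simpa using h, ?_⟩
    rw [map_mul, map_list_prod, map_list_prod]
    simp only [List.map_map]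
    congr 2
    · exact List.map_congr_left fun x _ => map_vec f g hf hg hfg hS x
    · exact List.map_congr_left fun x _ => map_inv f g hf hg hfg hS x
  | zero => rw [map_zero]; exact zero_mem _
  | add x y _ _ hx hy => rw [map_add]; exact add_mem hx hy
  | smul a x _ hx => rw [map_smul]; exact Submodule.smul_mem _ _ hx

end FormAlg

end FormAlg

/-- The ambient superalgebra over `V`: the symmetric superalgebra of the sections of `F` over `V`,
with the sections in `S V` inverted. -/
abbrev FAlg (F : SMod n) (S : ∀ V, Set (F.obj V)) (V : Opens (Pn n)) : Type :=
  FormAlg (sg V) (F.par V) (S V)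

/-- Restriction. -/
def resForm (F : SMod n) (S : ∀ V, Set (F.obj V))
    (hres : ∀ {V W : Opens (Pn n)} (h : W ≤ V), ∀ x ∈ S V, F.res h x ∈ S W)
    {V W : Opens (Pn n)} (h : W ≤ V) : FAlg F S V →ₐ[ℂ] FAlg F S W :=
  FormAlg.map (resO h) (F.res h) (res_sg h) (F.res_par h) (F.res_smul h) (hres h)

/-- The parity involution. -/
def parForm (F : SMod n) (S : ∀ V, Set (F.obj V)) (hev : ∀ V, ∀ x ∈ S V, F.par V x = x)
    (V : Opens (Pn n)) : FAlg F S V →ₐ[ℂ] FAlg F S V :=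
  FormAlg.map (sg V) (F.par V) (fun _ => rfl) (fun _ => rfl) (F.par_smul V)
    (fun x hx => by rwa [hev V x hx])

/-- The part of degree `d` of the symmetric superalgebra of `F` with the even sections in `S`
inverted. -/
def form (F : SMod n) (S : ∀ V, Set (F.obj V)) (hev : ∀ V, ∀ x ∈ S V, F.par V x = x)
    (hres : ∀ {V W : Opens (Pn n)} (h : W ≤ V), ∀ x ∈ S V, F.res h x ∈ S W) (d : ℤ) : SMod n where
  obj V := FormAlg.grade (sg V) (F.par V) (S V) d
  grp _ := inferInstance
  mod _ := inferInstance
  par V := AddMonoidHom.mk' (fun x => ⟨parForm F S hev V x.1, FormAlg.map_grade _ _ _ _ _ _ x.2⟩)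
    (fun x y => Subtype.ext (map_add (parForm F S hev V) x.1 y.1))
  res h := AddMonoidHom.mk' (fun x => ⟨resForm F S hres h x.1, FormAlg.map_grade _ _ _ _ _ _ x.2⟩)
    (fun x y => Subtype.ext (map_add (resForm F S hres h) x.1 y.1))
  par_par V x := Subtype.ext (by
    have : (parForm F S hev V).comp (parForm F S hev V) = AlgHom.id ℂ _ := by
      refine FormAlg.hom_ext fun x => ?_
      rw [AlgHom.comp_apply, AlgHom.id_apply]
      cases x with
      | scal a =>
        exact (congrArg _ (FormAlg.map_scal _ _ _ _ _ _ a)).trans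
          ((FormAlg.map_scal _ _ _ _ _ _ _).trans (by rw [sg_sg]; rfl))
      | vec a =>
        exact (congrArg _ (FormAlg.map_vec _ _ _ _ _ _ a)).trans
          ((FormAlg.map_vec _ _ _ _ _ _ _).trans (by rw [F.par_par]; rfl))
      | inv a =>
        exact (congrArg _ (FormAlg.map_inv _ _ _ _ _ _ a)).trans
          ((FormAlg.map_inv _ _ _ _ _ _ _).trans (by simp only [F.par_par]; rfl))
    exact DFunLike.congr_fun this x.1)
  par_smul V a x := Subtype.ext (FormAlg.map_smul _ _ _ _ _ _ a x.1)
  res_par {V W} h x := Subtype.ext (by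
    have : (resForm F S hres h).comp (parForm F S hev V) =
        (parForm F S hev W).comp (resForm F S hres h) := by
      refine FormAlg.hom_ext fun x => ?_
      rw [AlgHom.comp_apply, AlgHom.comp_apply]
      cases x with
      | scal a =>
        exact (congrArg _ (FormAlg.map_scal _ _ _ _ _ _ a)).trans
          ((FormAlg.map_scal _ _ _ _ _ _ _).trans ((congrArg _ (res_sg h a)).trans
          ((congrArg _ (FormAlg.map_scal _ _ _ _ _ _ a)).trans
            (FormAlg.map_scal _ _ _ _ _ _ _)).symm))
      | vec a =>
        exact (congrArg _ (FormAlg.map_vec _ _ _ _ _ _ a)).trans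
          ((FormAlg.map_vec _ _ _ _ _ _ _).trans ((congrArg _ (F.res_par h a)).trans
          ((congrArg _ (FormAlg.map_vec _ _ _ _ _ _ a)).trans
            (FormAlg.map_vec _ _ _ _ _ _ _)).symm))
      | inv a =>
        exact (congrArg _ (FormAlg.map_inv _ _ _ _ _ _ a)).trans
          ((FormAlg.map_inv _ _ _ _ _ _ _).trans
          ((congrArg _ (Subtype.ext (F.res_par h a.1))).trans
          ((congrArg _ (FormAlg.map_inv _ _ _ _ _ _ a)).trans
            (FormAlg.map_inv _ _ _ _ _ _ _)).symm))
    exact DFunLike.congr_fun this x.1)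
  res_smul h a x := Subtype.ext (FormAlg.map_smul _ _ _ _ _ _ a x.1)
  res_self V x := Subtype.ext (by
    have : resForm F S hres (le_refl V) = AlgHom.id ℂ _ := by
      refine FormAlg.hom_ext fun x => ?_
      rw [AlgHom.id_apply]
      cases x with
      | scal a =>
        exact FormAlg.map_scal _ _ _ _ _ _ a
      | vec a =>
        exact (FormAlg.map_vec _ _ _ _ _ _ a).trans (by rw [F.res_self]; rfl)
      | inv a =>
        exact (FormAlg.map_inv _ _ _ _ _ _ a).trans (by simp only [F.res_self]; rfl)
    exact DFunLike.congr_fun this x.1)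
  res_res {V W U} h h' x := Subtype.ext (by
    have : (resForm F S hres h').comp (resForm F S hres h) = resForm F S hres (h'.trans h) := by
      refine FormAlg.hom_ext fun x => ?_
      rw [AlgHom.comp_apply]
      cases x with
      | scal a =>
        exact (congrArg _ (FormAlg.map_scal _ _ _ _ _ _ a)).trans
          ((FormAlg.map_scal _ _ _ _ _ _ _).trans ((congrArg _ (res_res_O h h' a)).trans
          (FormAlg.map_scal _ _ _ _ _ _ a).symm))
      | vec a =>
        exact (congrArg _ (FormAlg.map_vec _ _ _ _ _ _ a)).trans
          ((FormAlg.map_vec _ _ _ _ _ _ _).trans ((congrArg _ (F.res_res h h' a)).trans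
          (FormAlg.map_vec _ _ _ _ _ _ a).symm))
      | inv a =>
        exact (congrArg _ (FormAlg.map_inv _ _ _ _ _ _ a)).trans
          ((FormAlg.map_inv _ _ _ _ _ _ _).trans
          ((congrArg _ (Subtype.ext (F.res_res h h' a.1))).trans
          (FormAlg.map_inv _ _ _ _ _ _ a).symm))
    exact DFunLike.congr_fun this x.1)

/-- The supersymmetric power `Sym^d F` (zero for `d < 0`). -/
def Sym (F : SMod n) (d : ℤ) : SMod n :=
  form F (fun _ => ∅) (fun _ _ h => h.elim) (fun _ _ h => h.elim) d

/-- The underlying element of the symmetric superalgebra. -/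
def symVal {F : SMod n} {d : ℤ} {V : Opens (Pn n)} (x : (Sym F d).obj V) :
    FAlg F (fun _ => ∅) V :=
  (show FormAlg.grade (sg V) (F.par V) ∅ d from x).1

/-! ### Tensor products -/

open TensorProduct in
/-- The relations `x a ⊗ y = x ⊗ a y`, where `x a = (-1)^{|x||a|} a x`. -/
def tensorRel (F G : SMod n) (V : Opens (Pn n)) : Submodule (O V) (F.obj V ⊗[ℤ] G.obj V) :=
  Submodule.span (O V) {t | ∃ (a : O V) (x : F.obj V) (y : G.obj V),
    (sg V a = a ∧ t = (a • x) ⊗ₜ[ℤ] y - x ⊗ₜ[ℤ] (a • y)) ∨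
    (sg V a = -a ∧ t = (a • F.par V x) ⊗ₜ[ℤ] y - x ⊗ₜ[ℤ] (a • y))}

open TensorProduct in
/-- The semilinear map induced on tensor products over `ℤ`. -/
def tensorMap {F G : SMod n} {V W : Opens (Pn n)} (ρ : O V →+* O W) (f : F.obj V →+ F.obj W)
    (g : G.obj V →+ G.obj W) (hf : ∀ a x, f (a • x) = ρ a • f x) :
    (F.obj V ⊗[ℤ] G.obj V) →ₛₗ[ρ] (F.obj W ⊗[ℤ] G.obj W) where
  toFun := TensorProduct.map f.toIntLinearMap g.toIntLinearMap
  map_add' := map_add _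
  map_smul' a t := by
    induction t with
    | zero => simp
    | tmul x y => simp [TensorProduct.smul_tmul', hf]
    | add x y hx hy => rw [smul_add, map_add, map_add, smul_add, hx, hy]

open TensorProduct in
lemma tensorMap_tmul {F G : SMod n} {V W : Opens (Pn n)} (ρ : O V →+* O W)
    (f : F.obj V →+ F.obj W) (g : G.obj V →+ G.obj W) (hf : ∀ a x, f (a • x) = ρ a • f x) (x y) :
    tensorMap ρ f g hf (x ⊗ₜ[ℤ] y) = f x ⊗ₜ[ℤ] g y := rfl

lemma tensorMap_rel {F G : SMod n} {V W : Opens (Pn n)} (ρ : O V →+* O W) (f : F.obj V →+ F.obj W)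
    (g : G.obj V →+ G.obj W) (hf : ∀ a x, f (a • x) = ρ a • f x) (hg : ∀ a x, g (a • x) = ρ a • g x)
    (hρ : ∀ a, ρ (sg V a) = sg W (ρ a)) (hp : ∀ x, f (F.par V x) = F.par W (f x)) :
    tensorRel F G V ≤ (tensorRel F G W).comap (tensorMap ρ f g hf) := by
  refine Submodule.span_le.2 ?_
  rintro _ ⟨a, x, y, h⟩
  refine Submodule.subset_span ⟨ρ a, f x, g y, ?_⟩
  rcases h with ⟨ha, rfl⟩ | ⟨ha, rfl⟩
  · left
    refine ⟨by rw [← hρ, ha], ?_⟩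
    rw [map_sub, tensorMap_tmul, tensorMap_tmul, hf, hg]
  · right
    refine ⟨by rw [← hρ, ha, map_neg], ?_⟩
    rw [map_sub, tensorMap_tmul, tensorMap_tmul, hf, hg, hp]

open TensorProduct in
/-- The section `x ⊗ y`. -/
def tmk (F G : SMod n) (V : Opens (Pn n)) (x : F.obj V) (y : G.obj V) :
    (F.obj V ⊗[ℤ] G.obj V) ⧸ tensorRel F G V :=
  Submodule.Quotient.mk (x ⊗ₜ[ℤ] y)

open TensorProduct in
lemma tensor_ext {F G : SMod n} {V : Opens (Pn n)} {M : Type} [AddCommGroup M]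
    {φ ψ : ((F.obj V ⊗[ℤ] G.obj V) ⧸ tensorRel F G V) →+ M}
    (h : ∀ x y, φ (tmk F G V x y) = ψ (tmk F G V x y)) (t) : φ t = ψ t := by
  obtain ⟨t, rfl⟩ := Submodule.Quotient.mk_surjective _ t
  induction t with
  | zero => rw [Submodule.Quotient.mk_zero, map_zero, map_zero]
  | tmul x y => exact h x y
  | add x y hx hy => rw [Submodule.Quotient.mk_add, map_add, map_add, hx, hy]

/-- The parity involution of the tensor product. -/
def tensorPar (F G : SMod n) (V : Opens (Pn n)) :
    ((TensorProduct ℤ (F.obj V) (G.obj V)) ⧸ tensorRel F G V) →ₛₗ[(sg V).toRingHom]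
      ((TensorProduct ℤ (F.obj V) (G.obj V)) ⧸ tensorRel F G V) :=
  (tensorRel F G V).mapQ (tensorRel F G V)
    (tensorMap (sg V).toRingHom (F.par V) (G.par V) (F.par_smul V))
    (tensorMap_rel _ _ _ _ (G.par_smul V) (fun _ => rfl) (fun _ => rfl))

/-- Restriction of the tensor product. -/
def tensorRes (F G : SMod n) {V W : Opens (Pn n)} (h : W ≤ V) :
    ((TensorProduct ℤ (F.obj V) (G.obj V)) ⧸ tensorRel F G V) →ₛₗ[(resO h).toRingHom]
      ((TensorProduct ℤ (F.obj W) (G.obj W)) ⧸ tensorRel F G W) :=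
  (tensorRel F G V).mapQ (tensorRel F G W)
    (tensorMap (resO h).toRingHom (F.res h) (G.res h) (F.res_smul h))
    (tensorMap_rel _ _ _ _ (G.res_smul h) (res_sg h) (F.res_par h))

/-- The tensor product of supermodules over the structure sheaf. -/
def tensor (F G : SMod n) : SMod n where
  obj V := (TensorProduct ℤ (F.obj V) (G.obj V)) ⧸ tensorRel F G V
  grp _ := inferInstance
  mod _ := inferInstance
  par V := (tensorPar F G V).toAddMonoidHom
  res h := (tensorRes F G h).toAddMonoidHom
  par_par V s := tensor_ext
    (φ := (tensorPar F G V).toAddMonoidHom.comp (tensorPar F G V).toAddMonoidHom)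
    (ψ := AddMonoidHom.id _)
    (fun x y => congrArg₂ (tmk F G V) (F.par_par V x) (G.par_par V y)) s
  par_smul V a s := (tensorPar F G V).map_smulₛₗ a s
  res_par {V W} h s := tensor_ext
    (φ := (tensorRes F G h).toAddMonoidHom.comp (tensorPar F G V).toAddMonoidHom)
    (ψ := (tensorPar F G W).toAddMonoidHom.comp (tensorRes F G h).toAddMonoidHom)
    (fun x y => congrArg₂ (tmk F G W) (F.res_par h x) (G.res_par h y)) s
  res_smul h a s := (tensorRes F G h).map_smulₛₗ a s
  res_self V s := tensor_ext
    (φ := (tensorRes F G le_rfl).toAddMonoidHom) (ψ := AddMonoidHom.id _)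
    (fun x y => congrArg₂ (tmk F G V) (F.res_self V x) (G.res_self V y)) s
  res_res h h' s := tensor_ext
    (φ := (tensorRes F G h').toAddMonoidHom.comp (tensorRes F G h).toAddMonoidHom)
    (ψ := (tensorRes F G (h'.trans h)).toAddMonoidHom)
    (fun x y => congrArg₂ (tmk F G _) (F.res_res h h' x) (G.res_res h h' y)) s

/-- The section `x ⊗ y` of the tensor product. -/
def tmul (F G : SMod n) (V : Opens (Pn n)) (x : F.obj V) (y : G.obj V) : (tensor F G).obj V :=
  tmk F G V x y

/-! ### The Berezinian sheaf -/

/-- A homogeneous frame of rank `p|q` of `F` over `V`: an isomorphism of `O^{p|q}` with `F` on `V`. -/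
structure Frame (F : SMod n) (p q : ℕ) (V : Opens (Pn n)) where
  ev : Fin p → F.obj V
  od : Fin q → F.obj V
  par_ev : ∀ i, F.par V (ev i) = ev i
  par_od : ∀ i, F.par V (od i) = -od i
  indep : ∀ W (h : W ≤ V), LinearIndependent (O W) (fun i => F.res h (Sum.elim ev od i))
  span : ∀ W (h : W ≤ V), Submodule.span (O W) (Set.range fun i => F.res h (Sum.elim ev od i)) = ⊤

/-- Restriction of frames. -/
def Frame.res {F : SMod n} {p q : ℕ} {V W : Opens (Pn n)} (h : W ≤ V) (e : Frame F p q V) :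
    Frame F p q W where
  ev i := F.res h (e.ev i)
  od i := F.res h (e.od i)
  par_ev i := by rw [← F.res_par, e.par_ev]
  par_od i := by rw [← F.res_par, e.par_od, map_neg]
  indep U h' := by
    convert e.indep U (h'.trans h) using 2 with i
    rcases i with i | i <;> exact F.res_res h h' _
  span U h' := by
    convert e.span U (h'.trans h) using 4 with i
    rcases i with i | i <;> exact F.res_res h h' _

/-- The group `GL(p|q)` of even invertible supermatrices; an even supermatrix is invertible if and
only if its two diagonal blocks are. -/
structure SuperGL (p q : ℕ) (V : Opens (Pn n)) where
  mat : Matrix (Fin p ⊕ Fin q) (Fin p ⊕ Fin q) (O V)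
  even₁₁ : ∀ i j, sg V (mat (.inl i) (.inl j)) = mat (.inl i) (.inl j)
  odd₁₂ : ∀ i j, sg V (mat (.inl i) (.inr j)) = -mat (.inl i) (.inr j)
  odd₂₁ : ∀ i j, sg V (mat (.inr i) (.inl j)) = -mat (.inr i) (.inl j)
  even₂₂ : ∀ i j, sg V (mat (.inr i) (.inr j)) = mat (.inr i) (.inr j)
  unit₁₁ : IsUnit mat.toBlocks₁₁.det
  unit₂₂ : IsUnit mat.toBlocks₂₂.det

/-- The Berezinian `det(A - B D⁻¹ C) det(D)⁻¹` of the supermatrix with blocks `A, B, C, D`. -/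
def SuperGL.ber {p q : ℕ} {V : Opens (Pn n)} (g : SuperGL p q V) : O V :=
  (g.mat.toBlocks₁₁ - g.mat.toBlocks₁₂ * g.mat.toBlocks₂₂⁻¹ * g.mat.toBlocks₂₁).det *
    Ring.inverse g.mat.toBlocks₂₂.det

lemma SuperGL.sg_ber {p q : ℕ} {V : Opens (Pn n)} (g : SuperGL p q V) : sg V g.ber = g.ber := by
  have hA : g.mat.toBlocks₁₁.map (sg V) = g.mat.toBlocks₁₁ := by
    ext1 i j; exact g.even₁₁ i j
  have hB : g.mat.toBlocks₁₂.map (sg V) = -g.mat.toBlocks₁₂ := by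
    ext1 i j; exact g.odd₁₂ i j
  have hC : g.mat.toBlocks₂₁.map (sg V) = -g.mat.toBlocks₂₁ := by
    ext1 i j; exact g.odd₂₁ i j
  have hD : g.mat.toBlocks₂₂.map (sg V) = g.mat.toBlocks₂₂ := by
    ext1 i j; exact g.even₂₂ i j
  have hd : sg V g.mat.toBlocks₂₂.det = g.mat.toBlocks₂₂.det := by
    rw [AlgHom.map_det, AlgHom.mapMatrix_apply, hD]
  have hi : sg V (Ring.inverse g.mat.toBlocks₂₂.det) = Ring.inverse g.mat.toBlocks₂₂.det := by
    have h1 := congrArg (sg V) (Ring.mul_inverse_cancel _ g.unit₂₂)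
    rw [map_mul, hd, map_one] at h1
    have h2 := Ring.inverse_mul_cancel _ g.unit₂₂
    calc _ = Ring.inverse g.mat.toBlocks₂₂.det * g.mat.toBlocks₂₂.det *
          sg V (Ring.inverse g.mat.toBlocks₂₂.det) := by rw [h2, one_mul]
      _ = _ := by rw [mul_assoc, h1, mul_one]
  have hDi : (g.mat.toBlocks₂₂⁻¹).map (sg V) = g.mat.toBlocks₂₂⁻¹ := by
    symm
    apply Matrix.inv_eq_right_inv
    have h1 := congrArg (fun m => m.map (sg V)) (Matrix.mul_nonsing_inv _ g.unit₂₂)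
    simp only [Matrix.map_mul, hD] at h1
    rw [h1]
    exact Matrix.map_one _ (map_zero _) (map_one _)
  have hm : (g.mat.toBlocks₁₁ - g.mat.toBlocks₁₂ * g.mat.toBlocks₂₂⁻¹ * g.mat.toBlocks₂₁).map
      (sg V) = g.mat.toBlocks₁₁ - g.mat.toBlocks₁₂ * g.mat.toBlocks₂₂⁻¹ * g.mat.toBlocks₂₁ := by
    rw [Matrix.map_sub (sg V) (map_sub _), Matrix.map_mul, Matrix.map_mul, hA, hB, hC, hDi]
    simp
  rw [SuperGL.ber, map_mul, hi, AlgHom.map_det, AlgHom.mapMatrix_apply, hm]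

/-- Sections over `V` of the dual `ℋom(Ber F, O)` of the Berezinian of a sheaf `F` of rank `p|q`.
Here `Ber F` is the invertible sheaf with a generator `[e]` for each local frame `e` of `F`, subject
to `[g e] = Ber(g) [e]`; thus a linear functional on it is a compatible family of functions
`e ↦ φ([e])` on frames, with `φ([g e]) = Ber(g) φ([e])`. -/
def berDualSec (F : SMod n) (p q : ℕ) (V : Opens (Pn n)) :
    AddSubgroup (∀ W : Sub V, Frame F p q W.1 → O W.1) where
  carrier := {φ |
    (∀ (W U : Sub V) (h : U.1 ≤ W.1) (e : Frame F p q W.1), resO h (φ W e) = φ U (e.res h)) ∧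
    (∀ (W : Sub V) (e e' : Frame F p q W.1) (g : SuperGL p q W.1),
      (∀ i, Sum.elim e'.ev e'.od i = ∑ j, g.mat i j • Sum.elim e.ev e.od j) →
      φ W e' = g.ber * φ W e)}
  add_mem' := by
    rintro φ ψ ⟨h1, h2⟩ ⟨k1, k2⟩
    refine ⟨fun W U h e => ?_, fun W e e' g hg => ?_⟩
    · simp [h1 W U h e, k1 W U h e]
    · simp only [Pi.add_apply, h2 W e e' g hg, k2 W e e' g hg, mul_add]
  zero_mem' := by
    refine ⟨fun W U h e => ?_, fun W e e' g hg => ?_⟩ <;> simp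
  neg_mem' := by
    rintro φ ⟨h1, h2⟩
    refine ⟨fun W U h e => ?_, fun W e e' g hg => ?_⟩
    · simp [h1 W U h e]
    · simp only [Pi.neg_apply, h2 W e e' g hg, mul_neg]

/-- The sheaf `(Ber F)*` for `F` of rank `p|q`; the generators `[e]` have parity `p + q`. -/
def berDual (F : SMod n) (p q : ℕ) : SMod n where
  obj V := berDualSec F p q V
  grp _ := inferInstance
  mod V :=
    { smul := fun a φ => ⟨fun W e => resO W.2 a * φ.1 W e, by
        obtain ⟨h1, h2⟩ := φ.2
        refine ⟨fun W U h e => ?_, fun W e e' g hg => ?_⟩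
        · rw [map_mul, h1 W U h e]; rfl
        · change resO W.2 a * φ.1 W e' = g.ber * (resO W.2 a * φ.1 W e)
          rw [h2 W e e' g hg]; ring⟩
      one_smul := fun φ => Subtype.ext (by
        funext W e; change resO W.2 1 * φ.1 W e = _; rw [map_one, one_mul])
      mul_smul := fun a b φ => Subtype.ext (by
        funext W e
        change resO W.2 (a * b) * φ.1 W e = resO W.2 a * (resO W.2 b * φ.1 W e)
        rw [map_mul, mul_assoc])
      smul_zero := fun a => Subtype.ext (by
        funext W e; exact mul_zero (resO W.2 a))
      smul_add := fun a φ ψ => Subtype.ext (by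
        funext W e
        exact mul_add (resO W.2 a) (φ.1 W e) (ψ.1 W e))
      add_smul := fun a b φ => Subtype.ext (by
        funext W e
        change resO W.2 (a + b) * φ.1 W e = resO W.2 a * φ.1 W e + resO W.2 b * φ.1 W e
        rw [map_add, add_mul])
      zero_smul := fun φ => Subtype.ext (by
        funext W e
        change resO W.2 0 * φ.1 W e = 0
        rw [map_zero, zero_mul]) }
  par V := AddMonoidHom.mk' (fun φ => ⟨fun W e => (-1) ^ (p + q) * sg W.1 (φ.1 W e), by
        obtain ⟨h1, h2⟩ := φ.2
        refine ⟨fun W U h e => ?_, fun W e e' g hg => ?_⟩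
        · rw [map_mul, map_pow, map_neg, map_one, res_sg, h1 W U h e]
        · change (-1) ^ (p + q) * sg W.1 (φ.1 W e') =
            g.ber * ((-1) ^ (p + q) * sg W.1 (φ.1 W e))
          rw [h2 W e e' g hg, map_mul, g.sg_ber]; ring⟩)
      (fun φ ψ => Subtype.ext (by
        funext W e
        change (-1) ^ (p + q) * sg W.1 (φ.1 W e + ψ.1 W e) =
          (-1) ^ (p + q) * sg W.1 (φ.1 W e) + (-1) ^ (p + q) * sg W.1 (ψ.1 W e)
        rw [map_add, mul_add]))
  res h := AddMonoidHom.mk' (fun φ => ⟨fun W => φ.1 ⟨W.1, W.2.trans h⟩,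
        fun W U h' => φ.2.1 ⟨W.1, W.2.trans h⟩ ⟨U.1, U.2.trans h⟩ h',
        fun W => φ.2.2 ⟨W.1, W.2.trans h⟩⟩)
      (fun _ _ => rfl)
  par_par V φ := Subtype.ext (by
    funext W e
    change (-1) ^ (p + q) * sg W.1 ((-1) ^ (p + q) * sg W.1 (φ.1 W e)) = _
    rw [map_mul, map_pow, map_neg, map_one, sg_sg, ← mul_assoc, ← mul_pow]
    simp)
  par_smul V a φ := Subtype.ext (by
    funext W e
    change (-1) ^ (p + q) * sg W.1 (resO W.2 a * φ.1 W e) =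
      sg W.1 (resO W.2 a) * ((-1) ^ (p + q) * sg W.1 (φ.1 W e))
    rw [map_mul]; ring)
  res_par _ _ := rfl
  res_smul _ _ _ := rfl
  res_self _ _ := rfl
  res_res _ _ _ := rfl

/-- The Berezinian sheaf `(Ber ΠT*)*` of the projective superspace; `ΠT*` has rank `1|n`. -/
abbrev Ber (n : ℕ) : SMod n := berDual (OneForms n) 1 n

/-- The value of a section `D` of the Berezinian sheaf on the generator `[e]` of `Ber ΠT*`. -/
def berVal (V : Opens (Pn n)) (D : (Ber n).obj V) (e : Frame (OneForms n) 1 n V) : O V :=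
  (show berDualSec (OneForms n) 1 n V from D).1 ⟨V, le_rfl⟩ e

/-! ### Superforms, integral forms and the extended forms -/

/-- The even one-forms `dθ` of the standard charts, which are to be inverted. -/
def invSet (V : Opens (Pn n)) : Set ((OneForms n).obj V) :=
  {x | ∃ (i : Fin (n + 1)) (h : V ≤ chart i), x = d V (coordT h)}

lemma sg_coordT {V : Opens (Pn n)} {i : Fin (n + 1)} (h : V ≤ chart i) :
    sg V (coordT h) = -coordT h := by
  refine O.ext fun v => ?_
  change TrivSqZeroExt.inl (TrivSqZeroExt.inr (1 / v.1 i) : DualNumber ℂ).fst -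
    TrivSqZeroExt.inr (TrivSqZeroExt.inr (1 / v.1 i) : DualNumber ℂ).snd =
    -(TrivSqZeroExt.inr (1 / v.1 i) : DualNumber ℂ)
  ext <;> simp

lemma invSet_even (V : Opens (Pn n)) (x : (OneForms n).obj V) (hx : x ∈ invSet V) :
    (OneForms n).par V x = x := by
  obtain ⟨i, h, rfl⟩ := hx
  refine Subtype.ext (a1 := (show dualSec (tangent n) V from _))
    (a2 := (show dualSec (tangent n) V from _)) ?_
  funext W
  refine LinearMap.ext fun D => ?_
  change -(sg W.1 (sg W.1 (act W.1 D (sg W.1 (resO W.2 (coordT h)))))) =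
    act W.1 D (resO W.2 (coordT h))
  rw [sg_sg, ← res_sg, sg_coordT, map_neg]
  unfold act
  rw [map_neg, neg_neg]

lemma invSet_res {V W : Opens (Pn n)} (h : W ≤ V) (x : (OneForms n).obj V) (hx : x ∈ invSet V) :
    (OneForms n).res h x ∈ invSet W := by
  obtain ⟨i, hi, rfl⟩ := hx
  exact ⟨i, h.trans hi, rfl⟩

/-- Degree `d` part of `Sym^• ΠT*` with the forms `dθ` inverted: it is generated on a chart by the
expressions `dz_{i_1} ⋯ dz_{i_r} dθ^j` with `j ∈ ℤ` and `r + j = d`. -/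
def Ext (n : ℕ) (d : ℤ) : SMod n := form (OneForms n) invSet invSet_even invSet_res d

/-- The homomorphism from the symmetric superalgebra to its localization. -/
def inclAlg (V : Opens (Pn n)) :
    FAlg (OneForms n) (fun _ => ∅) V →ₐ[ℂ] FAlg (OneForms n) invSet V :=
  FormAlg.map (σ := sg V) (τ := (OneForms n).par V) (S := ∅)
    (σ' := sg V) (τ' := (OneForms n).par V) (S' := invSet V)
    (AlgHom.id ℂ (O V)) (AddMonoidHom.id _) (fun _ => rfl) (fun _ => rfl) (fun _ _ => rfl)
    (fun _ h => absurd h (Set.notMem_empty _))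

/-- Superforms may be regarded as extended forms. -/
def inclForm (n : ℕ) (d : ℤ) (V : Opens (Pn n)) (ω : (Sym (OneForms n) d).obj V) :
    (Ext n d).obj V :=
  (⟨inclAlg V (symVal ω), FormAlg.map_grade (S := ∅) _ _ _ _ _ _
      (show FormAlg.grade (sg V) ((OneForms n).par V) ∅ d from ω).2⟩ :
    FormAlg.grade (sg V) ((OneForms n).par V) (invSet V) d)

/-- The underlying element of the localized symmetric superalgebra. -/
def extVal {n : ℕ} {d : ℤ} {V : Opens (Pn n)} (x : (Ext n d).obj V) :
    FAlg (OneForms n) invSet V :=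
  (show FormAlg.grade (sg V) ((OneForms n).par V) (invSet V) d from x).1

/-- The sheaf `Sym^d ΠT*` of superforms of degree `d`. -/
def SuperForms (n : ℕ) (d : ℤ) : SMod n := glue (Sym (OneForms n) d)

/-- The sheaf `Ω^{d;0}` of superforms of degree `d`, extended by the inverse forms. -/
def ExtForms (n : ℕ) (d : ℤ) : SMod n := glue (Ext n d)

/-- The sheaf `Ω^{k;1} = Ber ⊗ Sym^{n-k} ΠT` of integral forms. -/
def IntegralForms (n : ℕ) (k : ℤ) : SMod n := glue (tensor (Ber n) (Sym (PiT n) (n - k)))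

/-- The sheaf `ΠBer ⊗ Sym^{n-k} ΠT`. -/
def PiBerSym (n : ℕ) (k : ℤ) : SMod n := glue (tensor (shift (Ber n)) (Sym (PiT n) (n - k)))

/-- The superform given by an element of `Sym^d ΠT*` over `V`. -/
def mkSuper {n : ℕ} {d : ℤ} {V : Opens (Pn n)} (ω : (Sym (OneForms n) d).obj V) :
    (SuperForms n d).obj V :=
  toGlue (Sym (OneForms n) d) V ω

/-- The extended form given by an element of the localized symmetric superalgebra over `V`. -/
def mkExt {n : ℕ} {d : ℤ} {V : Opens (Pn n)} (ω : (Ext n d).obj V) : (ExtForms n d).obj V :=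
  toGlue (Ext n d) V ω

/-- The integral form `D ⊗ P`. -/
def mkIntegral {n : ℕ} {k : ℤ} {V : Opens (Pn n)} (D : (Ber n).obj V)
    (P : (Sym (PiT n) (n - k)).obj V) : (IntegralForms n k).obj V :=
  toGlue (tensor (Ber n) (Sym (PiT n) (n - k))) V (tmul _ _ V D P)

/-- The section `πD ⊗ P` of `ΠBer ⊗ Sym^{n-k} ΠT`. -/
def mkPiBerSym {n : ℕ} {k : ℤ} {V : Opens (Pn n)} (D : (Ber n).obj V)
    (P : (Sym (PiT n) (n - k)).obj V) : (PiBerSym n k).obj V :=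
  toGlue (tensor (shift (Ber n)) (Sym (PiT n) (n - k))) V (tmul _ _ V (pi (Ber n) V D) P)

/-- The frames attached to the affine coordinates `z_1, …, z_n | θ` on an open set of the chart `i`:
the coordinate vector fields, the frame `dθ | dz_1, …, dz_n` of `ΠT*` and the corresponding
generator `D[dz|dθ]` of the Berezinian sheaf. -/
structure LocalFrames {V : Opens (Pn n)} {i : Fin (n + 1)} (h : V ≤ chart i) where
  pz : Fin n → (tangent n).obj V
  pt : (tangent n).obj V
  pz_z : ∀ l m, act V (pz l) (coordZ h m) = if l = m then 1 else 0
  pz_t : ∀ l, act V (pz l) (coordT h) = 0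
  pt_z : ∀ m, act V pt (coordZ h m) = 0
  pt_t : act V pt (coordT h) = 1
  frame : Frame (OneForms n) 1 n V
  frame_ev : ∀ j, frame.ev j = d V (coordT h)
  frame_od : ∀ l, frame.od l = d V (coordZ h l)
  gen : (Ber n).obj V
  gen_frame : berVal V gen frame = 1

/-- The vector `x ∈ F` in the ambient superalgebra. -/
abbrev vecF (F : SMod n) (S : ∀ V, Set (F.obj V)) (V : Opens (Pn n)) (x : F.obj V) : FAlg F S V :=
  FormAlg.vec (sg V) (F.par V) (S V) x

/-- The section `π∂_{z_{τ(n)}} ⊙ ⋯ ⊙ π∂_{z_{τ(s+1)}} ⊙ (π∂_θ)^a` of the symmetric superalgebra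
of `ΠT`. -/
def LocalFrames.poly {V : Opens (Pn n)} {i : Fin (n + 1)} {h : V ≤ chart i} (c : LocalFrames h)
    (τ : Equiv.Perm (Fin n)) (s a : ℕ) : FAlg (PiT n) (fun _ => ∅) V :=
  ((((List.finRange n).drop s).reverse.map
    fun l => vecF (PiT n) _ V (pi (tangent n) V (c.pz (τ l)))).prod) *
    vecF (PiT n) _ V (pi (tangent n) V c.pt) ^ a

/-- The extended form `dz_{τ(1)} ⋯ dz_{τ(s)} / dθ^b` on an open set of the chart `i`. -/
def invForm {V : Opens (Pn n)} {i : Fin (n + 1)} (h : V ≤ chart i)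
    (τ : Equiv.Perm (Fin n)) (s b : ℕ) : FAlg (OneForms n) invSet V :=
  ((((List.finRange n).take s).map fun l => vecF (OneForms n) invSet V (d V (coordZ h (τ l)))).prod) *
    FormAlg.inv (sg V) ((OneForms n).par V) (invSet V) ⟨d V (coordT h), i, h, rfl⟩ ^ b

/-- The family `Θ` is given in the standard charts by the Heaviside operator `Θ(ι_{∂θ})`, which
replaces `δ^{(a)}(dθ)` by `(-1)^a a! / dθ^{a+1}`; the integral form
`dz_{τ(1)} ⋯ dz_{τ(s)} δ^{(a)}(dθ)` is the section
`sgn(τ) D[dz|dθ] ⊗ π∂_{z_{τ(n)}} ⊙ ⋯ ⊙ π∂_{z_{τ(s+1)}} ⊙ (π∂_θ)^a`. -/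
def IsHeaviside (Θ : ∀ k : ℤ, OddHom (IntegralForms n k) (ExtForms n (k - 1))) : Prop :=
  ∀ (i : Fin (n + 1)) (V : Opens (Pn n)) (h : V ≤ chart i), ∃ c : LocalFrames h,
    ∀ (τ : Equiv.Perm (Fin n)) (s a : ℕ), s ≤ n → ∀ (k : ℤ), k = s - a →
    ∀ (P : (Sym (PiT n) (n - k)).obj V) (ω : (Ext n (k - 1)).obj V),
      symVal P = c.poly τ s a →
      extVal ω = (((Equiv.Perm.sign τ : ℤ) : ℂ) * ((-1) ^ a * (a.factorial : ℂ))) •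
        invForm h τ s (a + 1) →
      (Θ k).app V (mkIntegral c.gen P) = mkExt ω

end SuperProj

end

noncomputable section

namespace SuperProj

/-! ### Symmetric superalgebras: induction and lifting -/

namespace FormAlg

variable {A : Type} [CommRing A] [Algebra ℂ A] {M : Type} [AddCommGroup M] [Module A M]
  {σ : A →ₐ[ℂ] A} {τ : M →+ M} {S : Set M}

/-! On a chart the extended forms are spanned freely by the monomials `dz_I dθ^j` with `j ∈ ℤ`. The
symmetric superalgebra of `ΠT` acts on them from the right by contractions, which are right
superderivations (`SBasis.contr`). Put `vol = dz_1 ⋯ dz_n / dθ`. The morphism `Θ` sends `D ⊗ P` to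
the contraction with `P` of `vol` times the coefficient of `D`. A contraction with `π∂_{z_l}` strips
a letter `dz_l`, and contractions with `π∂_θ` differentiate `1/dθ`; this produces the sign of the
permutation and the factor `(-1)^a a!` of the Heaviside formula (`SBasis.contr_vol`).

This recipe does not depend on the chart. The contraction is intrinsic: two charts give right
superderivations with the same values on basis vectors (`SBasis.Compat.contr_eq`). The volume
element is rescaled by the inverse of the Berezinian of the change of frames (`SBasis.vol_change`),
while the coefficient of `D` is rescaled by the Berezinian, so their product is invariant
(`kappa_eq`). Two features of the space make the computation short: products of odd functions
vanish, because there is one odd coordinate, and the even coordinates of one chart do not involve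
the odd coordinate of another, so that `dz'` is a combination of the `dz` alone.

For the isomorphisms, look at the monomials of degree `k - 1`, namely `dz_I dθ^(k-1-|I|)`. If `|I| <
k` the exponent is nonnegative and the monomial is a superform. If `k ≤ |I|` the exponent is
negative, and the monomial is a nonzero constant times the contraction of `vol` with the `π∂_{z_l}`,
`l ∉ I`, and with `|I| - k` copies of `π∂_θ` (`SBasis.exists_contr_symMono`). Each monomial thus
comes from exactly one of the two summands. As the monomials span (`SBasis.grade_le_span_mono`) and
are independent (`SBasis.mono_independent`), the sum of `Θ ∘ π⁻¹` and the inclusion of superforms is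
bijective over every chart and for every `k` (`phi_incl_bijective`). For `k ≤ 0` there are no
superforms of degree `k - 1`; for `k > n` there are no polyvectors of degree `n - k`.

To apply this algebra, `T` and `T*` must be free on coordinate bases. This rests on Hadamard's
lemma: a derivation that kills the coordinates is zero (`act_eq_zero`). Finally, maps given over the
opens of the charts and compatible with restriction are glued (`ChartHom`). -/

theorem induction {p : FormAlg σ τ S → Prop} (hs : ∀ a, p (scal σ τ S a))
    (hv : ∀ x, p (vec σ τ S x)) (hi : ∀ s, p (inv σ τ S s))
    (hadd : ∀ x y, p x → p y → p (x + y)) (hmul : ∀ x y, p x → p y → p (x * y)) (x) : p x := by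
  obtain ⟨y, rfl⟩ := RingQuot.mkAlgHom_surjective ℂ (FormRel σ τ S) x
  induction y using FreeAlgebra.induction with
  | grade0 r =>
    have h := hs (algebraMap ℂ A r)
    rw [AlgHom.commutes] at h
    rw [AlgHom.commutes]
    exact h
  | grade1 x =>
    cases x with
    | scal a => exact hs a
    | vec a => exact hv a
    | inv a => exact hi a
  | mul a b ha hb => rw [map_mul]; exact hmul _ _ ha hb
  | add a b ha hb => rw [map_add]; exact hadd _ _ ha hb

/-- The universal property. -/
def lift {R : Type*} [Ring R] [Algebra ℂ R] (f : A →ₐ[ℂ] R) (g : M →+ R) (i : S → R)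
    (hsmul : ∀ a x, g (a • x) = f a * g x)
    (hes : ∀ a x, σ a = a → f a * g x = g x * f a)
    (hos : ∀ a x, σ a = -a → f a * g x = g (τ x) * f a)
    (hev : ∀ x y, τ x = x → g x * g y = g y * g x)
    (hov : ∀ x y, τ x = -x → g x * g y = g (τ y) * g x)
    (hiv : ∀ s, i s * g s.1 = 1) (hvi : ∀ s, g s.1 * i s = 1) :
    FormAlg σ τ S →ₐ[ℂ] R :=
  RingQuot.liftAlgHom ℂ ⟨FreeAlgebra.lift ℂ (fun x => match x with
    | .scal a => f a
    | .vec x => g x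
    | .inv s => i s), by
    intro x y h
    cases h with
    | scal_const c => simp
    | scal_add a b => simp
    | scal_mul a b => simp
    | vec_add x y => simp
    | vec_smul a x => simpa using hsmul a x
    | even_scal a x ha => simpa using hes a x ha
    | odd_scal a x ha => simpa using hos a x ha
    | even_vec x y hx => simpa using hev x y hx
    | odd_vec x y hx => simpa using hov x y hx
    | inv_vec s => simpa using hiv s
    | vec_inv s => simpa using hvi s⟩

section

variable {R : Type*} [Ring R] [Algebra ℂ R] (f : A →ₐ[ℂ] R) (g : M →+ R) (i : S → R)
    (hsmul : ∀ a x, g (a • x) = f a * g x)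
    (hes : ∀ a x, σ a = a → f a * g x = g x * f a)
    (hos : ∀ a x, σ a = -a → f a * g x = g (τ x) * f a)
    (hev : ∀ x y, τ x = x → g x * g y = g y * g x)
    (hov : ∀ x y, τ x = -x → g x * g y = g (τ y) * g x)
    (hiv : ∀ s, i s * g s.1 = 1) (hvi : ∀ s, g s.1 * i s = 1)

lemma lift_gen (x : FormGen A S) : lift f g i hsmul hes hos hev hov hiv hvi (gen σ τ S x) =
    (match x with
    | .scal a => f a
    | .vec x => g x
    | .inv s => i s) := by
  unfold lift gen
  erw [RingQuot.liftAlgHom_mkAlgHom_apply]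
  simp

lemma lift_scal (a : A) : lift f g i hsmul hes hos hev hov hiv hvi (scal σ τ S a) = f a :=
  lift_gen f g i hsmul hes hos hev hov hiv hvi (.scal a)

lemma lift_vec (x : M) : lift f g i hsmul hes hos hev hov hiv hvi (vec σ τ S x) = g x :=
  lift_gen f g i hsmul hes hos hev hov hiv hvi (.vec x)

lemma lift_inv (s : S) : lift f g i hsmul hes hos hev hov hiv hvi (inv σ τ S s) = i s :=
  lift_gen f g i hsmul hes hos hev hov hiv hvi (.inv s)

end

end FormAlg

/-! ### Supermodules with a homogeneous basis of rank `1|n`, and maps out of their symmetric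
superalgebras -/

/-- A scalar superalgebra (with parity involution `σ`) in which odd elements multiply to zero, and a
supermodule over it (with parity involution `τ`). -/
structure IsSuper {A : Type} [CommRing A] [Algebra ℂ A] {M : Type} [AddCommGroup M] [Module A M]
    (σ : A →ₐ[ℂ] A) (τ : M →+ M) : Prop where
  σσ : ∀ a, σ (σ a) = a
  ττ : ∀ x, τ (τ x) = x
  τ_smul : ∀ a x, τ (a • x) = σ a • τ x
  odd_mul : ∀ x a, σ x = -x → x * σ a = x * a

/-- A homogeneous basis of rank `1|n` of a supermodule, with its coordinate functionals. -/
structure SBasis {A : Type} [CommRing A] [Algebra ℂ A] {M : Type} [AddCommGroup M] [Module A M]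
    (σ : A →ₐ[ℂ] A) (τ : M →+ M) (n : ℕ) where
  e : M
  o : Fin n → M
  ce : M →ₗ[A] A
  co : Fin n → M →ₗ[A] A
  expand : ∀ x, x = ce x • e + ∑ l, co l x • o l
  ce_e : ce e = 1
  ce_o : ∀ l, ce (o l) = 0
  co_e : ∀ l, co l e = 0
  co_o : ∀ l m, co l (o m) = if l = m then 1 else 0
  τ_e : τ e = e
  τ_o : ∀ l, τ (o l) = -o l

section Lift

variable {A : Type} [CommRing A] [Algebra ℂ A] {M : Type} [AddCommGroup M] [Module A M]
  {σ : A →ₐ[ℂ] A} {τ : M →+ M} {S : Set M} {n : ℕ}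

lemma IsSuper.even_of_add (H : IsSuper σ τ) (a : A) : σ (a + σ a) = a + σ a := by
  rw [map_add, H.σσ, add_comm]

lemma IsSuper.odd_of_sub (H : IsSuper σ τ) (a : A) : σ (a - σ a) = -(a - σ a) := by
  rw [map_sub, H.σσ, neg_sub]

/-- Two is invertible in a `ℂ`-algebra. This is how anticommutation yields vanishing squares. -/
lemma eq_zero_of_add_self {R : Type*} [Ring R] [Algebra ℂ R] {x : R} (h : x + x = 0) : x = 0 := by
  have h2 : (2 : ℂ) • x = 0 := by rw [two_smul, h]
  have h3 := congrArg (fun y => (2⁻¹ : ℂ) • y) h2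
  simpa [smul_smul] using h3

/-- With both factors odd, `odd_mul` reads `-(x * y) = x * y`. This is the algebraic trace of having
a single odd coordinate. -/
lemma IsSuper.odd_mul_odd (H : IsSuper σ τ) {x y : A} (hx : σ x = -x) (hy : σ y = -y) :
    x * y = 0 := by
  have h := H.odd_mul x y hx
  rw [hy, mul_neg] at h
  exact eq_zero_of_add_self (by nth_rw 1 [← h]; simp)

namespace SBasis

variable (b : SBasis σ τ n)

lemma tau_expand (H : IsSuper σ τ) (x : M) :
    τ x = σ (b.ce x) • b.e + ∑ l, (-σ (b.co l x)) • b.o l := by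
  conv_lhs => rw [b.expand x]
  rw [map_add, H.τ_smul, b.τ_e, map_sum]
  congr 1
  refine Finset.sum_congr rfl fun l _ => ?_
  rw [H.τ_smul, b.τ_o, smul_neg, neg_smul]

lemma ce_tau (H : IsSuper σ τ) (x : M) : b.ce (τ x) = σ (b.ce x) := by
  rw [b.tau_expand H]
  simp [b.ce_e, b.ce_o]

lemma co_tau (H : IsSuper σ τ) (l : Fin n) (x : M) : b.co l (τ x) = -σ (b.co l x) := by
  rw [b.tau_expand H]
  simp [b.co_e, b.co_o]

lemma linearIndependent :
    LinearIndependent A (Sum.elim (fun _ : Fin 1 => b.e) b.o) := by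
  rw [Fintype.linearIndependent_iff]
  intro g hg
  rw [Fintype.sum_sum_type] at hg
  simp only [Sum.elim_inl, Sum.elim_inr, Finset.univ_unique, Finset.sum_singleton] at hg
  rintro (i | l)
  · have := congrArg b.ce hg
    rw [Subsingleton.elim i default]
    simpa [b.ce_e, b.ce_o] using this
  · have := congrArg (b.co l) hg
    simpa [b.co_e, b.co_o] using this

lemma span_eq_top :
    Submodule.span A (Set.range (Sum.elim (fun _ : Fin 1 => b.e) b.o)) = ⊤ := by
  refine eq_top_iff.2 fun x _ => ?_
  rw [b.expand x]
  refine add_mem (Submodule.smul_mem _ _ (Submodule.subset_span ⟨.inl 0, rfl⟩))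
    (sum_mem fun l _ => Submodule.smul_mem _ _ (Submodule.subset_span ⟨.inr l, rfl⟩))

section

variable {R : Type*} [Ring R] [Algebra ℂ R] (f : A →ₐ[ℂ] R) (E : R) (O : Fin n → R)

/-- The additive map on `M` determined by the images of the scalars and of the basis. -/
def vecMap : M →+ R :=
  AddMonoidHom.mk' (fun x => f (b.ce x) * E + ∑ l, f (b.co l x) * O l) (fun x y => by
    simp only [map_add, add_mul, Finset.sum_add_distrib]; abel)

lemma vecMap_apply (x : M) : b.vecMap f E O x = f (b.ce x) * E + ∑ l, f (b.co l x) * O l := rfl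

lemma vecMap_smul (a : A) (x : M) : b.vecMap f E O (a • x) = f a * b.vecMap f E O x := by
  simp [vecMap_apply, mul_add, Finset.mul_sum, mul_assoc]

@[simp] lemma vecMap_e : b.vecMap f E O b.e = E := by simp [vecMap_apply, b.ce_e, b.co_e]

@[simp] lemma vecMap_o (l : Fin n) : b.vecMap f E O (b.o l) = O l := by
  simp only [vecMap_apply, b.ce_o, b.co_o, map_zero, zero_mul, zero_add]
  rw [Finset.sum_eq_single l] <;> simp +contextual

variable (H : IsSuper σ τ) (hE : ∀ a, f a * E = E * f a) (hO : ∀ a l, f a * O l = O l * f (σ a))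
  (hEO : ∀ l, E * O l = O l * E) (hOO : ∀ l m, O l * O m = -(O m * O l))
include H hE hO

/-- An even vector has an even coefficient at `e` and odd coefficients at the `o l`. Moving a scalar
past `O l` twists it by `σ`, and the twist is invisible next to an odd coefficient. -/
lemma vecMap_even_scal {x : M} (hx : τ x = x) (a : A) :
    b.vecMap f E O x * f a = f a * b.vecMap f E O x := by
  have hp : ∀ l, σ (b.co l x) = -b.co l x := fun l => by
    have := b.co_tau H l x; rw [hx] at this; exact (neg_eq_iff_eq_neg.2 this).symm
  rw [vecMap_apply, add_mul, mul_add, Finset.sum_mul, Finset.mul_sum]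
  congr 1
  · rw [mul_assoc, ← hE, ← mul_assoc, ← map_mul, ← mul_assoc, ← map_mul, mul_comm]
  · refine Finset.sum_congr rfl fun l _ => ?_
    have h1 : O l * f a = f (σ a) * O l := by rw [hO, H.σσ]
    rw [mul_assoc, h1, ← mul_assoc, ← map_mul, H.odd_mul _ _ (hp l), ← mul_assoc, ← map_mul,
      mul_comm]

/-- Here the coefficients at the `o l` are even and keep the twist, while the odd coefficient at `e`
absorbs it. -/
lemma vecMap_odd_scal {x : M} (hx : τ x = -x) (a : A) :
    b.vecMap f E O x * f a = f (σ a) * b.vecMap f E O x := by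
  have hq : σ (b.ce x) = -b.ce x := by rw [← b.ce_tau H, hx, map_neg]
  rw [vecMap_apply, add_mul, mul_add, Finset.sum_mul, Finset.mul_sum]
  congr 1
  · rw [mul_assoc, ← hE, ← mul_assoc, ← map_mul, ← mul_assoc, ← map_mul, mul_comm (σ a),
      H.odd_mul _ _ hq]
  · refine Finset.sum_congr rfl fun l _ => ?_
    have h1 : O l * f a = f (σ a) * O l := by rw [hO, H.σσ]
    rw [mul_assoc, h1, ← mul_assoc, ← map_mul, ← mul_assoc, ← map_mul, mul_comm]

lemma odd_scal_vecMap {a : A} (ha : σ a = -a) (x : M) :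
    f a * b.vecMap f E O x = b.vecMap f E O (τ x) * f a := by
  rw [vecMap_apply, vecMap_apply, add_mul, mul_add, Finset.sum_mul, Finset.mul_sum]
  congr 1
  · rw [mul_assoc, ← hE, ← mul_assoc, ← map_mul, ← mul_assoc, ← map_mul, b.ce_tau H,
      mul_comm _ a, H.odd_mul _ _ ha]
  · refine Finset.sum_congr rfl fun l _ => ?_
    have h1 : O l * f a = f (σ a) * O l := by rw [hO, H.σσ]
    rw [mul_assoc, h1, ← mul_assoc, ← map_mul, ← mul_assoc, ← map_mul, b.co_tau H, ha, neg_mul_neg,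
      mul_comm _ a, H.odd_mul _ _ ha]

include hEO hOO

lemma vecMap_even_vec {x : M} (hx : τ x = x) (y : M) :
    b.vecMap f E O x * b.vecMap f E O y = b.vecMap f E O y * b.vecMap f E O x := by
  have hs := b.vecMap_even_scal f E O H hE hO hx
  have hq : σ (b.ce x) = b.ce x := by rw [← b.ce_tau H, hx]
  have hp : ∀ l, σ (b.co l x) = -b.co l x := fun l => by
    have := b.co_tau H l x; rw [hx] at this; exact (neg_eq_iff_eq_neg.2 this).symm
  have h1 : b.vecMap f E O x * E = E * b.vecMap f E O x := by
    rw [vecMap_apply, add_mul, mul_add, Finset.sum_mul, Finset.mul_sum]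
    congr 1
    · rw [← mul_assoc, ← hE]
    · refine Finset.sum_congr rfl fun l _ => ?_
      rw [mul_assoc, ← hEO, ← mul_assoc, ← mul_assoc, hE]
  have h2 : ∀ m, b.vecMap f E O x * O m = O m * b.vecMap f E O x := by
    intro m
    rw [vecMap_apply, add_mul, mul_add, Finset.sum_mul, Finset.mul_sum]
    congr 1
    · rw [mul_assoc, hEO, ← mul_assoc, ← mul_assoc, hO, hq]
    · refine Finset.sum_congr rfl fun l _ => ?_
      rw [mul_assoc, hOO, mul_neg, ← mul_assoc, ← mul_assoc, hO, hp, map_neg, mul_neg, neg_mul,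
        neg_neg]
  -- Only the commutation of this element with scalars, `E` and the `O m` matters from here on;
  -- making it opaque leaves `y` as the only vector to expand.
  generalize b.vecMap f E O x = X at *
  rw [vecMap_apply, add_mul, mul_add, Finset.sum_mul, Finset.mul_sum]
  congr 1
  · rw [← mul_assoc, hs, mul_assoc, h1, mul_assoc]
  · refine Finset.sum_congr rfl fun l _ => ?_
    rw [← mul_assoc, hs, mul_assoc, h2, mul_assoc]

lemma vecMap_odd_vec {x : M} (hx : τ x = -x) (y : M) :
    b.vecMap f E O x * b.vecMap f E O y = b.vecMap f E O (τ y) * b.vecMap f E O x := by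
  have hs := b.vecMap_odd_scal f E O H hE hO hx
  have hq : σ (b.ce x) = -b.ce x := by rw [← b.ce_tau H, hx, map_neg]
  have hp : ∀ l, σ (b.co l x) = b.co l x := fun l => by
    have := b.co_tau H l x; rw [hx, map_neg] at this; exact (neg_injective this).symm
  have h1 : b.vecMap f E O x * E = E * b.vecMap f E O x := by
    rw [vecMap_apply, add_mul, mul_add, Finset.sum_mul, Finset.mul_sum]
    congr 1
    · rw [← mul_assoc, ← hE]
    · refine Finset.sum_congr rfl fun l _ => ?_
      rw [mul_assoc, ← hEO, ← mul_assoc, ← mul_assoc, hE]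
  have h2 : ∀ m, b.vecMap f E O x * O m = -(O m * b.vecMap f E O x) := by
    intro m
    rw [vecMap_apply, add_mul, mul_add, Finset.sum_mul, Finset.mul_sum, neg_add,
      ← Finset.sum_neg_distrib]
    congr 1
    · rw [mul_assoc, hEO, ← mul_assoc, ← mul_assoc, hO, hq, map_neg, mul_neg, neg_mul]
    · refine Finset.sum_congr rfl fun l _ => ?_
      rw [mul_assoc, hOO, mul_neg, ← mul_assoc, ← mul_assoc, hO, hp]
  generalize b.vecMap f E O x = X at *
  rw [vecMap_apply, vecMap_apply, add_mul, mul_add, Finset.sum_mul, Finset.mul_sum]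
  congr 1
  · rw [← mul_assoc, hs, mul_assoc, h1, mul_assoc, b.ce_tau H]
  · refine Finset.sum_congr rfl fun l _ => ?_
    rw [← mul_assoc, hs, mul_assoc, h2, mul_assoc, b.co_tau H, mul_neg, map_neg, neg_mul]

/-- Homomorphisms out of the symmetric superalgebra of a free supermodule. -/
def lift (i : S → R) (hiv : ∀ s, i s * b.vecMap f E O s.1 = 1)
    (hvi : ∀ s, b.vecMap f E O s.1 * i s = 1) : FormAlg σ τ S →ₐ[ℂ] R :=
  FormAlg.lift f (b.vecMap f E O) i (b.vecMap_smul f E O)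
    (fun a x ha => by
      rw [vecMap_apply, add_mul, mul_add, Finset.sum_mul, Finset.mul_sum]
      congr 1
      · rw [mul_assoc, ← hE, ← mul_assoc, ← map_mul, ← mul_assoc, ← map_mul, mul_comm]
      · refine Finset.sum_congr rfl fun l _ => ?_
        have h1 : O l * f a = f a * O l := by rw [hO, ha]
        rw [mul_assoc, h1, ← mul_assoc, ← map_mul, ← mul_assoc, ← map_mul, mul_comm])
    (fun a x ha => b.odd_scal_vecMap f E O H hE hO ha x)
    (fun x y hx => b.vecMap_even_vec f E O H hE hO hEO hOO hx y)
    (fun x y hx => b.vecMap_odd_vec f E O H hE hO hEO hOO hx y) hiv hvi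

section

variable (i : S → R) (hiv : ∀ s, i s * b.vecMap f E O s.1 = 1)
  (hvi : ∀ s, b.vecMap f E O s.1 * i s = 1)

lemma lift_scal (a : A) :
    b.lift f E O H hE hO hEO hOO i hiv hvi (FormAlg.scal σ τ S a) = f a :=
  FormAlg.lift_scal ..

lemma lift_vec (x : M) :
    b.lift f E O H hE hO hEO hOO i hiv hvi (FormAlg.vec σ τ S x) = b.vecMap f E O x :=
  FormAlg.lift_vec ..

lemma lift_inv (s : S) :
    b.lift f E O H hE hO hEO hOO i hiv hvi (FormAlg.inv σ τ S s) = i s :=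
  FormAlg.lift_inv ..

end

end

end SBasis

end Lift

section Contraction

variable {A : Type} [CommRing A] [Algebra ℂ A] {M : Type} [AddCommGroup M] [Module A M]
  {σ : A →ₐ[ℂ] A} {τ : M →+ M} {S : Set M} {n : ℕ}

/-! ### Commutation rules -/

namespace FormAlg

/-- The parity involution of the symmetric superalgebra. -/
def parAlg (H : IsSuper σ τ) (hS : ∀ x ∈ S, τ x = x) : FormAlg σ τ S →ₐ[ℂ] FormAlg σ τ S :=
  FormAlg.map σ τ (fun _ => rfl) (fun _ => rfl) H.τ_smul (fun x hx => by rwa [hS x hx])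

section

variable (H : IsSuper σ τ) (hS : ∀ x ∈ S, τ x = x)

@[simp] lemma parAlg_scal (a : A) : parAlg H hS (scal σ τ S a) = scal σ τ S (σ a) :=
  map_scal ..

@[simp] lemma parAlg_vec (x : M) : parAlg H hS (vec σ τ S x) = vec σ τ S (τ x) :=
  map_vec ..

@[simp] lemma parAlg_inv (s : S) : parAlg H hS (inv σ τ S s) = inv σ τ S s := by
  unfold parAlg
  rw [map_inv]
  congr 1
  exact Subtype.ext (hS _ s.2)

end

/-- The elements `a + σ a` and `a - σ a` are even and odd. Since `FormRel` only mentions homogeneous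
scalars, additive statements about scalars are reduced to that case. -/
lemma split_even_odd (H : IsSuper σ τ) {p : A → Prop} (hadd : ∀ a b, p a → p b → p (a + b))
    (he : ∀ a, σ a = a → p a) (ho : ∀ a, σ a = -a → p a) (a : A) : p a := by
  have h : a = (2⁻¹ : ℂ) • (a + σ a) + (2⁻¹ : ℂ) • (a - σ a) := by
    rw [← smul_add, add_add_sub_cancel, ← two_smul ℂ a, smul_smul]; norm_num
  rw [h]
  exact hadd _ _ (he _ (by rw [_root_.map_smul, H.even_of_add])) (ho _ (by
    rw [_root_.map_smul, H.odd_of_sub, smul_neg]))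

lemma scal_mul_even (H : IsSuper σ τ) {x : M} (hx : τ x = x) (a : A) :
    scal σ τ S a * vec σ τ S x = vec σ τ S x * scal σ τ S a := by
  refine split_even_odd H (p := fun a => scal σ τ S a * vec σ τ S x = vec σ τ S x * scal σ τ S a)
    (fun a b ha hb => by rw [map_add, add_mul, mul_add, ha, hb])
    (fun a ha => even_scal ha x) (fun a ha => ?_) a
  rw [odd_scal ha, hx]

lemma scal_mul_odd (H : IsSuper σ τ) {x : M} (hx : τ x = -x) (a : A) :
    scal σ τ S a * vec σ τ S x = vec σ τ S x * scal σ τ S (σ a) := by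
  refine split_even_odd H
    (p := fun a => scal σ τ S a * vec σ τ S x = vec σ τ S x * scal σ τ S (σ a))
    (fun a b ha hb => by rw [map_add, add_mul, map_add, map_add, mul_add, ha, hb])
    (fun a ha => by rw [ha, even_scal ha x]) (fun a ha => ?_) a
  rw [odd_scal ha, hx, ha, map_neg, map_neg, neg_mul, mul_neg]

lemma inv_comm_of_comm {y : FormAlg σ τ S} (s : S)
    (h : y * vec σ τ S s.1 = vec σ τ S s.1 * y) : y * inv σ τ S s = inv σ τ S s * y := by
  calc y * inv σ τ S s = inv σ τ S s * vec σ τ S s.1 * y * inv σ τ S s := by rw [inv_vec, one_mul]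
    _ = inv σ τ S s * (y * vec σ τ S s.1) * inv σ τ S s := by rw [h]; noncomm_ring
    _ = inv σ τ S s * y * (vec σ τ S s.1 * inv σ τ S s) := by noncomm_ring
    _ = _ := by rw [vec_inv, mul_one]

/-- Centrality spreads from generators to products. The inverses cause no sign because the elements
of `S` are even. -/
lemma scal_even_comm (H : IsSuper σ τ) (hS : ∀ x ∈ S, τ x = x) {a : A} (ha : σ a = a)
    (w : FormAlg σ τ S) : scal σ τ S a * w = w * scal σ τ S a := by
  induction w using FormAlg.induction with
  | hs c => rw [← map_mul, mul_comm, map_mul]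
  | hv x => exact even_scal ha x
  | hi s => exact inv_comm_of_comm s (scal_mul_even H (hS _ s.2) a)
  | hadd x y hx hy => rw [mul_add, add_mul, hx, hy]
  | hmul x y hx hy => rw [← mul_assoc, hx, mul_assoc, hy, mul_assoc]

lemma scal_odd_comm (H : IsSuper σ τ) (hS : ∀ x ∈ S, τ x = x) {a : A} (ha : σ a = -a)
    (w : FormAlg σ τ S) : scal σ τ S a * w = parAlg H hS w * scal σ τ S a := by
  induction w using FormAlg.induction with
  | hs c => rw [parAlg_scal, ← map_mul, ← map_mul, mul_comm _ a, H.odd_mul _ _ ha]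
  | hv x => rw [parAlg_vec]; exact odd_scal ha x
  | hi s => rw [parAlg_inv]; exact inv_comm_of_comm s (scal_mul_even H (hS _ s.2) a)
  | hadd x y hx hy => rw [mul_add, map_add, add_mul, hx, hy]
  | hmul x y hx hy => rw [← mul_assoc, hx, mul_assoc, hy, map_mul, mul_assoc]

lemma vec_even_comm (H : IsSuper σ τ) (hS : ∀ x ∈ S, τ x = x) {x : M} (hx : τ x = x)
    (w : FormAlg σ τ S) : vec σ τ S x * w = w * vec σ τ S x := by
  induction w using FormAlg.induction with
  | hs c => exact (scal_mul_even H hx c).symm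
  | hv y => exact even_vec hx y
  | hi s => exact inv_comm_of_comm s (even_vec hx _)
  | hadd y z hy hz => rw [mul_add, add_mul, hy, hz]
  | hmul y z hy hz => rw [← mul_assoc, hy, mul_assoc, hz, mul_assoc]

lemma inv_comm (H : IsSuper σ τ) (hS : ∀ x ∈ S, τ x = x) (s : S)
    (w : FormAlg σ τ S) : w * inv σ τ S s = inv σ τ S s * w :=
  inv_comm_of_comm s (vec_even_comm H hS (hS _ s.2) w).symm

lemma parAlg_parAlg (H : IsSuper σ τ) (hS : ∀ x ∈ S, τ x = x) (w : FormAlg σ τ S) :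
    parAlg H hS (parAlg H hS w) = w := by
  induction w using FormAlg.induction with
  | hs c => simp [H.σσ]
  | hv x => simp [H.ττ]
  | hi s => simp
  | hadd x y hx hy => rw [map_add, map_add, hx, hy]
  | hmul x y hx hy => rw [map_mul, map_mul, hx, hy]

end FormAlg

/-! ### Right contractions -/

/-- A right superderivation with twist `N` that vanishes on scalars. -/
structure IsRightDer (N : FormAlg σ τ S →ₐ[ℂ] FormAlg σ τ S)
    (X : FormAlg σ τ S →ₗ[ℂ] FormAlg σ τ S) : Prop where
  scal : ∀ a, X (FormAlg.scal σ τ S a) = 0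
  mul : ∀ x y, X (x * y) = x * X y + X x * N y

namespace IsRightDer

variable {N : FormAlg σ τ S →ₐ[ℂ] FormAlg σ τ S} {X : FormAlg σ τ S →ₗ[ℂ] FormAlg σ τ S}
  (hX : IsRightDer N X)
include hX

lemma scal_mul (a : A) (w : FormAlg σ τ S) :
    X (FormAlg.scal σ τ S a * w) = FormAlg.scal σ τ S a * X w := by
  rw [hX.mul, hX.scal, zero_mul, add_zero]

lemma one : X 1 = 0 := by
  have := hX.scal 1
  rwa [map_one] at this

/-- Apply the product rule to `s * s⁻¹ = 1`. Hence a right superderivation is determined by its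
values on vectors. -/
lemma inv (s : S) : X (FormAlg.inv σ τ S s) =
    -(FormAlg.inv σ τ S s * X (FormAlg.vec σ τ S s.1) * N (FormAlg.inv σ τ S s)) := by
  have h := hX.mul (FormAlg.vec σ τ S s.1) (FormAlg.inv σ τ S s)
  rw [FormAlg.vec_inv, hX.one] at h
  have h2 := congrArg (fun y => FormAlg.inv σ τ S s * y) h
  simp only [mul_zero, mul_add] at h2
  rw [← mul_assoc, FormAlg.inv_vec, one_mul, ← mul_assoc] at h2
  exact eq_neg_of_add_eq_zero_left h2.symm

/-- A homomorphism intertwines two right superderivations (up to a constant) if it does so on the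
vectors. -/
lemma intertwine {A' : Type} [CommRing A'] [Algebra ℂ A'] {M' : Type} [AddCommGroup M']
    [Module A' M'] {σ' : A' →ₐ[ℂ] A'} {τ' : M' →+ M'} {S' : Set M'}
    {N' : FormAlg σ' τ' S' →ₐ[ℂ] FormAlg σ' τ' S'}
    {Y : FormAlg σ' τ' S' →ₗ[ℂ] FormAlg σ' τ' S'} (hY : IsRightDer N' Y)
    (ρ : FormAlg σ τ S →ₐ[ℂ] FormAlg σ' τ' S') (c : ℂ)
    (hN : ∀ w, ρ (N w) = N' (ρ w))
    (hs : ∀ a, Y (ρ (FormAlg.scal σ τ S a)) = 0)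
    (hv : ∀ x, ρ (X (FormAlg.vec σ τ S x)) = c • Y (ρ (FormAlg.vec σ τ S x)))
    (w : FormAlg σ τ S) : ρ (X w) = c • Y (ρ w) := by
  induction w using FormAlg.induction with
  | hs a => rw [hX.scal, hs, map_zero, smul_zero]
  | hv x => exact hv x
  | hi s =>
    rw [hX.inv, map_neg, map_mul, map_mul, hv, hN]
    -- The image of an inverse need not be a generator, so `hY.inv` is not available; the product
    -- rule on `ρ (s * s⁻¹) = 1` gives the same formula.
    have h := hY.mul (ρ (FormAlg.vec σ τ S s.1)) (ρ (FormAlg.inv σ τ S s))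
    rw [← map_mul, FormAlg.vec_inv, map_one, hY.one] at h
    have h2 := congrArg (fun y => ρ (FormAlg.inv σ τ S s) * y) h
    simp only [mul_zero, mul_add] at h2
    rw [← mul_assoc, ← map_mul, FormAlg.inv_vec, map_one, one_mul, ← mul_assoc] at h2
    rw [eq_neg_of_add_eq_zero_left h2.symm, mul_smul_comm, smul_mul_assoc, smul_neg]
  | hadd x y hx hy => rw [map_add, map_add, map_add, map_add, hx, hy, smul_add]
  | hmul x y hx hy =>
    rw [hX.mul, map_add, map_mul, map_mul, hx, hy, hN, map_mul, hY.mul, smul_add, mul_smul_comm,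
      smul_mul_assoc]

/-- The zero map is a right superderivation for every twist; compare `X` with it through the
identity homomorphism and the constant `0`. -/
lemma eq_zero (h : ∀ x, X (FormAlg.vec σ τ S x) = 0) (w : FormAlg σ τ S) : X w = 0 := by
  have h0 : IsRightDer N (0 : FormAlg σ τ S →ₗ[ℂ] FormAlg σ τ S) :=
    ⟨fun _ => rfl, fun _ _ => by simp⟩
  have := hX.intertwine h0 (AlgHom.id ℂ _) 0 (fun _ => rfl) (fun _ => rfl)
    (fun x => by simpa using h x) w
  simpa using this

end IsRightDer

namespace SBasis

variable (b : SBasis σ τ n) (H : IsSuper σ τ) (hS : ∀ x ∈ S, τ x = x)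

lemma vec_eq (x : M) : FormAlg.vec σ τ S x =
    b.vecMap (FormAlg.scal σ τ S) (FormAlg.vec σ τ S b.e) (fun l => FormAlg.vec σ τ S (b.o l)) x := by
  conv_lhs => rw [b.expand x]
  rw [map_add, map_sum, FormAlg.vec_smul, vecMap_apply, FormAlg.smul_def]
  congr 1
  refine Finset.sum_congr rfl fun l _ => ?_
  rw [FormAlg.vec_smul, FormAlg.smul_def]

lemma comm_e_o (l : Fin n) : FormAlg.vec σ τ S b.e * FormAlg.vec σ τ S (b.o l) =
    FormAlg.vec σ τ S (b.o l) * FormAlg.vec σ τ S b.e := FormAlg.even_vec b.τ_e _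

lemma anticomm_o (l m : Fin n) : FormAlg.vec σ τ S (b.o l) * FormAlg.vec σ τ S (b.o m) =
    -(FormAlg.vec σ τ S (b.o m) * FormAlg.vec σ τ S (b.o l)) := by
  rw [FormAlg.odd_vec (b.τ_o l), b.τ_o, map_neg, neg_mul]

include H in
lemma comm_scal_o (a : A) (l : Fin n) : FormAlg.scal σ τ S a * FormAlg.vec σ τ S (b.o l) =
    FormAlg.vec σ τ S (b.o l) * FormAlg.scal σ τ S (σ a) := FormAlg.scal_mul_odd H (b.τ_o l) a

include H in
lemma comm_scal_e (a : A) : FormAlg.scal σ τ S a * FormAlg.vec σ τ S b.e =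
    FormAlg.vec σ τ S b.e * FormAlg.scal σ τ S a := FormAlg.scal_mul_even H b.τ_e a

/-- Diagonal matrices. -/
def diagHom (N : FormAlg σ τ S →ₐ[ℂ] FormAlg σ τ S) :
    FormAlg σ τ S →ₐ[ℂ] Matrix (Fin 2) (Fin 2) (FormAlg σ τ S) :=
  AlgHom.ofLinearMap
    { toFun := fun a => !![a, 0; 0, N a]
      map_add' := fun x y => by
        ext i j; fin_cases i <;> fin_cases j <;> simp
      map_smul' := fun c x => by
        ext i j; fin_cases i <;> fin_cases j <;> simp }
    (by ext i j; fin_cases i <;> fin_cases j <;> simp)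
    (fun x y => by
      ext i j; fin_cases i <;> fin_cases j <;> simp [Matrix.mul_apply])

lemma diagHom_apply (N : FormAlg σ τ S →ₐ[ℂ] FormAlg σ τ S) (a) :
    diagHom N a = !![a, 0; 0, N a] := rfl

/-- For upper triangular matrices `[[w, X w], [0, N w]]`, multiplicativity is exactly the right
Leibniz rule for `X` with twist `N`. A contraction is therefore constructed from the universal
property, by prescribing such matrices on the basis and reading off the corner. -/
lemma vecMap_e_matrix (x : M) :
    b.vecMap ((diagHom (AlgHom.id ℂ (FormAlg σ τ S))).comp (FormAlg.scal σ τ S))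
      !![FormAlg.vec σ τ S b.e, 1; 0, FormAlg.vec σ τ S b.e]
      (fun m => !![FormAlg.vec σ τ S (b.o m), 0; 0, FormAlg.vec σ τ S (b.o m)]) x =
    !![FormAlg.vec σ τ S x, FormAlg.scal σ τ S (b.ce x); 0, FormAlg.vec σ τ S x] := by
  rw [b.vec_eq (S := S) x, vecMap_apply, vecMap_apply]
  ext i j
  fin_cases i <;> fin_cases j <;>
    simp [diagHom_apply, Matrix.sum_apply]

include H in
-- The contraction with an odd dual vector has the parity involution as its twist; this accounts for
-- the sign in the lower right entry.
lemma vecMap_o_matrix (l : Fin n) (x : M) :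
    b.vecMap ((diagHom (FormAlg.parAlg H hS)).comp (FormAlg.scal σ τ S))
      !![FormAlg.vec σ τ S b.e, 0; 0, FormAlg.vec σ τ S b.e]
      (fun m => !![FormAlg.vec σ τ S (b.o m), if l = m then 1 else 0;
        0, -FormAlg.vec σ τ S (b.o m)]) x =
    !![FormAlg.vec σ τ S x, FormAlg.scal σ τ S (b.co l x); 0, FormAlg.vec σ τ S (τ x)] := by
  rw [b.vec_eq (S := S) x, b.vec_eq (S := S) (τ x), vecMap_apply, vecMap_apply, vecMap_apply]
  ext i j
  fin_cases i <;> fin_cases j <;>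
    simp [diagHom_apply, Matrix.sum_apply, b.ce_tau H, b.co_tau H]

/-- The homomorphism to upper triangular matrices that encodes the contraction with the even dual
basis vector. -/
def matE : FormAlg σ τ S →ₐ[ℂ] Matrix (Fin 2) (Fin 2) (FormAlg σ τ S) :=
  b.lift ((diagHom (AlgHom.id ℂ (FormAlg σ τ S))).comp (FormAlg.scal σ τ S))
    !![FormAlg.vec σ τ S b.e, 1; 0, FormAlg.vec σ τ S b.e]
    (fun m => !![FormAlg.vec σ τ S (b.o m), 0; 0, FormAlg.vec σ τ S (b.o m)]) H
    (fun a => by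
      ext i j
      fin_cases i <;> fin_cases j <;>
        simp [diagHom_apply, Matrix.mul_apply, b.comm_scal_e H])
    (fun a l => by
      ext i j
      fin_cases i <;> fin_cases j <;>
        simp [diagHom_apply, Matrix.mul_apply, b.comm_scal_o H])
    (fun l => by
      ext i j
      fin_cases i <;> fin_cases j <;> simp [Matrix.mul_apply, b.comm_e_o])
    (fun l m => by
      ext i j
      fin_cases i <;> fin_cases j <;> simp [Matrix.mul_apply, b.anticomm_o l m])
    -- The corner is the value `-s⁻¹ X(s) s⁻¹` that the Leibniz rule forces on an inverse.
    (fun s => !![FormAlg.inv σ τ S s,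
      -(FormAlg.inv σ τ S s * FormAlg.scal σ τ S (b.ce s.1) * FormAlg.inv σ τ S s);
      0, FormAlg.inv σ τ S s])
    (fun s => by
      rw [vecMap_e_matrix]
      ext i j
      fin_cases i <;> fin_cases j <;>
        simp [Matrix.mul_apply, FormAlg.inv_vec, mul_assoc])
    (fun s => by
      rw [vecMap_e_matrix]
      ext i j
      fin_cases i <;> fin_cases j <;>
        simp [Matrix.mul_apply, FormAlg.vec_inv, ← mul_assoc])

/-- The homomorphism to upper triangular matrices that encodes the contraction with an odd dual
basis vector. -/
def matO (l : Fin n) : FormAlg σ τ S →ₐ[ℂ] Matrix (Fin 2) (Fin 2) (FormAlg σ τ S) :=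
  b.lift ((diagHom (FormAlg.parAlg H hS)).comp (FormAlg.scal σ τ S))
    !![FormAlg.vec σ τ S b.e, 0; 0, FormAlg.vec σ τ S b.e]
    (fun m => !![FormAlg.vec σ τ S (b.o m), if l = m then 1 else 0;
      0, -FormAlg.vec σ τ S (b.o m)]) H
    (fun a => by
      ext i j
      fin_cases i <;> fin_cases j <;>
        simp [diagHom_apply, Matrix.mul_apply, b.comm_scal_e H])
    (fun a m => by
      ext i j
      fin_cases i <;> fin_cases j <;>
        simp [diagHom_apply, Matrix.mul_apply, b.comm_scal_o H, H.σσ])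
    (fun m => by
      ext i j
      fin_cases i <;> fin_cases j <;> simp [Matrix.mul_apply, b.comm_e_o])
    (fun m k => by
      ext i j
      fin_cases i <;> fin_cases j <;> simp [Matrix.mul_apply, Fin.sum_univ_two, b.anticomm_o m k] <;>
        split_ifs <;> simp)
    (fun s => !![FormAlg.inv σ τ S s,
      -(FormAlg.inv σ τ S s * FormAlg.scal σ τ S (b.co l s.1) * FormAlg.inv σ τ S s);
      0, FormAlg.inv σ τ S s])
    (fun s => by
      rw [b.vecMap_o_matrix H hS, hS _ s.2]
      ext i j
      fin_cases i <;> fin_cases j <;>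
        simp [Matrix.mul_apply, FormAlg.inv_vec, mul_assoc])
    (fun s => by
      rw [b.vecMap_o_matrix H hS, hS _ s.2]
      ext i j
      fin_cases i <;> fin_cases j <;>
        simp [Matrix.mul_apply, FormAlg.vec_inv, ← mul_assoc])

lemma matE_entries (w : FormAlg σ τ S) :
    b.matE H w 0 0 = w ∧ b.matE H w 1 0 = 0 ∧ b.matE H w 1 1 = w := by
  induction w using FormAlg.induction with
  | hs a => simp [matE, lift_scal, diagHom_apply]
  | hv x => simp [matE, lift_vec, vecMap_e_matrix]
  | hi s => simp [matE, lift_inv]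
  | hadd x y hx hy => simp [hx, hy]
  | hmul x y hx hy => simp [Matrix.mul_apply, hx, hy]

lemma matO_entries (l : Fin n) (w : FormAlg σ τ S) :
    b.matO H hS l w 0 0 = w ∧ b.matO H hS l w 1 0 = 0 ∧
      b.matO H hS l w 1 1 = FormAlg.parAlg H hS w := by
  induction w using FormAlg.induction with
  | hs a => simp [matO, lift_scal, diagHom_apply]
  | hv x => simp [matO, lift_vec, b.vecMap_o_matrix H hS]
  | hi s => simp [matO, lift_inv]
  | hadd x y hx hy => simp [hx, hy]
  | hmul x y hx hy => simp [Matrix.mul_apply, hx, hy]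

/-- The right contraction with the even dual basis vector. -/
def derE : FormAlg σ τ S →ₗ[ℂ] FormAlg σ τ S where
  toFun w := b.matE H w 0 1
  map_add' x y := by simp
  map_smul' c x := by simp

/-- The right contraction with an odd dual basis vector. -/
def derO (l : Fin n) : FormAlg σ τ S →ₗ[ℂ] FormAlg σ τ S where
  toFun w := b.matO H hS l w 0 1
  map_add' x y := by simp
  map_smul' c x := by simp

lemma isRightDer_derE : IsRightDer (AlgHom.id ℂ _) (b.derE H (S := S)) where
  scal a := by simp [derE, matE, lift_scal, diagHom_apply]
  mul x y := by simp [derE, Matrix.mul_apply, b.matE_entries H]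

lemma isRightDer_derO (l : Fin n) : IsRightDer (FormAlg.parAlg H hS) (b.derO H hS l) where
  scal a := by simp [derO, matO, lift_scal, diagHom_apply]
  mul x y := by simp [derO, Matrix.mul_apply, b.matO_entries H hS]

lemma derE_vec (x : M) : b.derE H (FormAlg.vec σ τ S x) = FormAlg.scal σ τ S (b.ce x) := by
  simp [derE, matE, lift_vec, vecMap_e_matrix]

lemma derO_vec (l : Fin n) (x : M) :
    b.derO H hS l (FormAlg.vec σ τ S x) = FormAlg.scal σ τ S (b.co l x) := by
  simp [derO, matO, lift_vec, b.vecMap_o_matrix H hS]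

/-- The constant `-1` comes from `co_tau`, which gives the claim on vectors; the intertwining lemma
extends it to all forms. -/
lemma par_derO (l : Fin n) (w : FormAlg σ τ S) :
    FormAlg.parAlg H hS (b.derO H hS l w) = -b.derO H hS l (FormAlg.parAlg H hS w) := by
  have := (b.isRightDer_derO H hS l).intertwine (b.isRightDer_derO H hS l)
    (FormAlg.parAlg H hS) (-1) (fun _ => rfl)
    (fun a => by rw [FormAlg.parAlg_scal, (b.isRightDer_derO H hS l).scal])
    (fun x => by simp [derO_vec, b.co_tau H]) w
  rw [this, neg_one_smul]

lemma par_derE (w : FormAlg σ τ S) :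
    FormAlg.parAlg H hS (b.derE H w) = b.derE H (FormAlg.parAlg H hS w) := by
  have := (b.isRightDer_derE H (S := S)).intertwine (b.isRightDer_derE H)
    (FormAlg.parAlg H hS) 1 (fun _ => rfl)
    (fun a => by rw [FormAlg.parAlg_scal, (b.isRightDer_derE H).scal])
    (fun x => by simp [derE_vec, b.ce_tau H]) w
  rw [this, one_smul]

/-- The commutator is itself a right superderivation, twisted by the parity involution. It kills
vectors, whose contractions are scalars. -/
lemma derE_derO (l : Fin n) (w : FormAlg σ τ S) :
    b.derE H (b.derO H hS l w) = b.derO H hS l (b.derE H w) := by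
  have hE := b.isRightDer_derE H (S := S)
  have hO := b.isRightDer_derO H hS l
  have hZ : IsRightDer (FormAlg.parAlg H hS)
      (b.derE H ∘ₗ b.derO H hS l - b.derO H hS l ∘ₗ b.derE H) :=
    { scal := fun a => by simp [hE.scal, hO.scal]
      mul := fun x y => by
        simp only [LinearMap.sub_apply, LinearMap.comp_apply, hE.mul, hO.mul, map_add,
          AlgHom.id_apply, ← b.par_derE H hS]
        noncomm_ring }
  exact sub_eq_zero.1 (hZ.eq_zero
    (fun x => by simp [derE_vec, derO_vec, hE.scal, hO.scal]) w)

/-- Now the anticommutator is a right derivation: the mixed terms cancel by `par_derO`, and the two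
twists compose to the identity. -/
lemma derO_derO (l m : Fin n) (w : FormAlg σ τ S) :
    b.derO H hS l (b.derO H hS m w) = -b.derO H hS m (b.derO H hS l w) := by
  have hl := b.isRightDer_derO H hS l
  have hm := b.isRightDer_derO H hS m
  have hZ : IsRightDer (AlgHom.id ℂ (FormAlg σ τ S))
      (b.derO H hS l ∘ₗ b.derO H hS m + b.derO H hS m ∘ₗ b.derO H hS l) :=
    { scal := fun a => by simp [hl.scal, hm.scal]
      mul := fun x y => by
        have h1 := b.par_derO H hS l y
        have h2 := b.par_derO H hS m y
        rw [eq_neg_iff_add_eq_zero, add_comm, ← eq_neg_iff_add_eq_zero] at h1 h2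
        simp only [LinearMap.add_apply, LinearMap.comp_apply, hl.mul, hm.mul, map_add,
          AlgHom.id_apply, FormAlg.parAlg_parAlg, h1, h2]
        noncomm_ring }
  exact eq_neg_of_add_eq_zero_left (hZ.eq_zero
    (fun x => by simp [derO_vec, hl.scal, hm.scal]) w)

end SBasis

end Contraction

section Action

variable {A : Type} [CommRing A] [Algebra ℂ A] {M : Type} [AddCommGroup M] [Module A M]
  {M' : Type} [AddCommGroup M'] [Module A M']
  {σ : A →ₐ[ℂ] A} {τ : M →+ M} {τ' : M' →+ M'} {S : Set M} {n : ℕ}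

namespace SBasis

section Words

variable (b : SBasis σ τ n)

/-! ### Words in the odd basis vectors -/

/-- The product of a list of odd basis vectors. -/
def word (S : Set M) (L : List (Fin n)) : FormAlg σ τ S :=
  (L.map fun l => FormAlg.vec σ τ S (b.o l)).prod

@[simp] lemma word_nil : b.word S [] = 1 := rfl

lemma word_cons (l : Fin n) (L : List (Fin n)) :
    b.word S (l :: L) = FormAlg.vec σ τ S (b.o l) * b.word S L := by simp [word]

lemma word_append (L L' : List (Fin n)) : b.word S (L ++ L') = b.word S L * b.word S L' := by
  simp [word]

lemma word_singleton (l : Fin n) : b.word S [l] = FormAlg.vec σ τ S (b.o l) := by simp [word]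

lemma word_perm {L L' : List (Fin n)} (h : L.Perm L') :
    b.word S L = b.word S L' ∨ b.word S L = -b.word S L' := by
  induction h with
  | nil => exact .inl rfl
  | cons l _ ih => simp only [word_cons]; rcases ih with h | h <;> simp [h]
  | swap l m L =>
    right
    rw [word_cons, word_cons, word_cons, word_cons, ← mul_assoc, b.anticomm_o, neg_mul, mul_assoc]
  | trans _ _ h1 h2 => rcases h1 with h1 | h1 <;> rcases h2 with h2 | h2 <;> simp [h1, h2]

lemma sq_o (l : Fin n) : FormAlg.vec σ τ S (b.o l) * FormAlg.vec σ τ S (b.o l) = 0 :=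
  eq_zero_of_add_self (by nth_rw 1 [b.anticomm_o l l]; simp)

lemma word_eq_zero {L : List (Fin n)} (h : ¬ L.Nodup) : b.word S L = 0 := by
  induction L with
  | nil => simp at h
  | cons l L ih =>
    rw [word_cons]
    by_cases hl : l ∈ L
    · have hp := b.word_perm (S := S) (List.perm_cons_erase hl)
      rcases hp with hp | hp <;>
        simp [hp, word_cons, ← mul_assoc, b.sq_o]
    · rw [ih (fun hL => h (List.nodup_cons.2 ⟨hl, hL⟩)), mul_zero]

/-- Complex combinations of the odd basis vectors have square zero, so words are images of wedge
products under a map from an exterior algebra over `ℂ`; there the sign is that of an alternating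
map. -/
lemma word_map_perm (π : Equiv.Perm (Fin n)) :
    b.word S ((List.finRange n).map π) =
      ((Equiv.Perm.sign π : ℤ) : ℂ) • b.word S (List.finRange n) := by
  let g : (Fin n → ℂ) →ₗ[ℂ] FormAlg σ τ S :=
    Fintype.linearCombination ℂ (fun l => FormAlg.vec σ τ S (b.o l))
  have hg : ∀ l, g (Pi.single l 1) = FormAlg.vec σ τ S (b.o l) := fun l => by
    simp [g, Fintype.linearCombination_apply_single]
  have hsq : ∀ v, g v * g v = 0 := by
    intro v
    refine eq_zero_of_add_self ?_
    simp only [g, Fintype.linearCombination_apply, Finset.sum_mul, Finset.mul_sum]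
    nth_rw 2 [Finset.sum_comm]
    rw [← Finset.sum_add_distrib]
    refine Finset.sum_eq_zero fun l _ => ?_
    rw [← Finset.sum_add_distrib]
    refine Finset.sum_eq_zero fun m _ => ?_
    rw [smul_mul_smul_comm, smul_mul_smul_comm, b.anticomm_o l m, mul_comm (v l), smul_neg,
      add_neg_cancel]
  have key : ∀ f : Fin n → Fin n, b.word S ((List.finRange n).map f) =
      ExteriorAlgebra.lift ℂ ⟨g, hsq⟩ (ExteriorAlgebra.ιMulti ℂ n fun l => Pi.single (f l) 1) := by
    intro f
    rw [ExteriorAlgebra.ιMulti_apply, map_list_prod, List.map_ofFn, word, List.map_map,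
      List.ofFn_eq_map]
    congr 1
    refine List.map_congr_left fun l _ => ?_
    simp [hg]
  have h1 := key π
  have h2 := key id
  rw [List.map_id] at h2
  rw [h1, h2]
  have := (ExteriorAlgebra.ιMulti ℂ n).map_perm (fun l : Fin n => (Pi.single l 1 : Fin n → ℂ)) π
  simp only [Function.comp_def] at this
  rw [this]
  rcases Int.units_eq_one_or (Equiv.Perm.sign π) with h | h <;> simp [h]

section

variable (H : IsSuper σ τ) (hS : ∀ x ∈ S, τ x = x)

lemma par_word (L : List (Fin n)) :
    FormAlg.parAlg H hS (b.word S L) = (-1) ^ L.length * b.word S L := by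
  induction L with
  | nil => simp
  | cons l L ih =>
    rw [word_cons, map_mul, ih, FormAlg.parAlg_vec, b.τ_o, map_neg, List.length_cons, pow_succ]
    rcases neg_one_pow_eq_or (FormAlg σ τ S) L.length with h | h <;> simp [h]

include H in
lemma word_mul_scal (L : List (Fin n)) (a : A) : b.word S L * FormAlg.scal σ τ S a =
    FormAlg.scal σ τ S (σ^[L.length] a) * b.word S L := by
  induction L with
  | nil => simp
  | cons l L ih =>
    rw [word_cons, mul_assoc, ih, ← mul_assoc, List.length_cons, Function.iterate_succ_apply',
      ← mul_assoc, b.comm_scal_o H, H.σσ]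

lemma derO_word (l : Fin n) {L : List (Fin n)} (hl : l ∉ L) :
    b.derO H hS l (b.word S L) = 0 := by
  have hO := b.isRightDer_derO H hS l
  induction L with
  | nil => exact hO.one
  | cons m L ih =>
    rw [List.mem_cons, not_or] at hl
    rw [word_cons, hO.mul, ih hl.2, derO_vec, b.co_o, if_neg hl.1]
    simp

/-- A contraction from the right meets the last letter first, so no sign appears. -/
lemma derO_word_append (l : Fin n) {L : List (Fin n)} (hl : l ∉ L) :
    b.derO H hS l (b.word S (L ++ [l])) = b.word S L := by
  have hO := b.isRightDer_derO H hS l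
  rw [word_append, hO.mul, b.derO_word H hS l hl, word_singleton, derO_vec, b.co_o, if_pos rfl]
  simp

end

end Words

/-! ### The right action of the symmetric superalgebra of the dual -/

section Contr

variable (b : SBasis σ τ n) (c : SBasis σ τ' n) (H : IsSuper σ τ) (H' : IsSuper σ τ')
  (hS : ∀ x ∈ S, τ x = x)

/-- Right multiplication by scalars. -/
def rightScal : A →ₐ[ℂ] (Module.End ℂ (FormAlg σ τ S))ᵐᵒᵖ :=
  AlgHom.ofLinearMap
    { toFun := fun a => MulOpposite.op (LinearMap.mulRight ℂ (FormAlg.scal σ τ S a))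
      map_add' := fun x y => MulOpposite.unop_injective (LinearMap.ext fun w => by
        simp [mul_add])
      map_smul' := fun c x => MulOpposite.unop_injective (LinearMap.ext fun w => by
        simp) }
    (MulOpposite.unop_injective (LinearMap.ext fun w => by simp))
    (fun x y => MulOpposite.unop_injective (LinearMap.ext fun w => by
      simp [mul_assoc]))

lemma rightScal_apply (a : A) (w : FormAlg σ τ S) :
    (rightScal (S := S) (τ := τ) (σ := σ) a).unop w = w * FormAlg.scal σ τ S a := rfl

/-- The right action of the symmetric superalgebra of the dual by contractions. -/
def contrHom : FormAlg σ τ' (∅ : Set M') →ₐ[ℂ] (Module.End ℂ (FormAlg σ τ S))ᵐᵒᵖ :=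
  c.lift rightScal (MulOpposite.op (b.derE H)) (fun l => MulOpposite.op (b.derO H hS l)) H'
    (fun a => MulOpposite.unop_injective (LinearMap.ext fun w => by
      have hE := b.isRightDer_derE H (S := S)
      simp [rightScal_apply, hE.mul, hE.scal]))
    (fun a l => MulOpposite.unop_injective (LinearMap.ext fun w => by
      have hO := b.isRightDer_derO H hS l
      simp [rightScal_apply, hO.mul, hO.scal]))
    (fun l => MulOpposite.unop_injective (LinearMap.ext fun w => by
      simp [b.derE_derO H hS]))
    (fun l m => MulOpposite.unop_injective (LinearMap.ext fun w => by
      simp [b.derO_derO H hS m l]))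
    (fun s => s.2.elim) (fun s => s.2.elim) (fun s => s.2.elim)

/-- The contraction of a form (on the left) with a polyvector (on the right). -/
def contr (P : FormAlg σ τ' (∅ : Set M')) : FormAlg σ τ S →ₗ[ℂ] FormAlg σ τ S :=
  (b.contrHom c H H' hS P).unop

lemma contr_scal (a : A) (w) :
    b.contr c H H' hS (FormAlg.scal σ τ' ∅ a) w = w * FormAlg.scal σ τ S a := by
  unfold contr contrHom
  rw [lift_scal, rightScal_apply]

lemma contr_e (w) : b.contr c H H' hS (FormAlg.vec σ τ' ∅ c.e) w = b.derE H w := by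
  unfold contr contrHom
  rw [lift_vec, vecMap_e, MulOpposite.unop_op]

lemma contr_o (l) (w) : b.contr c H H' hS (FormAlg.vec σ τ' ∅ (c.o l)) w = b.derO H hS l w := by
  unfold contr contrHom
  rw [lift_vec, vecMap_o, MulOpposite.unop_op]

/-- The action takes values in the opposite of the endomorphism algebra, so the left factor of a
product acts first. -/
lemma contr_mul (P Q) (w) :
    b.contr c H H' hS (P * Q) w = b.contr c H H' hS Q (b.contr c H H' hS P w) := by
  simp [contr]

lemma contr_add (P Q) (w) :
    b.contr c H H' hS (P + Q) w = b.contr c H H' hS P w + b.contr c H H' hS Q w := by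
  simp [contr]

@[simp] lemma contr_one (w) : b.contr c H H' hS 1 w = w := by simp [contr]

@[simp] lemma contr_zero (w) : b.contr c H H' hS 0 w = 0 := by simp [contr]

lemma contr_sum {ι : Type*} (s : Finset ι) (P : ι → FormAlg σ τ' (∅ : Set M')) (w) :
    b.contr c H H' hS (∑ i ∈ s, P i) w = ∑ i ∈ s, b.contr c H H' hS (P i) w := by
  simp [contr]

lemma contr_vec (x : M') (w) : b.contr c H H' hS (FormAlg.vec σ τ' ∅ x) w =
    b.derE H (w * FormAlg.scal σ τ S (c.ce x)) +
      ∑ l, b.derO H hS l (w * FormAlg.scal σ τ S (c.co l x)) := by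
  rw [c.vec_eq x, vecMap_apply, contr_add, contr_sum, contr_mul, contr_scal, contr_e]
  congr 1
  refine Finset.sum_congr rfl fun l _ => ?_
  rw [contr_mul, contr_scal, contr_o]

/-- Operations from the right commute with multiplication from the left. This is the source of the
linearity of `Θ`. -/
lemma contr_scal_mul (P : FormAlg σ τ' (∅ : Set M')) (a : A) (w : FormAlg σ τ S) :
    b.contr c H H' hS P (FormAlg.scal σ τ S a * w) =
      FormAlg.scal σ τ S a * b.contr c H H' hS P w := by
  induction P using FormAlg.induction generalizing w with
  | hs c => rw [contr_scal, contr_scal, mul_assoc]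
  | hv x =>
    rw [contr_vec, contr_vec, mul_assoc, (b.isRightDer_derE H).scal_mul, mul_add, Finset.mul_sum]
    congr 1
    refine Finset.sum_congr rfl fun l _ => ?_
    rw [mul_assoc, (b.isRightDer_derO H hS l).scal_mul]
  | hi s => exact s.2.elim
  | hadd x y hx hy => rw [contr_add, contr_add, hx, hy, mul_add]
  | hmul x y hx hy => rw [contr_mul, contr_mul, hx, hy]

lemma contr_smul_left (P : FormAlg σ τ' (∅ : Set M')) (a : A) (w : FormAlg σ τ S) :
    b.contr c H H' hS (a • P) w = b.contr c H H' hS P (w * FormAlg.scal σ τ S a) := by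
  rw [FormAlg.smul_def, contr_mul, contr_scal]

/-- The reversed word begins with the last letter of `L₂`, so the letters are stripped from right to
left. The factor `i` does not interfere, being even and killed by the odd contractions. -/
lemma contr_word_append {L₁ L₂ : List (Fin n)} (hL : (L₁ ++ L₂).Nodup) {i : FormAlg σ τ S}
    (hi : ∀ l, b.derO H hS l i = 0) (hp : FormAlg.parAlg H hS i = i) :
    b.contr c H H' hS (c.word ∅ L₂.reverse) (b.word S (L₁ ++ L₂) * i) = b.word S L₁ * i := by
  induction L₂ using List.reverseRecOn with
  | nil => simp
  | append_singleton L l ih =>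
    rw [← List.append_assoc] at hL ⊢
    have hl : l ∉ L₁ ++ L := by
      have := List.nodup_append.1 hL
      exact fun h => this.2.2 l h l (by simp) rfl
    rw [List.reverse_append, List.reverse_singleton, List.singleton_append, word_cons, contr_mul,
      contr_o, (b.isRightDer_derO H hS l).mul, hi, mul_zero, zero_add, hp,
      b.derO_word_append H hS l hl, ih (List.nodup_append.1 hL).1]

/-- Odd contractions anticommute, so being killed by `derO l` persists until the letter `l` of `K`
is reached. -/
lemma contr_word_eq_zero {w : FormAlg σ τ S} {l : Fin n} (hw : b.derO H hS l w = 0)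
    {K : List (Fin n)} (hl : l ∈ K) : b.contr c H H' hS (c.word ∅ K) w = 0 := by
  induction K generalizing w with
  | nil => simp at hl
  | cons m K ih =>
    rw [word_cons, contr_mul, contr_o]
    rcases List.mem_cons.1 hl with rfl | hl
    · rw [hw, map_zero]
    · exact ih (by rw [b.derO_derO H hS, hw, map_zero, neg_zero]) hl

/-- The condition `w * o_l = 0` stands for divisibility of `w` by `o_l`. Contracting with a letter
other than `l` preserves it, since that contraction kills `o_l`. -/
lemma contr_word_mul_o {w : FormAlg σ τ S} {l : Fin n} (hw : w * FormAlg.vec σ τ S (b.o l) = 0)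
    {K : List (Fin n)} (hl : l ∉ K) :
    b.contr c H H' hS (c.word ∅ K) w * FormAlg.vec σ τ S (b.o l) = 0 := by
  induction K generalizing w with
  | nil => simpa using hw
  | cons m K ih =>
    rw [List.mem_cons, not_or] at hl
    rw [word_cons, contr_mul, contr_o]
    refine ih ?_ hl.2
    have h := (b.isRightDer_derO H hS m).mul w (FormAlg.vec σ τ S (b.o l))
    rw [hw, map_zero, derO_vec, b.co_o, if_neg (Ne.symm hl.1), map_zero, mul_zero, zero_add,
      FormAlg.parAlg_vec, b.τ_o, map_neg, mul_neg] at h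
    exact neg_eq_zero.1 h.symm

/-! ### The volume element and the Heaviside formula -/

variable (he : b.e ∈ S)

/-- The element `o_1 ⋯ o_n / e`. -/
def vol (he : b.e ∈ S) : FormAlg σ τ S :=
  b.word S (List.finRange n) * FormAlg.inv σ τ S ⟨b.e, he⟩

lemma derO_inv_e (l : Fin n) : b.derO H hS l (FormAlg.inv σ τ S ⟨b.e, he⟩) = 0 := by
  rw [(b.isRightDer_derO H hS l).inv, derO_vec, b.co_e]
  simp

lemma derE_inv_e : b.derE H (FormAlg.inv σ τ S ⟨b.e, he⟩) =
    -(FormAlg.inv σ τ S ⟨b.e, he⟩ * FormAlg.inv σ τ S ⟨b.e, he⟩) := by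
  rw [(b.isRightDer_derE H).inv, derE_vec, b.ce_e]
  simp

lemma derE_word (L : List (Fin n)) : b.derE H (b.word S L) = 0 := by
  have hE := b.isRightDer_derE H (S := S)
  induction L with
  | nil => exact hE.one
  | cons m L ih => rw [word_cons, hE.mul, ih, derE_vec, b.ce_o]; simp

lemma derE_inv_e_pow (m : ℕ) : b.derE H (FormAlg.inv σ τ S ⟨b.e, he⟩ ^ (m + 1)) =
    (-(m + 1 : ℂ)) • FormAlg.inv σ τ S ⟨b.e, he⟩ ^ (m + 2) := by
  have hE := b.isRightDer_derE H (S := S)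
  induction m with
  | zero => rw [zero_add, pow_one, derE_inv_e, pow_two]; simp
  | succ m ih =>
    rw [pow_succ, hE.mul, ih, derE_inv_e, AlgHom.id_apply, smul_mul_assoc, ← pow_succ, mul_neg,
      ← pow_two, ← pow_add]
    push_cast
    module

/-- Contracting with `c.e` differentiates in `b.e`; the factor `(-1)^a a!` is that of the `a`-th
derivative of `1/e`. -/
lemma contr_e_pow (L : List (Fin n)) (a : ℕ) :
    b.contr c H H' hS (FormAlg.vec σ τ' ∅ c.e ^ a)
      (b.word S L * FormAlg.inv σ τ S ⟨b.e, he⟩) =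
    ((-1) ^ a * (a.factorial : ℂ)) •
      (b.word S L * FormAlg.inv σ τ S ⟨b.e, he⟩ ^ (a + 1)) := by
  induction a with
  | zero => simp
  | succ a ih =>
    rw [pow_succ, contr_mul, ih, contr_e, map_smul, (b.isRightDer_derE H).mul, derE_word, zero_mul,
      add_zero, derE_inv_e_pow, mul_smul_comm, smul_smul, Nat.factorial_succ]
    push_cast
    congr 1
    ring

/-- Writing the volume element in the order given by `π` costs the sign of `π`. The letters after
position `s` are then the last ones and are stripped in turn; the remaining contractions
differentiate `1/e`. -/
theorem contr_vol (π : Equiv.Perm (Fin n)) (s a : ℕ) :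
    b.contr c H H' hS (c.word ∅ (((List.finRange n).drop s).map π).reverse *
        FormAlg.vec σ τ' ∅ c.e ^ a) (b.vol he) =
      (((Equiv.Perm.sign π : ℤ) : ℂ) * ((-1) ^ a * (a.factorial : ℂ))) •
        (b.word S (((List.finRange n).take s).map π) *
          FormAlg.inv σ τ S ⟨b.e, he⟩ ^ (a + 1)) := by
  have h1 := b.word_map_perm (S := S) π
  have h2 : b.word S (List.finRange n) = ((Equiv.Perm.sign π : ℤ) : ℂ) •
      b.word S ((List.finRange n).map π) := by
    rw [h1, smul_smul]
    rcases Int.units_eq_one_or (Equiv.Perm.sign π) with h | h <;> simp [h]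
  have h3 : (List.finRange n).map π =
      ((List.finRange n).take s).map π ++ ((List.finRange n).drop s).map π := by
    rw [← List.map_append, List.take_append_drop]
  have h4 : ((List.finRange n).map π).Nodup := (List.nodup_finRange n).map π.injective
  rw [vol, h2, smul_mul_assoc, map_smul, contr_mul, h3,
    b.contr_word_append c H H' hS (h3 ▸ h4) (b.derO_inv_e H hS he) (by simp), contr_e_pow,
    smul_smul]

end Contr

end SBasis

end Action

section Monomials

variable {A : Type} [CommRing A] [Algebra ℂ A] {M : Type} [AddCommGroup M] [Module A M]
  {M' : Type} [AddCommGroup M'] [Module A M']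
  {σ : A →ₐ[ℂ] A} {τ : M →+ M} {τ' : M' →+ M'} {S : Set M} {n : ℕ}

namespace SBasis

section Span

variable (b : SBasis σ τ n)

/-! ### Spanning sets of the graded pieces -/

/-- The span of the products of a word in the odd basis vectors with an element of the family `E`,
of total degree `d`. -/
def wordSpan (E : ℤ → Set (FormAlg σ τ S)) (d : ℤ) : Submodule A (FormAlg σ τ S) :=
  Submodule.span A {x | ∃ (L : List (Fin n)) (j : ℤ) (p : FormAlg σ τ S), p ∈ E j ∧
    (L.length : ℤ) + j = d ∧ x = b.word S L * p}

variable {E : ℤ → Set (FormAlg σ τ S)} (H : IsSuper σ τ)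

include H in
-- The family `E` stands for the powers of `e`: natural powers in the symmetric superalgebra,
-- integral powers in its localization. Both cases need only that these powers are central and
-- closed under products.
lemma wordSpan_mul (hE : ∀ i j, ∀ p ∈ E i, ∀ q ∈ E j, p * q ∈ E (i + j))
    (hc : ∀ i, ∀ p ∈ E i, ∀ w, p * w = w * p) {d d' : ℤ} {x y : FormAlg σ τ S}
    (hx : x ∈ b.wordSpan E d) (hy : y ∈ b.wordSpan E d') : x * y ∈ b.wordSpan E (d + d') := by
  induction hx using Submodule.span_induction with
  | mem x h =>
    obtain ⟨L, i, p, hp, hd, rfl⟩ := h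
    induction hy using Submodule.span_induction with
    | mem y h =>
      obtain ⟨L', j, q, hq, hd', rfl⟩ := h
      refine Submodule.subset_span ⟨L ++ L', i + j, p * q, hE _ _ _ hp _ hq, ?_, ?_⟩
      · rw [List.length_append]; push_cast; omega
      · rw [word_append, mul_assoc, ← mul_assoc p, hc _ _ hp, mul_assoc, mul_assoc]
    | zero => rw [mul_zero]; exact zero_mem _
    | add y z _ _ hy hz => rw [mul_add]; exact add_mem hy hz
    | smul a y _ hy =>
      have : b.word S L * p * a • y = (σ^[L.length] a) • (b.word S L * p * y) := by
        rw [FormAlg.smul_def, FormAlg.smul_def, mul_assoc, ← mul_assoc p, hc _ _ hp, mul_assoc,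
          ← mul_assoc, b.word_mul_scal H]
        simp only [mul_assoc]
      rw [this]
      exact Submodule.smul_mem _ _ hy
  | zero => rw [zero_mul]; exact zero_mem _
  | add x z _ _ hx hz => rw [add_mul]; exact add_mem hx hz
  | smul a x _ hx =>
    rw [FormAlg.smul_def, mul_assoc]
    exact Submodule.smul_mem _ a hx

include H in
-- Vectors are handled by expansion in the basis. The elements of `S` other than `e` are the reason
-- for the hypothesis `hi`: their inverses have to be expressed through `e`.
lemma grade_le_wordSpan (hE : ∀ i j, ∀ p ∈ E i, ∀ q ∈ E j, p * q ∈ E (i + j))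
    (hc : ∀ i, ∀ p ∈ E i, ∀ w, p * w = w * p) (h1 : 1 ∈ E 0)
    (he : FormAlg.vec σ τ S b.e ∈ E 1)
    (hi : ∀ s, FormAlg.inv σ τ S s ∈ b.wordSpan E (-1)) (d : ℤ) :
    FormAlg.grade σ τ S d ≤ b.wordSpan E d := by
  refine Submodule.span_le.2 ?_
  rintro _ ⟨l, t, hd, rfl⟩
  have hone : (1 : FormAlg σ τ S) ∈ b.wordSpan E 0 :=
    Submodule.subset_span ⟨[], 0, 1, h1, by simp, by simp⟩
  have hvec : ∀ x, FormAlg.vec σ τ S x ∈ b.wordSpan E 1 := by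
    intro x
    rw [b.vec_eq, vecMap_apply]
    refine add_mem (Submodule.smul_mem _ _ (Submodule.subset_span ⟨[], 1, _, he, by simp, ?_⟩))
      (sum_mem fun l _ => Submodule.smul_mem _ _
        (Submodule.subset_span ⟨[l], 0, 1, h1, by simp, ?_⟩))
    · simp
    · simp [word_singleton]
  have hl : (l.map (FormAlg.vec σ τ S)).prod ∈ b.wordSpan E l.length := by
    clear hd
    induction l with
    | nil => simpa using hone
    | cons x l ih =>
      rw [List.map_cons, List.prod_cons, List.length_cons, Nat.cast_succ, add_comm]
      exact b.wordSpan_mul H hE hc (hvec x) ih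
  have ht : (t.map (FormAlg.inv σ τ S)).prod ∈ b.wordSpan E (-t.length) := by
    clear hd
    induction t with
    | nil => simpa using hone
    | cons x l ih =>
      rw [List.map_cons, List.prod_cons, List.length_cons, Nat.cast_succ, neg_add_rev]
      exact b.wordSpan_mul H hE hc (hi x) ih
  rw [← hd, sub_eq_add_neg]
  exact b.wordSpan_mul H hE hc hl ht

/-- Words with a repeated letter vanish and reordering costs at most a sign, so one ordering of each
subset suffices. -/
lemma wordSpan_le {N : Submodule A (FormAlg σ τ S)} {d : ℤ}
    (h : ∀ L : List (Fin n), L.Nodup → ∃ L' : List (Fin n), L.Perm L' ∧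
      ∀ j, (L.length : ℤ) + j = d → ∀ p ∈ E j, b.word S L' * p ∈ N) :
    b.wordSpan E d ≤ N := by
  refine Submodule.span_le.2 ?_
  rintro _ ⟨L, j, p, hp, hd, rfl⟩
  by_cases hL : L.Nodup
  · obtain ⟨L', hLL, hN⟩ := h L hL
    rcases b.word_perm (S := S) hLL with h | h
    · rw [h]; exact hN j hd p hp
    · rw [h, neg_mul]; exact neg_mem (hN j hd p hp)
  · rw [b.word_eq_zero hL, zero_mul]; exact zero_mem _

end Span

/-! ### The monomials `o_I e^j` of the localized superalgebra -/

section Invert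

variable (b : SBasis σ τ n) (H : IsSuper σ τ) (hS : ∀ x ∈ S, τ x = x) (he : b.e ∈ S)

/-- The even basis vector as a unit of the localized superalgebra. -/
def unitE : (FormAlg σ τ S)ˣ :=
  ⟨FormAlg.vec σ τ S b.e, FormAlg.inv σ τ S ⟨b.e, he⟩, FormAlg.vec_inv ⟨b.e, he⟩,
    FormAlg.inv_vec ⟨b.e, he⟩⟩

include H hS in
lemma unitE_zpow_comm (j : ℤ) (w : FormAlg σ τ S) :
    ((b.unitE he ^ j : (FormAlg σ τ S)ˣ) : FormAlg σ τ S) * w =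
      w * ((b.unitE he ^ j : (FormAlg σ τ S)ˣ) : FormAlg σ τ S) := by
  have h : Commute ((b.unitE he : (FormAlg σ τ S)ˣ) : FormAlg σ τ S) w :=
    FormAlg.vec_even_comm H hS b.τ_e w
  exact (h.units_zpow_left j).eq

lemma unitE_zpow_neg (a : ℕ) : ((b.unitE he ^ (-(a : ℤ)) : (FormAlg σ τ S)ˣ) : FormAlg σ τ S) =
    FormAlg.inv σ τ S ⟨b.e, he⟩ ^ a := by
  rw [zpow_neg, zpow_natCast, ← inv_pow, Units.val_pow_eq_pow_val]
  rfl

lemma unitE_zpow_natCast (a : ℕ) : ((b.unitE he ^ (a : ℤ) : (FormAlg σ τ S)ˣ) : FormAlg σ τ S) =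
    FormAlg.vec σ τ S b.e ^ a := by
  rw [zpow_natCast, Units.val_pow_eq_pow_val]
  rfl

/-- The monomial `o_I e^j`. -/
def mono (I : Finset (Fin n)) (j : ℤ) : FormAlg σ τ S :=
  b.word S I.toList * ((b.unitE he ^ j : (FormAlg σ τ S)ˣ) : FormAlg σ τ S)

lemma derO_unitE_zpow (l : Fin n) (j : ℤ) :
    b.derO H hS l ((b.unitE he ^ j : (FormAlg σ τ S)ˣ) : FormAlg σ τ S) = 0 := by
  have hO := b.isRightDer_derO H hS l
  have key : ∀ (w : FormAlg σ τ S), b.derO H hS l w = 0 → ∀ a : ℕ, b.derO H hS l (w ^ a) = 0 := by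
    intro w hw a
    induction a with
    | zero => rw [pow_zero, hO.one]
    | succ a ih => rw [pow_succ, hO.mul, ih, hw]; simp
  obtain ⟨a, rfl | rfl⟩ := j.eq_nat_or_neg
  · rw [unitE_zpow_natCast]
    exact key _ (by rw [derO_vec, b.co_e, map_zero]) a
  · rw [unitE_zpow_neg]
    exact key _ (b.derO_inv_e H hS he l) a

lemma par_unitE_zpow (j : ℤ) :
    FormAlg.parAlg H hS ((b.unitE he ^ j : (FormAlg σ τ S)ˣ) : FormAlg σ τ S) =
      ((b.unitE he ^ j : (FormAlg σ τ S)ˣ) : FormAlg σ τ S) := by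
  obtain ⟨a, rfl | rfl⟩ := j.eq_nat_or_neg
  · rw [unitE_zpow_natCast, map_pow, FormAlg.parAlg_vec, b.τ_e]
  · rw [unitE_zpow_neg, map_pow, FormAlg.parAlg_inv]

variable (hU : ∀ s ∈ S, IsUnit (b.ce s))

include H in
/-- An even vector with vanishing even coordinate has square zero. -/
lemma vec_mul_self_eq_zero {x : M} (hx : τ x = x) (h0 : b.ce x = 0) :
    FormAlg.vec σ τ S x * FormAlg.vec σ τ S x = 0 := by
  have hp : ∀ l, σ (b.co l x) = -b.co l x := fun l => by
    have := b.co_tau H l x; rw [hx] at this; exact (neg_eq_iff_eq_neg.2 this).symm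
  rw [b.vec_eq, vecMap_apply, h0, map_zero, zero_mul, zero_add, Finset.sum_mul]
  refine Finset.sum_eq_zero fun l _ => ?_
  rw [Finset.mul_sum]
  refine Finset.sum_eq_zero fun m _ => ?_
  have h : FormAlg.vec σ τ S (b.o l) * FormAlg.scal σ τ S (b.co m x) =
      FormAlg.scal σ τ S (-b.co m x) * FormAlg.vec σ τ S (b.o l) := by
    rw [b.comm_scal_o H, map_neg, hp m, neg_neg]
  rw [mul_assoc, ← mul_assoc (FormAlg.vec σ τ S (b.o l)), h, ← mul_assoc, ← mul_assoc, ← map_mul,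
    mul_neg, H.odd_mul_odd (hp l) (hp m), neg_zero, map_zero, zero_mul, zero_mul]

include H hS he hU in
-- Write `s = β e + x` with `β` a unit and `x` in the span of the odd basis vectors. Then `x` is
-- even with odd coefficients, so `x² = 0`, and the geometric series for `s⁻¹` stops after its
-- linear term: `s⁻¹ = β⁻¹ e⁻¹ - β⁻² x e⁻²`.
lemma exists_inv_eq (s : S) : ∃ (q q' : A) (x : M), FormAlg.inv σ τ S s =
    FormAlg.scal σ τ S q * FormAlg.inv σ τ S ⟨b.e, he⟩ +
      FormAlg.scal σ τ S q' * FormAlg.vec σ τ S x * FormAlg.inv σ τ S ⟨b.e, he⟩ ^ 2 ∧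
      b.ce x = 0 := by
  obtain ⟨q, hq⟩ := (hU s.1 s.2).exists_right_inv
  have hs : σ (b.ce s.1) = b.ce s.1 := by rw [← b.ce_tau H, hS _ s.2]
  have hq' : σ q = q := by
    have h1 := congrArg σ hq
    rw [map_mul, hs, map_one] at h1
    calc σ q = (b.ce s.1 * q) * σ q := by rw [hq, one_mul]
      _ = q * (b.ce s.1 * σ q) := by ring
      _ = q := by rw [h1, mul_one]
  let x : M := s.1 - b.ce s.1 • b.e
  have hx0 : b.ce x = 0 := by simp [x, b.ce_e]
  have hx : τ x = x := by simp [x, hS _ s.2, H.τ_smul, hs, b.τ_e]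
  refine ⟨q, -(q * q), x, ?_, hx0⟩
  have hN := b.vec_mul_self_eq_zero (S := S) H hx hx0
  have hsx : FormAlg.vec σ τ S s.1 = FormAlg.scal σ τ S (b.ce s.1) * FormAlg.vec σ τ S b.e +
      FormAlg.vec σ τ S x := by
    rw [← FormAlg.smul_def, ← FormAlg.vec_smul, ← map_add]; simp [x]
  have hei := FormAlg.vec_inv (σ := σ) (τ := τ) (⟨b.e, he⟩ : S)
  have hQ : FormAlg.scal σ τ S (b.ce s.1) * FormAlg.scal σ τ S q = 1 := by
    rw [← map_mul, hq, map_one]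
  -- All the elements involved are central, so the identity can be checked in the centre, which is a
  -- commutative ring.
  have key : ∀ {R : Type} [Ring R] [Algebra ℂ R] (Q q e i N : R)
      (_ : ∀ w, Q * w = w * Q) (_ : ∀ w, q * w = w * q) (_ : ∀ w, e * w = w * e)
      (_ : ∀ w, w * i = i * w) (_ : ∀ w, N * w = w * N) (_ : Q * q = 1) (_ : e * i = 1)
      (_ : N * N = 0), (Q * e + N) * (q * i + (-(q * q)) * N * i ^ 2) = 1 := by
    intro R _ _ Q q e i N h1 h2 h3 h4 h5 h6 h7 h8
    have mem : ∀ z : R, (∀ w, z * w = w * z) → z ∈ Subalgebra.center ℂ R := fun z hz =>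
      Subalgebra.mem_center_iff.2 fun w => (hz w).symm
    have comm : ∀ {C : Type} [CommRing C] (Q q e i N : C), Q * q = 1 → e * i = 1 → N * N = 0 →
        (Q * e + N) * (q * i + (-(q * q)) * N * i ^ 2) = 1 := by
      intro C _ Q q e i N h6 h7 h8
      linear_combination (e * i) * h6 + h7 - q * N * i * e * i * h6 - q * N * i * h7 -
        q ^ 2 * i ^ 2 * h8
    exact congrArg Subtype.val (comm (C := Subalgebra.center ℂ R) ⟨Q, mem _ h1⟩ ⟨q, mem _ h2⟩
      ⟨e, mem _ h3⟩ ⟨i, mem _ (fun w => (h4 w).symm)⟩ ⟨N, mem _ h5⟩ (Subtype.ext h6)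
      (Subtype.ext h7) (Subtype.ext h8))
  have h2 := key (FormAlg.scal σ τ S (b.ce s.1)) (FormAlg.scal σ τ S q) (FormAlg.vec σ τ S b.e)
    (FormAlg.inv σ τ S ⟨b.e, he⟩) (FormAlg.vec σ τ S x) (FormAlg.scal_even_comm H hS hs)
    (FormAlg.scal_even_comm H hS hq') (FormAlg.vec_even_comm H hS b.τ_e)
    (FormAlg.inv_comm H hS _) (FormAlg.vec_even_comm H hS hx) hQ hei hN
  rw [← hsx] at h2
  have h3 := congrArg (fun y => FormAlg.inv σ τ S s * y) h2
  simp only [mul_one] at h3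
  rw [← h3, ← mul_assoc, FormAlg.inv_vec, one_mul, map_neg, map_mul]

include H hS hU in
lemma grade_le_span_mono (d : ℤ) : FormAlg.grade σ τ S d ≤
    Submodule.span A (Set.range fun I : Finset (Fin n) => b.mono he I (d - I.card)) := by
  let E : ℤ → Set (FormAlg σ τ S) := fun j =>
    {((b.unitE he ^ j : (FormAlg σ τ S)ˣ) : FormAlg σ τ S)}
  refine (b.grade_le_wordSpan (E := E) H ?_ ?_ ?_ ?_ ?_ d).trans (b.wordSpan_le ?_)
  · rintro i j p rfl q rfl
    exact Set.mem_singleton_iff.2 (by rw [zpow_add, Units.val_mul])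
  · rintro i p rfl w
    exact b.unitE_zpow_comm H hS he i w
  · exact Set.mem_singleton_iff.2 (by rw [zpow_zero, Units.val_one])
  · exact Set.mem_singleton_iff.2 (by rw [zpow_one]; rfl)
  · intro s
    obtain ⟨q, q', x, h, hx⟩ := b.exists_inv_eq H hS he hU s
    have hi : FormAlg.inv σ τ S ⟨b.e, he⟩ ∈ E (-1) :=
      Set.mem_singleton_iff.2 (by rw [zpow_neg_one]; rfl)
    have hi2 : FormAlg.inv σ τ S ⟨b.e, he⟩ ^ 2 ∈ E (-2) := by
      exact (b.unitE_zpow_neg he 2).symm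
    rw [h, b.vec_eq x, vecMap_apply, hx, map_zero, zero_mul, zero_add]
    refine add_mem (Submodule.smul_mem _ q (Submodule.subset_span ⟨[], -1, _, hi, by simp, ?_⟩)) ?_
    · simp
    · rw [mul_assoc, Finset.sum_mul]
      refine Submodule.smul_mem _ q' (sum_mem fun l _ => ?_)
      rw [mul_assoc]
      exact Submodule.smul_mem _ _ (Submodule.subset_span
        ⟨[l], -2, _, hi2, by simp, by rw [word_singleton]⟩)
  · intro L hL
    refine ⟨L.toFinset.toList, ?_, ?_⟩
    · exact (List.perm_ext_iff_of_nodup hL (Finset.nodup_toList _)).2 fun a => by simp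
    · rintro j rfl p rfl
      refine Submodule.subset_span ⟨L.toFinset, ?_⟩
      have : ((L.length : ℤ) + j - L.toFinset.card) = j := by
        rw [List.toFinset_card_of_nodup hL]; ring
      simp only [mono, this]

lemma mono_mem_grade (I : Finset (Fin n)) (d : ℤ) :
    b.mono he I (d - I.card) ∈ FormAlg.grade σ τ S d := by
  have hw : b.word S I.toList = ((I.toList.map b.o).map (FormAlg.vec σ τ S)).prod := by
    rw [List.map_map]; rfl
  obtain ⟨a, h | h⟩ := (d - I.card).eq_nat_or_neg
  · refine Submodule.subset_span ⟨I.toList.map b.o ++ List.replicate a b.e, [], ?_, ?_⟩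
    · simp; omega
    · rw [mono, h, unitE_zpow_natCast, hw]; simp
  · refine Submodule.subset_span ⟨I.toList.map b.o, List.replicate a ⟨b.e, he⟩, ?_, ?_⟩
    · simp; omega
    · rw [mono, h, unitE_zpow_neg, hw]; simp

/-! ### Linear independence of the monomials -/

open LaurentPolynomial in
/-- The augmentation that kills the odd basis vectors. -/
def aug (hU : ∀ s ∈ S, IsUnit (b.ce s)) : FormAlg σ τ S →ₐ[ℂ] LaurentPolynomial A :=
  b.lift (IsScalarTower.toAlgHom ℂ A (LaurentPolynomial A)) (T 1) (fun _ => 0) H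
    (fun _ => mul_comm _ _) (fun _ _ => by simp) (fun _ => by simp) (fun _ _ => by simp)
    (fun s => C (Ring.inverse (b.ce s.1)) * T (-1))
    (fun s => by
      have h : b.vecMap (IsScalarTower.toAlgHom ℂ A (LaurentPolynomial A)) (T 1) (fun _ => 0) s.1 =
        C (b.ce s.1) * T 1 := by simp [vecMap_apply]
      rw [h, mul_mul_mul_comm, ← map_mul, ← T_add, Ring.inverse_mul_cancel _ (hU _ s.2)]
      simp)
    (fun s => by
      have h : b.vecMap (IsScalarTower.toAlgHom ℂ A (LaurentPolynomial A)) (T 1) (fun _ => 0) s.1 =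
        C (b.ce s.1) * T 1 := by simp [vecMap_apply]
      rw [h, mul_mul_mul_comm, ← map_mul, ← T_add, Ring.mul_inverse_cancel _ (hU _ s.2)]
      simp)

open LaurentPolynomial in
lemma aug_scal (a : A) : b.aug H hU (FormAlg.scal σ τ S a) = C a := by
  unfold aug; rw [lift_scal]; rfl

lemma aug_o (l : Fin n) : b.aug H hU (FormAlg.vec σ τ S (b.o l)) = 0 := by
  unfold aug; rw [lift_vec, vecMap_o]

open LaurentPolynomial in
lemma aug_unitE_zpow (j : ℤ) :
    b.aug H hU ((b.unitE he ^ j : (FormAlg σ τ S)ˣ) : FormAlg σ τ S) = T j := by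
  obtain ⟨a, rfl | rfl⟩ := j.eq_nat_or_neg
  · rw [unitE_zpow_natCast, map_pow]
    unfold aug
    rw [lift_vec, vecMap_e, T_pow, mul_one]
  · rw [unitE_zpow_neg, map_pow]
    unfold aug
    rw [lift_inv]
    simp [b.ce_e, T_pow]

include hS in
-- Contracting `w * o_l = 0` with the dual of `o_l` gives `w = (derO l w) * o_l`, and the
-- augmentation kills `o_l`.
lemma aug_eq_zero {w : FormAlg σ τ S} {l : Fin n} (hw : w * FormAlg.vec σ τ S (b.o l) = 0) :
    b.aug H hU w = 0 := by
  have h := (b.isRightDer_derO H hS l).mul w (FormAlg.vec σ τ S (b.o l))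
  rw [hw, map_zero, derO_vec, b.co_o, if_pos rfl, map_one, mul_one, FormAlg.parAlg_vec, b.τ_o,
    map_neg, mul_neg, ← sub_eq_add_neg] at h
  rw [sub_eq_zero.1 h.symm, map_mul, aug_o, mul_zero]

include H hS hU in
-- To isolate the coefficient of `J`, contract with the letters of `J` and then augment. A subset
-- not containing `J` dies under the contraction, one strictly containing `J` leaves an odd letter
-- and dies under the augmentation, and `J` itself leaves `f J` times a power of `T`. The basis `c`
-- serves only to index the contractions.
theorem mono_independent (c : SBasis σ τ' n) (H' : IsSuper σ τ')
    (j : Finset (Fin n) → ℤ) (f : Finset (Fin n) → A) (h : ∑ I : Finset (Fin n),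
    FormAlg.scal σ τ S (f I) * b.mono he I (j I) = 0) : f = 0 := by
  classical
  funext J
  have h1 := congrArg (fun w => b.aug H hU
    (b.contr c H H' hS (c.word ∅ J.toList.reverse) w)) h
  simp only [map_zero, map_sum, contr_scal_mul, map_mul, aug_scal] at h1
  rw [Finset.sum_eq_single J] at h1
  · have h2 := b.contr_word_append c H H' hS (L₁ := []) (L₂ := J.toList)
      (i := ((b.unitE he ^ (j J) : (FormAlg σ τ S)ˣ) : FormAlg σ τ S))
      (by simpa using Finset.nodup_toList J)
      (fun l => b.derO_unitE_zpow H hS he l _) (b.par_unitE_zpow H hS he _)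
    rw [List.nil_append, word_nil, one_mul] at h2
    rw [mono, h2, aug_unitE_zpow, ← LaurentPolynomial.single_eq_C_mul_T] at h1
    exact AddMonoidAlgebra.single_eq_zero.1 h1
  · intro I _ hIJ
    by_cases hsub : J ⊆ I
    · obtain ⟨l, hlI, hlJ⟩ : ∃ l ∈ I, l ∉ J := by
        by_contra! hcon
        exact hIJ (Finset.Subset.antisymm hcon hsub)
      rw [b.aug_eq_zero H hS hU (l := l), mul_zero]
      refine b.contr_word_mul_o c H H' hS ?_ (by simpa using hlJ)
      rw [mono, mul_assoc, b.unitE_zpow_comm H hS, ← mul_assoc, ← word_singleton, ← word_append,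
        b.word_eq_zero, zero_mul]
      intro hnd
      exact (List.nodup_append.1 hnd).2.2 l (by simpa using hlI) l (by simp) rfl
    · obtain ⟨l, hlJ, hlI⟩ := Finset.not_subset.1 hsub
      rw [b.contr_word_eq_zero c H H' hS (l := l), map_zero, mul_zero]
      · rw [mono, (b.isRightDer_derO H hS l).mul, b.derO_unitE_zpow H hS he,
          b.derO_word H hS l (by simpa using hlI)]
        simp
      · simpa using hlJ
  · simp

end Invert

end SBasis

end Monomials

/-! ### Products of anticommuting elements and determinants -/

/-- The product of `n` linear combinations of anticommuting elements. -/
lemma prod_ofFn_sum {C R : Type} [CommRing C] [Ring R] {n : ℕ} (f : C →+* R)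
    (hf : ∀ c x, f c * x = x * f c) (o : Fin n → R) (hsq : ∀ l, o l * o l = 0)
    (hanti : ∀ l m, o l * o m = -(o m * o l)) (a : Matrix (Fin n) (Fin n) C) :
    (List.ofFn fun m => ∑ l, f (a m l) * o l).prod = f a.det * (List.ofFn o).prod := by
  let _ : Algebra C R := f.toAlgebra' hf
  have smul_eq : ∀ (c : C) (x : R), c • x = f c * x := fun c x => Algebra.smul_def c x
  let g : (Fin n → C) →ₗ[C] R := Fintype.linearCombination C o
  have hg : ∀ v : Fin n → C, g v = ∑ l, f (v l) * o l := fun v => by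
    simp [g, Fintype.linearCombination_apply, smul_eq]
  have hg1 : ∀ l, g (Pi.single l 1) = o l := fun l => by
    simp [g, Fintype.linearCombination_apply_single]
  have hgsq : ∀ v, g v * g v = 0 := by
    intro v
    have h1 : g v * g v = ∑ p : Fin n × Fin n, (v p.1 * v p.2) • (o p.1 * o p.2) := by
      rw [Fintype.sum_prod_type]
      simp only [g, Fintype.linearCombination_apply, Finset.sum_mul_sum, smul_mul_smul_comm]
    rw [h1]
    -- Here `2` need not be invertible: off the diagonal the pairs `(l, m)` and `(m, l)` cancel, and
    -- on the diagonal `hsq` applies.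
    refine Finset.sum_involution (fun p _ => p.swap) ?_ ?_ (fun _ _ => Finset.mem_univ _)
      (fun p _ => Prod.swap_swap p)
    · rintro ⟨l, m⟩ -
      simp only [Prod.fst_swap, Prod.snd_swap]
      rw [hanti l m, mul_comm (v l), smul_neg, neg_add_cancel]
    · rintro ⟨l, m⟩ - hne heq
      simp only [Prod.swap_prod_mk, Prod.mk.injEq] at heq
      rw [heq.1] at hne
      simp [hsq] at hne
  have key : ∀ v : Fin n → Fin n → C, (List.ofFn fun m => g (v m)).prod =
      ExteriorAlgebra.lift C ⟨g, hgsq⟩ (ExteriorAlgebra.ιMulti C n v) := by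
    intro v
    rw [ExteriorAlgebra.ιMulti_apply, map_list_prod, List.map_ofFn]
    congr 2
    funext m
    simp
  let φ : (Fin n → C) [⋀^Fin n]→ₗ[C] R :=
    (ExteriorAlgebra.lift C ⟨g, hgsq⟩).toLinearMap.compAlternatingMap (ExteriorAlgebra.ιMulti C n)
  have hφ : ∀ v, φ v = (List.ofFn fun m => g (v m)).prod := fun v => (key v).symm
  -- An alternating map of `n` arguments in `Cⁿ` is determined by its value on the standard basis,
  -- where the determinant is `1`.
  have hφψ : φ = (LinearMap.toSpanSingleton C R (List.ofFn o).prod).compAlternatingMap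
      Matrix.detRowAlternating := by
    refine Module.Basis.ext_alternating (Pi.basisFun C (Fin n)) fun i h => ?_
    let π : Equiv.Perm (Fin n) := Equiv.ofBijective i (Finite.injective_iff_bijective.1 h)
    rw [show (fun k => Pi.basisFun C (Fin n) (i k)) = Pi.basisFun C (Fin n) ∘ π from rfl]
    rw [AlternatingMap.map_perm, AlternatingMap.map_perm, hφ]
    congr 1
    have h1 : Matrix.detRowAlternating (Pi.basisFun C (Fin n) : Fin n → Fin n → C) = 1 := by
      rw [← Pi.basisFun_det, Module.Basis.det_self]
    simp only [Pi.basisFun_apply, hg1]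
    rw [LinearMap.compAlternatingMap_apply, h1, LinearMap.toSpanSingleton_apply, one_smul]
  have h2 := hφ a
  rw [hφψ] at h2
  simp only [hg] at h2
  rw [← h2, ← smul_eq]
  rfl

section Change

variable {A : Type} [CommRing A] [Algebra ℂ A] {M : Type} [AddCommGroup M] [Module A M]
  {M' : Type} [AddCommGroup M'] [Module A M']
  {σ : A →ₐ[ℂ] A} {τ : M →+ M} {τ' : M' →+ M'} {S : Set M} {n : ℕ}

namespace SBasis

section Par

variable (b b' : SBasis σ τ n) (c c' : SBasis σ τ' n) (H : IsSuper σ τ) (H' : IsSuper σ τ')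
  (hS : ∀ x ∈ S, τ x = x)

lemma par_contr (P : FormAlg σ τ' (∅ : Set M')) (w : FormAlg σ τ S) :
    FormAlg.parAlg H hS (b.contr c H H' hS P w) =
      b.contr c H H' hS (FormAlg.parAlg H' (fun _ h => h.elim) P) (FormAlg.parAlg H hS w) := by
  induction P using FormAlg.induction generalizing w with
  | hs a => simp [contr_scal]
  | hv x =>
    simp only [FormAlg.parAlg_vec, contr_vec, map_add, map_sum, b.par_derE H hS,
      b.par_derO H hS, map_mul, FormAlg.parAlg_scal, c.ce_tau H', c.co_tau H', map_neg, mul_neg]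
  | hi s => exact s.2.elim
  | hadd x y hx hy => simp only [contr_add, map_add, hx, hy]
  | hmul x y hx hy => simp only [contr_mul, map_mul, hx, hy]

/-! ### Change of basis -/

lemma contr_vec_vec (x : M') (y : M) :
    b.contr c H H' hS (FormAlg.vec σ τ' ∅ x) (FormAlg.vec σ τ S y) =
      FormAlg.scal σ τ S (b.ce y * c.ce x + ∑ l, b.co l y * σ (c.co l x)) := by
  have hE := b.isRightDer_derE H (S := S)
  rw [contr_vec, hE.mul, hE.scal, derE_vec, mul_zero, zero_add, map_add, map_mul, map_sum]
  congr 1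
  refine Finset.sum_congr rfl fun l _ => ?_
  have hO := b.isRightDer_derO H hS l
  rw [hO.mul, hO.scal, derO_vec, mul_zero, zero_add, map_mul, FormAlg.parAlg_scal]

/-- The coefficients of an even `x` at the odd basis vectors are odd. Moving such a coefficient past
the second factor applies the parity involution, which cancels the twist of `derO`. The total twist
thus depends only on the parity of `x`. -/
lemma isRightDer_contr_even {x : M'} (hx : τ' x = x) :
    IsRightDer (AlgHom.id ℂ _) (b.contr c H H' hS (FormAlg.vec σ τ' ∅ x)) := by
  have hE := b.isRightDer_derE H (S := S)
  have hO := b.isRightDer_derO H hS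
  have hq : σ (c.ce x) = c.ce x := by rw [← c.ce_tau H', hx]
  have hp : ∀ l, σ (c.co l x) = -c.co l x := fun l => by
    have := c.co_tau H' l x; rw [hx] at this; exact (neg_eq_iff_eq_neg.2 this).symm
  refine ⟨fun a => ?_, fun u v => ?_⟩
  · rw [contr_vec, ← map_mul, hE.scal, zero_add]
    exact Finset.sum_eq_zero fun l _ => by rw [← map_mul, (hO l).scal]
  · simp only [contr_vec, AlgHom.id_apply, mul_add, add_mul, Finset.mul_sum, Finset.sum_mul]
    rw [add_add_add_comm, ← Finset.sum_add_distrib]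
    congr 1
    · rw [mul_assoc, hE.mul, hE.mul u, hE.scal, mul_zero, zero_add, AlgHom.id_apply,
        AlgHom.id_apply, mul_assoc (b.derE H u), FormAlg.scal_even_comm H hS hq]
    · refine Finset.sum_congr rfl fun l _ => ?_
      rw [mul_assoc, (hO l).mul, (hO l).mul u (FormAlg.scal σ τ S _), (hO l).scal, mul_zero,
        zero_add, map_mul (FormAlg.parAlg H hS), FormAlg.parAlg_scal, hp, mul_assoc (b.derO H hS l u), map_neg,
        neg_mul, FormAlg.scal_odd_comm H hS (hp l), mul_neg]

lemma isRightDer_contr_odd {x : M'} (hx : τ' x = -x) :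
    IsRightDer (FormAlg.parAlg H hS) (b.contr c H H' hS (FormAlg.vec σ τ' ∅ x)) := by
  have hE := b.isRightDer_derE H (S := S)
  have hO := b.isRightDer_derO H hS
  have hq : σ (c.ce x) = -c.ce x := by rw [← c.ce_tau H', hx, map_neg]
  have hp : ∀ l, σ (c.co l x) = c.co l x := fun l => by
    have := c.co_tau H' l x; rw [hx, map_neg] at this; exact (neg_injective this).symm
  refine ⟨fun a => ?_, fun u v => ?_⟩
  · rw [contr_vec, ← map_mul, hE.scal, zero_add]
    exact Finset.sum_eq_zero fun l _ => by rw [← map_mul, (hO l).scal]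
  · simp only [contr_vec, mul_add, add_mul, Finset.mul_sum, Finset.sum_mul]
    rw [add_add_add_comm, ← Finset.sum_add_distrib]
    congr 1
    · rw [mul_assoc, hE.mul, hE.mul u, hE.scal, mul_zero, zero_add, AlgHom.id_apply,
        AlgHom.id_apply, mul_assoc (b.derE H u), FormAlg.scal_odd_comm H hS hq,
        FormAlg.parAlg_parAlg]
    · refine Finset.sum_congr rfl fun l _ => ?_
      rw [mul_assoc, (hO l).mul, (hO l).mul u (FormAlg.scal σ τ S _), (hO l).scal, mul_zero,
        zero_add, map_mul (FormAlg.parAlg H hS), FormAlg.parAlg_scal, hp, mul_assoc (b.derO H hS l u),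
        FormAlg.scal_even_comm H hS (hp l)]

/-- Right superderivations are linear over scalars on the left, so a basis suffices. -/
lemma derivation_ext {N : FormAlg σ τ S →ₐ[ℂ] FormAlg σ τ S}
    {X Y : FormAlg σ τ S →ₗ[ℂ] FormAlg σ τ S} (hX : IsRightDer N X) (hY : IsRightDer N Y)
    (he : X (FormAlg.vec σ τ S b.e) = Y (FormAlg.vec σ τ S b.e))
    (ho : ∀ l, X (FormAlg.vec σ τ S (b.o l)) = Y (FormAlg.vec σ τ S (b.o l))) : X = Y := by
  refine LinearMap.ext fun w => ?_
  have := hX.intertwine hY (AlgHom.id ℂ _) 1 (fun _ => rfl) (fun a => hY.scal a) (fun x => by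
    rw [one_smul, b.vec_eq, vecMap_apply, AlgHom.id_apply, AlgHom.id_apply, map_add, map_add,
      map_sum, map_sum, hX.scal_mul, hY.scal_mul, he]
    congr 1
    exact Finset.sum_congr rfl fun l _ => by rw [hX.scal_mul, hY.scal_mul, ho]) w
  simpa using this

/-- The bases `b, b'` of a supermodule and the bases `c, c'` of its dual are related by mutually
transposed matrices, of which the block `b'.o → b.e` vanishes. -/
structure Compat (b b' : SBasis σ τ n) (c c' : SBasis σ τ' n) : Prop where
  ee : c'.ce c.e = b.ce b'.e
  eo : ∀ l, c'.ce (c.o l) = b.co l b'.e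
  oe : ∀ m, c'.co m c.e = 0
  oe' : ∀ m, b.ce (b'.o m) = 0
  oo : ∀ l m, c'.co m (c.o l) = b.co l (b'.o m)

variable {b b' c c'}

lemma even_co_o (b b' : SBasis σ τ n) (H : IsSuper σ τ) (l m : Fin n) :
    σ (b.co l (b'.o m)) = b.co l (b'.o m) := by
  have := b.co_tau H l (b'.o m)
  rw [b'.τ_o, map_neg] at this
  exact (neg_injective this).symm

/-- By multiplicativity in the polyvector it suffices to treat scalars and the basis vectors of `c`.
For the latter both sides are right superderivations with the same twist, and their values on the
basis `b'` agree because the two matrices are transposed to each other. -/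
theorem Compat.contr_eq (h : Compat b b' c c') (P : FormAlg σ τ' (∅ : Set M'))
    (w : FormAlg σ τ S) : b.contr c H H' hS P w = b'.contr c' H H' hS P w := by
  have hE : b.derE H = b'.contr c' H H' hS (FormAlg.vec σ τ' ∅ c.e) := by
    refine b'.derivation_ext (b.isRightDer_derE H)
      (b'.isRightDer_contr_even c' H H' hS c.τ_e) ?_ fun l => ?_
    · rw [contr_vec_vec, derE_vec, b'.ce_e, one_mul, h.ee]
      simp [b'.co_e]
    · rw [contr_vec_vec, derE_vec, b'.ce_o, zero_mul, h.oe']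
      simp [h.oe]
  have hO : ∀ l, b.derO H hS l = b'.contr c' H H' hS (FormAlg.vec σ τ' ∅ (c.o l)) := by
    intro l
    refine b'.derivation_ext (b.isRightDer_derO H hS l)
      (b'.isRightDer_contr_odd c' H H' hS (c.τ_o l)) ?_ fun m => ?_
    · rw [contr_vec_vec, derO_vec, b'.ce_e, one_mul, h.eo]
      simp [b'.co_e]
    · rw [contr_vec_vec, derO_vec, b'.ce_o, zero_mul, zero_add]
      simp only [b'.co_o, h.oo, even_co_o b b' H]
      simp
  induction P using FormAlg.induction generalizing w with
  | hs a => rw [contr_scal, contr_scal]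
  | hv x =>
    rw [contr_vec, hE, c.vec_eq x, vecMap_apply, contr_add, contr_mul, contr_scal, contr_sum]
    congr 1
    refine Finset.sum_congr rfl fun l _ => ?_
    rw [hO, contr_mul, contr_scal]
  | hi s => exact s.2.elim
  | hadd x y hx hy => rw [contr_add, contr_add, hx, hy]
  | hmul x y hx hy => rw [contr_mul, contr_mul, hx, hy]

/-- The matrix of the odd vectors of `b'` in terms of those of `b`. -/
def oddMatrix (b b' : SBasis σ τ n) : Matrix (Fin n) (Fin n) A := fun m l => b.co l (b'.o m)

variable (b b')

include H hS in
-- The odd vectors of `b'` are combinations of those of `b` alone. Their coefficients are even,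
-- hence central, so the determinant formula applies over the subalgebra `A₀` of even scalars.
lemma word_change (h : ∀ m, b.ce (b'.o m) = 0) : b'.word S (List.finRange n) =
    FormAlg.scal σ τ S (oddMatrix b b').det * b.word S (List.finRange n) := by
  let A₀ : Subalgebra ℂ A := AlgHom.equalizer σ (AlgHom.id ℂ A)
  have hc : ∀ (c : A₀) (x : FormAlg σ τ S), FormAlg.scal σ τ S c.1 * x =
      x * FormAlg.scal σ τ S c.1 := fun c x => FormAlg.scal_even_comm H hS c.2 x
  let a : Matrix (Fin n) (Fin n) A₀ := fun m l => ⟨b.co l (b'.o m), even_co_o b b' H l m⟩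
  have ha : a.det.1 = (oddMatrix b b').det := A₀.val.map_det a
  have hw : ∀ b : SBasis σ τ n, b.word S (List.finRange n) =
      (List.ofFn fun l => FormAlg.vec σ τ S (b.o l)).prod := fun b => by
    rw [word, List.ofFn_eq_map]
  have := prod_ofFn_sum ((FormAlg.scal σ τ S).comp A₀.val).toRingHom hc
    (fun l => FormAlg.vec σ τ S (b.o l)) b.sq_o b.anticomm_o a
  rw [hw, hw, ← ha]
  refine Eq.trans ?_ this
  congr 2
  funext m
  rw [b.vec_eq, vecMap_apply, h, map_zero, zero_mul, zero_add]
  rfl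

include H' in
lemma even_ce_e (b b' : SBasis σ τ' n) : σ (b.ce b'.e) = b.ce b'.e := by
  rw [← b.ce_tau H', b'.τ_e]

include H hS in
-- Against the full word `o_1 ⋯ o_n` the odd part of `b'.e` vanishes, so dividing by `b'.e` is
-- dividing by `b.e` and by its coefficient. Together with the determinant this is the inverse of
-- the Berezinian.
theorem vol_change (h : ∀ m, b.ce (b'.o m) = 0) (he : b.e ∈ S) (he' : b'.e ∈ S)
    {q : A} (hq : b.ce b'.e * q = 1) : b'.vol he' =
      FormAlg.scal σ τ S ((oddMatrix b b').det * q) * b.vol he := by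
  have hβ := even_ce_e H b b'
  set β := b.ce b'.e with hβdef
  set w := b.word S (List.finRange n) with hw
  have hwe : w * FormAlg.vec σ τ S b'.e = FormAlg.scal σ τ S β * (w * FormAlg.vec σ τ S b.e) := by
    rw [b.vec_eq b'.e, vecMap_apply, mul_add, Finset.mul_sum, Finset.sum_eq_zero, add_zero,
      ← mul_assoc, ← FormAlg.scal_even_comm H hS hβ, mul_assoc]
    intro l _
    rw [← mul_assoc, hw, b.word_mul_scal H, mul_assoc, ← word_singleton, ← word_append,
      b.word_eq_zero, mul_zero]
    intro hnd
    exact (List.nodup_append.1 hnd).2.2 l (by simp) l (by simp) rfl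
  have h1 := FormAlg.vec_inv (σ := σ) (τ := τ) (⟨b.e, he⟩ : S)
  have h2 := FormAlg.vec_inv (σ := σ) (τ := τ) (⟨b'.e, he'⟩ : S)
  have hq1 : FormAlg.scal σ τ S q * FormAlg.scal σ τ S β = 1 := by
    rw [← map_mul, mul_comm, hq, map_one]
  simp only at h1 h2
  set i := FormAlg.inv σ τ S ⟨b.e, he⟩
  set i' := FormAlg.inv σ τ S ⟨b'.e, he'⟩
  have hi : ∀ x, x * i = i * x := FormAlg.inv_comm H hS _
  have key : w * i' = FormAlg.scal σ τ S q * (w * i) := by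
    calc w * i' = FormAlg.scal σ τ S q * FormAlg.scal σ τ S β *
          (w * (FormAlg.vec σ τ S b.e * i) * i') := by rw [hq1, h1, mul_one, one_mul]
      _ = FormAlg.scal σ τ S q * ((FormAlg.scal σ τ S β * (w * FormAlg.vec σ τ S b.e)) *
          (i * i')) := by noncomm_ring
      _ = FormAlg.scal σ τ S q * (w * (FormAlg.vec σ τ S b'.e * i') * i) := by
        rw [← hwe, ← hi i']; noncomm_ring
      _ = _ := by rw [h2, mul_one]
  rw [vol, vol, b.word_change b' H hS h, mul_assoc, key, map_mul, mul_assoc]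

end Par

end SBasis

end Change

section Local

variable {A : Type} [CommRing A] [Algebra ℂ A] {M : Type} [AddCommGroup M] [Module A M]
  {M' : Type} [AddCommGroup M'] [Module A M']
  {σ : A →ₐ[ℂ] A} {τ : M →+ M} {τ' : M' →+ M'} {S : Set M} {n : ℕ}

namespace SBasis

/-! ### Compatibility of contractions and volume elements with restriction -/

section Functoriality

variable {B : Type} [CommRing B] [Algebra ℂ B] {N : Type} [AddCommGroup N] [Module B N]
  {N' : Type} [AddCommGroup N'] [Module B N']
  {σB : B →ₐ[ℂ] B} {τN : N →+ N} {τN' : N' →+ N'} {T : Set N}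
  (b : SBasis σ τ n) (c : SBasis σ τ' n) (H : IsSuper σ τ) (H' : IsSuper σ τ')
  (hS : ∀ x ∈ S, τ x = x)
  (b₂ : SBasis σB τN n) (c₂ : SBasis σB τN' n) (H₂ : IsSuper σB τN) (H₂' : IsSuper σB τN')
  (hT : ∀ x ∈ T, τN x = x)
  (f : A →ₐ[ℂ] B) (g : M →+ N) (g' : M' →+ N')
  (hf : ∀ a, f (σ a) = σB (f a)) (hg : ∀ x, g (τ x) = τN (g x))
  (hg' : ∀ x, g' (τ' x) = τN' (g' x))
  (hfg : ∀ a x, g (a • x) = f a • g x) (hfg' : ∀ a x, g' (a • x) = f a • g' x)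
  (hST : ∀ x ∈ S, g x ∈ T)

/-- By induction on the polyvector, only the elementary contractions have to be compared, and there
the intertwining lemma reduces everything to the coordinate functionals. -/
theorem map_contr (hce : ∀ x, b₂.ce (g x) = f (b.ce x)) (hco : ∀ l x, b₂.co l (g x) = f (b.co l x))
    (hce' : ∀ x, c₂.ce (g' x) = f (c.ce x)) (hco' : ∀ l x, c₂.co l (g' x) = f (c.co l x))
    (P : FormAlg σ τ' (∅ : Set M')) (w : FormAlg σ τ S) :
    FormAlg.map f g hf hg hfg hST (b.contr c H H' hS P w) =
      b₂.contr c₂ H₂ H₂' hT (FormAlg.map f g' hf hg' hfg' (fun _ h => h.elim) P)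
        (FormAlg.map f g hf hg hfg hST w) := by
  have hE : ∀ w, FormAlg.map f g hf hg hfg hST (b.derE H w) =
      b₂.derE H₂ (FormAlg.map f g hf hg hfg hST w) := fun w => by
    have := (b.isRightDer_derE H (S := S)).intertwine (b₂.isRightDer_derE H₂ (S := T))
      (FormAlg.map f g hf hg hfg hST) 1 (fun _ => rfl)
      (fun a => by rw [FormAlg.map_scal, (b₂.isRightDer_derE H₂).scal])
      (fun x => by rw [derE_vec, FormAlg.map_scal, FormAlg.map_vec, derE_vec, hce, one_smul]) w
    rw [this, one_smul]
  have hO : ∀ l w, FormAlg.map f g hf hg hfg hST (b.derO H hS l w) =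
      b₂.derO H₂ hT l (FormAlg.map f g hf hg hfg hST w) := fun l w => by
    have := (b.isRightDer_derO H hS l).intertwine (b₂.isRightDer_derO H₂ hT l)
      (FormAlg.map f g hf hg hfg hST) 1
      (fun w => by
        induction w using FormAlg.induction with
        | hs a => simp only [FormAlg.parAlg_scal, FormAlg.map_scal, hf]
        | hv x => simp only [FormAlg.parAlg_vec, FormAlg.map_vec, hg]
        | hi s => simp only [FormAlg.parAlg_inv, FormAlg.map_inv]
        | hadd x y hx hy => simp only [map_add, hx, hy]
        | hmul x y hx hy => simp only [map_mul, hx, hy])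
      (fun a => by rw [FormAlg.map_scal, (b₂.isRightDer_derO H₂ hT l).scal])
      (fun x => by rw [derO_vec, FormAlg.map_scal, FormAlg.map_vec, derO_vec, hco, one_smul]) w
    rw [this, one_smul]
  induction P using FormAlg.induction generalizing w with
  | hs a => simp only [contr_scal, FormAlg.map_scal, map_mul]
  | hv x =>
    simp only [contr_vec, FormAlg.map_vec, map_add, map_sum, hE, hO, map_mul, FormAlg.map_scal,
      hce', hco']
  | hi s => exact s.2.elim
  | hadd x y hx hy => simp only [contr_add, map_add, hx, hy]
  | hmul x y hx hy => simp only [contr_mul, map_mul, hx, hy]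

lemma map_vol (he : b.e ∈ S) (he₂ : b₂.e ∈ T) (hge : g b.e = b₂.e)
    (hgo : ∀ l, g (b.o l) = b₂.o l) :
    FormAlg.map f g hf hg hfg hST (b.vol he) = b₂.vol he₂ := by
  rw [vol, vol, map_mul, FormAlg.map_inv, word, word, map_list_prod, List.map_map]
  congr 1
  · congr 1
    refine List.map_congr_left fun l _ => ?_
    rw [Function.comp_apply, FormAlg.map_vec, hgo]
  · congr 1
    exact Subtype.ext hge

end Functoriality

/-! ### The splitting of extended forms into contractions of the volume element and superforms -/

section Bijection

variable (b : SBasis σ τ n) (c : SBasis σ τ' n) (H : IsSuper σ τ) (H' : IsSuper σ τ')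
  (hS : ∀ x ∈ S, τ x = x) (he : b.e ∈ S) (hU : ∀ s ∈ S, IsUnit (b.ce s))

/-- The monomials of degree `d` in the symmetric superalgebra, for a choice of the orderings of the
subsets of the odd basis vectors. -/
def symMono (c : SBasis σ τ' n) (K : Finset (Fin n) → List (Fin n)) (d : ℤ) (I : Finset (Fin n)) :
    FormAlg σ τ' (∅ : Set M') :=
  if (I.card : ℤ) ≤ d then c.word ∅ (K I) * FormAlg.vec σ τ' ∅ c.e ^ (d - I.card).toNat else 0

variable {K : Finset (Fin n) → List (Fin n)} (hK : ∀ I, (K I).Perm I.toList)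
include hK

lemma symMono_mem_grade (d : ℤ) (I : Finset (Fin n)) :
    c.symMono K d I ∈ FormAlg.grade σ τ' (∅ : Set M') d := by
  unfold symMono
  split_ifs with h
  · refine Submodule.subset_span
      ⟨(K I).map c.o ++ List.replicate (d - I.card).toNat c.e, [], ?_, ?_⟩
    · have := (hK I).length_eq
      simp at this ⊢
      omega
    · simp [word, Function.comp_def]
  · exact zero_mem _

include H' in
-- The same argument as in the localization, with natural powers of `e` only. Spanning is enough:
-- the coefficients will be controlled by the independence of the monomials in the localization.
lemma exists_sum_symMono {d : ℤ} {P : FormAlg σ τ' (∅ : Set M')}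
    (hP : P ∈ FormAlg.grade σ τ' (∅ : Set M') d) :
    ∃ f : Finset (Fin n) → A, P = ∑ I, f I • c.symMono K d I := by
  suffices FormAlg.grade σ τ' (∅ : Set M') d ≤
      Submodule.span A (Set.range (c.symMono K d)) by
    obtain ⟨f, hf⟩ := (Submodule.mem_span_range_iff_exists_fun A).1 (this hP)
    exact ⟨f, hf.symm⟩
  let E : ℤ → Set (FormAlg σ τ' (∅ : Set M')) := fun j =>
    {x | ∃ a : ℕ, (a : ℤ) = j ∧ x = FormAlg.vec σ τ' ∅ c.e ^ a}
  refine (c.grade_le_wordSpan (E := E) H' ?_ ?_ ?_ ?_ (fun s => s.2.elim) d).trans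
    (c.wordSpan_le ?_)
  · rintro _ _ _ ⟨a, rfl, rfl⟩ _ ⟨a', rfl, rfl⟩
    exact ⟨a + a', by push_cast; rfl, (pow_add _ _ _).symm⟩
  · rintro _ _ ⟨a, rfl, rfl⟩ w
    have h : Commute (FormAlg.vec σ τ' ∅ c.e) w :=
      FormAlg.vec_even_comm H' (fun _ h => h.elim) c.τ_e w
    exact (h.pow_left a).eq
  · exact ⟨0, rfl, (pow_zero _).symm⟩
  · exact ⟨1, rfl, (pow_one _).symm⟩
  · intro L hL
    refine ⟨K L.toFinset, ?_, ?_⟩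
    · refine ((List.perm_ext_iff_of_nodup hL (Finset.nodup_toList _)).2 fun a => ?_).trans
        (hK L.toFinset).symm
      simp
    · rintro _ hj _ ⟨a, rfl, rfl⟩
      refine Submodule.subset_span ⟨L.toFinset, ?_⟩
      rw [← List.toFinset_card_of_nodup hL] at hj
      have : (d - L.toFinset.card).toNat = a := by omega
      rw [symMono, if_pos (by omega), this]

omit hK

/-- The inclusion of the symmetric superalgebra in its localization. -/
def incl (σ : A →ₐ[ℂ] A) (τ : M →+ M) (S : Set M) : FormAlg σ τ (∅ : Set M) →ₐ[ℂ] FormAlg σ τ S :=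
  FormAlg.map (AlgHom.id ℂ A) (AddMonoidHom.id M) (fun _ => rfl) (fun _ => rfl) (fun _ _ => rfl)
    (fun _ h => h.elim)

lemma incl_smul (a : A) (x : FormAlg σ τ (∅ : Set M)) : incl σ τ S (a • x) = a • incl σ τ S x :=
  FormAlg.map_smul ..

lemma incl_symMono (d : ℤ) (I : Finset (Fin n)) :
    incl σ τ S (b.symMono Finset.toList d I) = if (I.card : ℤ) ≤ d then b.mono he I (d - I.card)
      else 0 := by
  unfold symMono
  split_ifs with h
  · obtain ⟨a, ha⟩ := Int.eq_ofNat_of_zero_le (sub_nonneg.2 h)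
    rw [ha, mono, unitE_zpow_natCast, map_mul, map_pow]
    congr 2
    · rw [word, map_list_prod, List.map_map]
      congr 1
      exact List.map_congr_left fun l _ => FormAlg.map_vec ..
    · exact FormAlg.map_vec ..
  · exact map_zero _

/-- Listing `I` before its complement turns a subset into a permutation to which `contr_vol`
applies. -/
lemma exists_perm_of_finset (I : Finset (Fin n)) : ∃ π : Equiv.Perm (Fin n),
    ((List.finRange n).take I.card).map π = I.toList ∧
      ((List.finRange n).drop I.card).map π = Iᶜ.toList := by
  have hlen : (I.toList ++ Iᶜ.toList).length = n := by
    rw [List.length_append, Finset.length_toList, Finset.length_toList, Finset.card_add_card_compl,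
      Fintype.card_fin]
  have hnd : (I.toList ++ Iᶜ.toList).Nodup := by
    refine List.nodup_append.2 ⟨Finset.nodup_toList _, Finset.nodup_toList _, ?_⟩
    rintro a ha _ hb rfl
    simp at ha hb
    exact hb ha
  let f : Fin n → Fin n := fun i => (I.toList ++ Iᶜ.toList).get (i.cast hlen.symm)
  have hf : Function.Injective f := fun i j h => by
    have := hnd.injective_get h
    simpa [Fin.ext_iff] using this
  have hmap : (List.finRange n).map f = I.toList ++ Iᶜ.toList := by
    refine List.ext_getElem (by simp [hlen]) fun i h1 h2 => ?_
    simp [f]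
  have hc : I.card = I.toList.length := (Finset.length_toList I).symm
  refine ⟨Equiv.ofBijective f (Finite.injective_iff_bijective.1 hf), ?_, ?_⟩
  · rw [List.map_take]
    change ((List.finRange n).map f).take _ = _
    rw [hmap, hc, List.take_left]
  · rw [List.map_drop]
    change ((List.finRange n).map f).drop _ = _
    rw [hmap, hc, List.drop_left]

/-- Contracting with the letters outside `I` leaves `o_I`, and the remaining `a = |I| - k`
contractions with `c.e` turn `e⁻¹` into a multiple of `e^(-a-1)`. This reaches exactly the monomials
of degree `k - 1` with negative exponent. The constant `± (-1)^a a!` is nonzero in characteristic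
zero. -/
lemma exists_contr_symMono (k : ℤ) (I : Finset (Fin n)) : ∃ u : ℂ, u ≠ 0 ∧
    b.contr c H H' hS (c.symMono (fun J => J.toList.reverse) (n - k) Iᶜ) (b.vol he) =
      if k ≤ I.card then u • b.mono he I (k - 1 - I.card) else 0 := by
  obtain ⟨π, h1, h2⟩ := exists_perm_of_finset I
  have hcard : (Iᶜ.card : ℤ) = n - I.card := by
    have := Finset.card_add_card_compl I
    rw [Fintype.card_fin] at this
    omega
  set a := ((n : ℤ) - k - Iᶜ.card).toNat with ha
  refine ⟨((Equiv.Perm.sign π : ℤ) : ℂ) * ((-1) ^ a * (a.factorial : ℂ)), ?_, ?_⟩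
  · refine mul_ne_zero ?_ (mul_ne_zero (by simp) (Nat.cast_ne_zero.2 a.factorial_ne_zero))
    rcases Int.units_eq_one_or (Equiv.Perm.sign π) with h | h <;> simp [h]
  · unfold symMono
    by_cases h : k ≤ I.card
    · simp only [if_pos h]
      rw [if_pos (by omega), ← h2, ← ha, contr_vol, h1]
      have : k - 1 - I.card = -((a + 1 : ℕ) : ℤ) := by push_cast; omega
      rw [mono, this, unitE_zpow_neg]
    · rw [if_neg h, if_neg (by omega), contr_zero]

omit b c in
include H in
lemma iterate_iterate (m : ℕ) (a : A) : σ^[m] (σ^[m] a) = a := by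
  induction m generalizing a with
  | zero => rfl
  | succ m ih =>
    rw [Function.iterate_succ_apply', Function.iterate_succ_apply, ih, H.σσ]

include H hS in
lemma vol_mul_scal (a : A) :
    b.vol he * FormAlg.scal σ τ S a = FormAlg.scal σ τ S (σ^[n] a) * b.vol he := by
  rw [vol, mul_assoc, ← FormAlg.inv_comm H hS, ← mul_assoc, b.word_mul_scal H, List.length_finRange,
    mul_assoc]

/-- A coefficient of the polyvector multiplies `vol` from the right; bringing it to the left past
`n` odd letters applies `σ` that many times. -/
lemma contr_sum_vol (k : ℤ) (f : Finset (Fin n) → A)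
    (u : Finset (Fin n) → ℂ) (hu : ∀ I, b.contr c H H' hS
      (c.symMono (fun J => J.toList.reverse) (n - k) Iᶜ) (b.vol he) =
      if k ≤ I.card then u I • b.mono he I (k - 1 - I.card) else 0) :
    b.contr c H H' hS (∑ I, f I • c.symMono (fun J => J.toList.reverse) (n - k) Iᶜ) (b.vol he) =
      ∑ I : Finset (Fin n), FormAlg.scal σ τ S (if k ≤ I.card then u I • σ^[n] (f I) else 0) *
        b.mono he I (k - 1 - I.card) := by
  rw [contr_sum]
  refine Finset.sum_congr rfl fun I _ => ?_
  rw [contr_smul_left, b.vol_mul_scal H hS he, contr_scal_mul, hu]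
  split_ifs
  · rw [_root_.map_smul, smul_mul_assoc, mul_smul_comm]
  · rw [map_zero, mul_zero, zero_mul]

/-- The complementary range: `k - 1 - |I|` is nonnegative exactly when `|I| < k`. -/
lemma incl_sum (k : ℤ) (f : Finset (Fin n) → A) :
    incl σ τ S (∑ I, f I • b.symMono Finset.toList (k - 1) I) =
      ∑ I : Finset (Fin n), FormAlg.scal σ τ S (if k ≤ I.card then 0 else f I) *
        b.mono he I (k - 1 - I.card) := by
  rw [map_sum]
  refine Finset.sum_congr rfl fun I _ => ?_
  rw [incl_smul, b.incl_symMono he, FormAlg.smul_def]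
  by_cases h : k ≤ I.card
  · rw [if_pos h, if_neg (by omega), map_zero, mul_zero, zero_mul]
  · rw [if_neg h, if_pos (by omega)]

lemma exists_sum_compl {d : ℤ} {P : FormAlg σ τ' (∅ : Set M')} (H' : IsSuper σ τ')
    (hP : P ∈ FormAlg.grade σ τ' (∅ : Set M') d) :
    ∃ f : Finset (Fin n) → A, P = ∑ I, f I • c.symMono (fun J => J.toList.reverse) d Iᶜ := by
  obtain ⟨f, hf⟩ := c.exists_sum_symMono H' (K := fun J => J.toList.reverse)
    (fun J => List.reverse_perm _) hP
  refine ⟨fun I => f Iᶜ, ?_⟩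
  rw [hf]
  exact (Equiv.sum_comp (Equiv.ofBijective _ compl_involutive.bijective)
    (fun I => f I • c.symMono (fun J => J.toList.reverse) d I)).symm

theorem contr_vol_mem_grade (k : ℤ) {P : FormAlg σ τ' (∅ : Set M')}
    (hP : P ∈ FormAlg.grade σ τ' (∅ : Set M') (n - k)) :
    b.contr c H H' hS P (b.vol he) ∈ FormAlg.grade σ τ S (k - 1) := by
  obtain ⟨f, rfl⟩ := c.exists_sum_compl H' hP
  choose u hu0 hu using b.exists_contr_symMono c H H' hS he k
  rw [b.contr_sum_vol c H H' hS he k f u hu]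
  exact sum_mem fun I _ => Submodule.smul_mem _ _ (b.mono_mem_grade he I _)

include hU in
-- Each monomial receives a contribution from only one summand, according to whether `k ≤ |I|`, so
-- independence kills the coefficients of both. The remaining coefficients multiply a `symMono`
-- whose value is `0` by default.
theorem contr_vol_add_incl_eq_zero (k : ℤ) {P : FormAlg σ τ' (∅ : Set M')}
    {w : FormAlg σ τ (∅ : Set M)} (hP : P ∈ FormAlg.grade σ τ' (∅ : Set M') (n - k))
    (hw : w ∈ FormAlg.grade σ τ (∅ : Set M) (k - 1))
    (h : b.contr c H H' hS P (b.vol he) + incl σ τ S w = 0) : P = 0 ∧ w = 0 := by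
  obtain ⟨f, rfl⟩ := c.exists_sum_compl H' hP
  obtain ⟨g, rfl⟩ := b.exists_sum_symMono H (K := Finset.toList) (fun _ => List.Perm.refl _) hw
  choose u hu0 hu using b.exists_contr_symMono c H H' hS he k
  rw [b.contr_sum_vol c H H' hS he k f u hu, b.incl_sum he, ← Finset.sum_add_distrib] at h
  simp only [← add_mul, ← map_add] at h
  have h0 := congrFun (b.mono_independent H hS he hU c H' _ _ h)
  constructor
  · refine Finset.sum_eq_zero fun I _ => ?_
    have hI := h0 I
    by_cases hk : k ≤ I.card
    · simp only [if_pos hk, add_zero, Pi.zero_apply, smul_eq_zero, hu0, false_or] at hI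
      rw [← iterate_iterate H n (f I), hI, Function.iterate_fixed (map_zero σ), zero_smul]
    · have hcard := Finset.card_add_card_compl I
      rw [Fintype.card_fin] at hcard
      rw [symMono, if_neg (by omega), smul_zero]
  · refine Finset.sum_eq_zero fun I _ => ?_
    have hI := h0 I
    by_cases hk : k ≤ I.card
    · rw [symMono, if_neg (by omega), smul_zero]
    · simp only [if_neg hk, zero_add, Pi.zero_apply] at hI
      rw [hI, zero_smul]

include hU in
theorem exists_contr_vol_add_incl (k : ℤ) {x : FormAlg σ τ S} (hx : x ∈ FormAlg.grade σ τ S (k - 1)) :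
    ∃ P ∈ FormAlg.grade σ τ' (∅ : Set M') (n - k), ∃ w ∈ FormAlg.grade σ τ (∅ : Set M) (k - 1),
      b.contr c H H' hS P (b.vol he) + incl σ τ S w = x := by
  obtain ⟨h, rfl⟩ := (Submodule.mem_span_range_iff_exists_fun A).1
    (b.grade_le_span_mono H hS he hU (k - 1) hx)
  choose u hu0 hu using b.exists_contr_symMono c H H' hS he k
  -- The coefficients undo the constant `u I` and the twist `σ^[n]`, which is its own inverse. No
  -- case distinction is needed in the witnesses, since `symMono` is zero outside its range.
  refine ⟨∑ I, ((u I)⁻¹ • σ^[n] (h I)) • c.symMono (fun J => J.toList.reverse) (n - k) Iᶜ,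
    sum_mem fun I _ => Submodule.smul_mem _ _
      (c.symMono_mem_grade (fun J => List.reverse_perm _) _ _),
    ∑ I, h I • b.symMono Finset.toList (k - 1) I,
    sum_mem fun I _ => Submodule.smul_mem _ _
      (b.symMono_mem_grade (fun _ => List.Perm.refl _) _ _), ?_⟩
  rw [b.contr_sum_vol c H H' hS he k _ u hu, b.incl_sum he, ← Finset.sum_add_distrib]
  refine Finset.sum_congr rfl fun I _ => ?_
  have hσ : ∀ (m : ℕ) (z : ℂ) (a : A), σ^[m] (z • a) = z • σ^[m] a := fun m z a => by
    induction m generalizing a with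
    | zero => rfl
    | succ m ih => rw [Function.iterate_succ_apply, _root_.map_smul, ih, Function.iterate_succ_apply]
  rw [← add_mul, ← map_add, FormAlg.smul_def]
  congr 2
  split_ifs
  · rw [hσ, smul_smul, mul_inv_cancel₀ (hu0 I), one_smul, iterate_iterate H, add_zero]
  · rw [zero_add]

end Bijection

end SBasis

end Local

variable {n : ℕ}

/-! ### Coordinate vector fields on the charts -/

lemma isOpen_cone (V : Opens (Pn n)) : IsOpen (cone V) := by
  have h1 : IsOpen ((fun v : {v : Fin (n + 1) → ℂ // v ≠ 0} =>
      Projectivization.mk ℂ v.1 v.2) ⁻¹' (V : Set (Pn n))) := isOpen_coinduced.1 V.2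
  have h2 : IsOpen {v : Fin (n + 1) → ℂ | v ≠ 0} := isOpen_ne
  have h3 := h2.isOpenMap_subtype_val _ h1
  convert h3 using 1
  ext v
  constructor
  · rintro ⟨h, hv⟩
    exact ⟨⟨v, h⟩, hv, rfl⟩
  · rintro ⟨⟨w, h⟩, hw, rfl⟩
    exact ⟨h, hw⟩

lemma smul_mem_cone {V : Opens (Pn n)} {v : Fin (n + 1) → ℂ} (hv : v ∈ cone V) {t : ℂ}
    (ht : t ≠ 0) : t • v ∈ cone V := by
  obtain ⟨h, hv⟩ := hv
  refine ⟨smul_ne_zero ht h, ?_⟩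
  have : Projectivization.mk ℂ (t • v) (smul_ne_zero ht h) = Projectivization.mk ℂ v h :=
    (Projectivization.mk_eq_mk_iff' ℂ _ _ _ _).2 ⟨t, rfl⟩
  rwa [this]

lemma ne_zero_of_mem_cone {V : Opens (Pn n)} {v : Fin (n + 1) → ℂ} {t : ℂ}
    (h : t • v ∈ cone V) : t ≠ 0 := by
  rintro rfl
  exact h.1 (zero_smul ℂ v)

/-- The section `f + g ε` given by functions on the cone. -/
def O.mk {V : Opens (Pn n)} (f g : (Fin (n + 1) → ℂ) → ℂ) (hf : AnalyticOnNhd ℂ f (cone V))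
    (hg : AnalyticOnNhd ℂ g (cone V))
    (hf0 : ∀ v ∈ cone V, ∀ t : ℂ, t ≠ 0 → f (t • v) = f v)
    (hg0 : ∀ v ∈ cone V, ∀ t : ℂ, t ≠ 0 → t * g (t • v) = g v) : O V :=
  ⟨fun v => TrivSqZeroExt.inl (f v) + TrivSqZeroExt.inr (g v), ⟨f, hf, fun v => by simp⟩,
    ⟨g, hg, fun v => by simp⟩, fun v w t h => by
      have ht : t ≠ 0 := ne_zero_of_mem_cone (h ▸ w.2)
      simp [h, hf0 v v.2 t ht, hg0 v v.2 t ht]⟩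

lemma O.ext' {V : Opens (Pn n)} {a b : O V} (h : ∀ v, (a.1 v).fst = (b.1 v).fst)
    (h' : ∀ v, (a.1 v).snd = (b.1 v).snd) : a = b :=
  O.ext fun v => TrivSqZeroExt.ext (h v) (h' v)

section

variable {V : Opens (Pn n)}

lemma O.add_fst (a b : O V) (v) : ((a + b).1 v).fst = (a.1 v).fst + (b.1 v).fst := rfl
lemma O.add_snd (a b : O V) (v) : ((a + b).1 v).snd = (a.1 v).snd + (b.1 v).snd := rfl
lemma O.neg_fst (a : O V) (v) : ((-a).1 v).fst = -(a.1 v).fst := rfl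
lemma O.sub_fst (a b : O V) (v) : ((a - b).1 v).fst = (a.1 v).fst - (b.1 v).fst := rfl
lemma O.sub_snd (a b : O V) (v) : ((a - b).1 v).snd = (a.1 v).snd - (b.1 v).snd := rfl
lemma O.zero_fst (v) : ((0 : O V).1 v).fst = 0 := rfl
lemma O.zero_snd (v) : ((0 : O V).1 v).snd = 0 := rfl
lemma O.one_fst (v) : ((1 : O V).1 v).fst = 1 := rfl
lemma O.one_snd (v) : ((1 : O V).1 v).snd = 0 := rfl
lemma O.mul_fst (a b : O V) (v) : ((a * b).1 v).fst = (a.1 v).fst * (b.1 v).fst := rfl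
lemma O.mul_snd (a b : O V) (v) :
    ((a * b).1 v).snd = (a.1 v).fst * (b.1 v).snd + (a.1 v).snd * (b.1 v).fst := by
  change (a.1 v * b.1 v).snd = _
  simp
lemma O.smul_fst (c : ℂ) (a : O V) (v) : ((c • a).1 v).fst = c * (a.1 v).fst := rfl
lemma O.smul_snd (c : ℂ) (a : O V) (v) : ((c • a).1 v).snd = c * (a.1 v).snd := rfl
lemma O.sum_fst {ι : Type*} (s : Finset ι) (a : ι → O V) (v) :
    ((∑ j ∈ s, a j).1 v).fst = ∑ j ∈ s, ((a j).1 v).fst := by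
  classical
  induction s using Finset.induction_on with
  | empty => rfl
  | insert j s hj ih => rw [Finset.sum_insert hj, Finset.sum_insert hj, O.add_fst, ih]
lemma O.sum_snd {ι : Type*} (s : Finset ι) (a : ι → O V) (v) :
    ((∑ j ∈ s, a j).1 v).snd = ∑ j ∈ s, ((a j).1 v).snd := by
  classical
  induction s using Finset.induction_on with
  | empty => rfl
  | insert j s hj ih => rw [Finset.sum_insert hj, Finset.sum_insert hj, O.add_snd, ih]
lemma O.mk_fst (f g hf hg hf0 hg0) (v : cone V) :
    ((O.mk f g hf hg hf0 hg0 : O V).1 v).fst = f v := by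
  change (TrivSqZeroExt.inl (f v) + TrivSqZeroExt.inr (g v) : DualNumber ℂ).fst = f v
  simp
lemma O.mk_snd (f g hf hg hf0 hg0) (v : cone V) :
    ((O.mk f g hf hg hf0 hg0 : O V).1 v).snd = g v := by
  change (TrivSqZeroExt.inl (f v) + TrivSqZeroExt.inr (g v) : DualNumber ℂ).snd = g v
  simp
lemma coordZ_fst {i : Fin (n + 1)} (h : V ≤ chart i) (l) (v) :
    ((coordZ h l).1 v).fst = v.1 (i.succAbove l) / v.1 i := rfl
lemma coordZ_snd {i : Fin (n + 1)} (h : V ≤ chart i) (l) (v) : ((coordZ h l).1 v).snd = 0 := rfl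
lemma coordT_fst {i : Fin (n + 1)} (h : V ≤ chart i) (v) : ((coordT h).1 v).fst = 0 := rfl
lemma coordT_snd {i : Fin (n + 1)} (h : V ≤ chart i) (v) :
    ((coordT h).1 v).snd = 1 / v.1 i := rfl
lemma res_fst {W : Opens (Pn n)} (h : W ≤ V) (a : O V) (v) :
    ((resO h a).1 v).fst = (a.1 ⟨v.1, cone_mono h v.2⟩).fst := rfl
lemma res_snd {W : Opens (Pn n)} (h : W ≤ V) (a : O V) (v) :
    ((resO h a).1 v).snd = (a.1 ⟨v.1, cone_mono h v.2⟩).snd := rfl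

lemma even_iff {a : O V} : sg V a = a ↔ ∀ v, (a.1 v).snd = 0 := by
  constructor
  · intro h v
    have := congrArg (fun b : O V => (b.1 v).snd) h
    simp only [sg_snd] at this
    exact self_eq_neg.1 this.symm
  · intro h
    exact O.ext' (fun v => sg_fst a v) (fun v => by rw [sg_snd, h, neg_zero])

lemma odd_iff {a : O V} : sg V a = -a ↔ ∀ v, (a.1 v).fst = 0 := by
  constructor
  · intro h v
    have := congrArg (fun b : O V => (b.1 v).fst) h
    simp only [sg_fst, O.neg_fst] at this
    exact self_eq_neg.1 this
  · intro h
    exact O.ext' (fun v => by rw [sg_fst, O.neg_fst, h, neg_zero]) (fun v => sg_snd a v)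

open Classical in
/-- The even coefficient of a section, extended by zero outside of the cone. -/
def fstE (a : O V) : (Fin (n + 1) → ℂ) → ℂ :=
  fun v => if h : v ∈ cone V then (a.1 ⟨v, h⟩).fst else 0

open Classical in
/-- The odd coefficient of a section, extended by zero outside of the cone. -/
def sndE (a : O V) : (Fin (n + 1) → ℂ) → ℂ :=
  fun v => if h : v ∈ cone V then (a.1 ⟨v, h⟩).snd else 0

lemma fstE_apply (a : O V) (v : cone V) : fstE a v = (a.1 v).fst := by
  rw [fstE, dif_pos v.2]

lemma sndE_apply (a : O V) (v : cone V) : sndE a v = (a.1 v).snd := by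
  rw [sndE, dif_pos v.2]

lemma fstE_analytic (a : O V) : AnalyticOnNhd ℂ (fstE a) (cone V) := by
  obtain ⟨⟨f, hf, hf'⟩, -, -⟩ := a.2
  exact hf.congr (isOpen_cone V) fun v hv => by rw [fstE, dif_pos hv, hf']

lemma sndE_analytic (a : O V) : AnalyticOnNhd ℂ (sndE a) (cone V) := by
  obtain ⟨-, ⟨f, hf, hf'⟩, -⟩ := a.2
  exact hf.congr (isOpen_cone V) fun v hv => by rw [sndE, dif_pos hv, hf']

lemma fstE_smul (a : O V) {v} (hv : v ∈ cone V) {t : ℂ} (ht : t ≠ 0) :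
    fstE a (t • v) = fstE a v := by
  rw [fstE, fstE, dif_pos hv, dif_pos (smul_mem_cone hv ht)]
  exact (a.2.2.2 ⟨v, hv⟩ ⟨t • v, smul_mem_cone hv ht⟩ t rfl).1

lemma sndE_smul (a : O V) {v} (hv : v ∈ cone V) {t : ℂ} (ht : t ≠ 0) :
    t * sndE a (t • v) = sndE a v := by
  rw [sndE, sndE, dif_pos hv, dif_pos (smul_mem_cone hv ht)]
  exact (a.2.2.2 ⟨v, hv⟩ ⟨t • v, smul_mem_cone hv ht⟩ t rfl).2

/-- Partial derivatives in the homogeneous coordinates. -/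
def pd (f : (Fin (n + 1) → ℂ) → ℂ) (j : Fin (n + 1)) (v : Fin (n + 1) → ℂ) : ℂ :=
  fderiv ℂ f v (Pi.single j 1)

lemma pd_analytic {f : (Fin (n + 1) → ℂ) → ℂ} (hf : AnalyticOnNhd ℂ f (cone V)) (j) :
    AnalyticOnNhd ℂ (pd f j) (cone V) := fun v hv =>
  ((ContinuousLinearMap.apply ℂ ℂ (Pi.single j 1 : Fin (n + 1) → ℂ)).analyticAt _).comp
    (hf.fderiv v hv)

/-- The chain rule applied to the homogeneity relation. It is used with `s = 1` for even
coefficients, of degree `0`, and with `s = t` for odd ones, of degree `-1`. -/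
lemma pd_smul {f : (Fin (n + 1) → ℂ) → ℂ} (hf : AnalyticOnNhd ℂ f (cone V)) {t : ℂ} (ht : t ≠ 0)
    {s : ℂ} (hs : ∀ v ∈ cone V, s * f (t • v) = f v) (j) {v} (hv : v ∈ cone V) :
    s * (t * pd f j (t • v)) = pd f j v := by
  have h1 : HasFDerivAt f (fderiv ℂ f (t • v)) (t • v) :=
    ((hf _ (smul_mem_cone hv ht)).differentiableAt).hasFDerivAt
  have h2 : HasFDerivAt (fun w : Fin (n + 1) → ℂ => t • w)
      (t • ContinuousLinearMap.id ℂ (Fin (n + 1) → ℂ)) v := (hasFDerivAt_id v).const_smul t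
  have h3 := (h1.comp v h2).const_mul s
  have h4 : f =ᶠ[nhds v] fun w => s * (f ∘ fun w => t • w) w := by
    filter_upwards [(isOpen_cone V).mem_nhds hv] with w hw
    exact (hs w hw).symm
  have h5 := (h3.congr_of_eventuallyEq h4).fderiv
  rw [pd, pd, h5]
  simp

lemma pd_congr {f g : (Fin (n + 1) → ℂ) → ℂ} (h : ∀ v ∈ cone V, f v = g v) (j) {v}
    (hv : v ∈ cone V) : pd f j v = pd g j v := by
  have h4 : f =ᶠ[nhds v] g := by
    filter_upwards [(isOpen_cone V).mem_nhds hv] with w hw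
    exact h w hw
  rw [pd, pd, h4.fderiv_eq]

lemma pd_add {f g : (Fin (n + 1) → ℂ) → ℂ} (hf : AnalyticOnNhd ℂ f (cone V))
    (hg : AnalyticOnNhd ℂ g (cone V)) (j) {v} (hv : v ∈ cone V) :
    pd (fun w => f w + g w) j v = pd f j v + pd g j v := by
  rw [pd, pd, pd, fderiv_fun_add (hf v hv).differentiableAt (hg v hv).differentiableAt]
  rfl

lemma pd_mul {f g : (Fin (n + 1) → ℂ) → ℂ} (hf : AnalyticOnNhd ℂ f (cone V))
    (hg : AnalyticOnNhd ℂ g (cone V)) (j) {v} (hv : v ∈ cone V) :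
    pd (fun w => f w * g w) j v = f v * pd g j v + pd f j v * g v := by
  rw [pd, pd, pd, fderiv_fun_mul (hf v hv).differentiableAt (hg v hv).differentiableAt]
  simp [mul_comm]

variable {i : Fin (n + 1)}

/-- The partial derivative `∂a/∂z_l`. -/
def derZFun (i : Fin (n + 1)) (l : Fin n) (a : O V) : O V :=
  -- In homogeneous coordinates `∂/∂z_l` at constant `θ = ε / X_i` is `X_i ∂/∂X_l`; the factor `X_i`
  -- restores the degree lowered by differentiation.
  O.mk (fun v => v i * pd (fstE a) (i.succAbove l) v)
    (fun v => v i * pd (sndE a) (i.succAbove l) v)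
    (by
      intro v hv
      exact ((ContinuousLinearMap.proj (R := ℂ) (φ := fun _ => ℂ) i).analyticAt v).mul
        (pd_analytic (fstE_analytic a) _ v hv))
    (by
      intro v hv
      exact ((ContinuousLinearMap.proj (R := ℂ) (φ := fun _ => ℂ) i).analyticAt v).mul
        (pd_analytic (sndE_analytic a) _ v hv))
    (fun v hv t ht => by
      rw [← pd_smul (fstE_analytic a) ht (s := 1)
        (fun w hw => by rw [one_mul, fstE_smul a hw ht]) _ hv]
      simp only [Pi.smul_apply, smul_eq_mul]; ring)
    (fun v hv t ht => by
      rw [← pd_smul (sndE_analytic a) ht (fun w hw => sndE_smul a hw ht) _ hv]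
      simp only [Pi.smul_apply, smul_eq_mul]; ring)

lemma derZFun_fst (l) (a : O V) (v) :
    ((derZFun i l a).1 v).fst = v.1 i * pd (fstE a) (i.succAbove l) v := by
  unfold derZFun
  exact O.mk_fst ..

lemma derZFun_snd (l) (a : O V) (v) :
    ((derZFun i l a).1 v).snd = v.1 i * pd (sndE a) (i.succAbove l) v := by
  unfold derZFun
  exact O.mk_snd ..

/-- The coordinate derivation `∂/∂z_l`. -/
def derZ (_h : V ≤ chart i) (l : Fin n) : O V →ₗ[ℂ] O V where
  toFun := derZFun i l
  map_add' a b := by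
    refine O.ext' (fun v => ?_) (fun v => ?_)
    · rw [O.add_fst, derZFun_fst, derZFun_fst, derZFun_fst, ← mul_add,
        ← pd_add (fstE_analytic a) (fstE_analytic b) _ v.2]
      congr 1
      refine pd_congr (fun w hw => ?_) _ v.2
      rw [fstE_apply _ ⟨w, hw⟩, fstE_apply _ ⟨w, hw⟩, fstE_apply _ ⟨w, hw⟩, O.add_fst]
    · rw [O.add_snd, derZFun_snd, derZFun_snd, derZFun_snd, ← mul_add,
        ← pd_add (sndE_analytic a) (sndE_analytic b) _ v.2]
      congr 1
      refine pd_congr (fun w hw => ?_) _ v.2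
      rw [sndE_apply _ ⟨w, hw⟩, sndE_apply _ ⟨w, hw⟩, sndE_apply _ ⟨w, hw⟩, O.add_snd]
  map_smul' c a := by
    have hc : ∀ v, pd (fun _ : Fin (n + 1) → ℂ => c) (i.succAbove l) v = 0 := by
      intro v; simp [pd]
    refine O.ext' (fun v => ?_) (fun v => ?_)
    · rw [RingHom.id_apply, O.smul_fst, derZFun_fst, derZFun_fst]
      have h1 := pd_mul (f := fun _ => c) analyticOnNhd_const (fstE_analytic a) (i.succAbove l) v.2
      rw [hc, zero_mul, add_zero] at h1
      rw [mul_left_comm, ← h1]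
      congr 1
      refine pd_congr (fun w hw => ?_) _ v.2
      rw [fstE_apply _ ⟨w, hw⟩, fstE_apply _ ⟨w, hw⟩, O.smul_fst]
    · rw [RingHom.id_apply, O.smul_snd, derZFun_snd, derZFun_snd]
      have h1 := pd_mul (f := fun _ => c) analyticOnNhd_const (sndE_analytic a) (i.succAbove l) v.2
      rw [hc, zero_mul, add_zero] at h1
      rw [mul_left_comm, ← h1]
      congr 1
      refine pd_congr (fun w hw => ?_) _ v.2
      rw [sndE_apply _ ⟨w, hw⟩, sndE_apply _ ⟨w, hw⟩, O.smul_snd]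

lemma derZ_fst (h : V ≤ chart i) (l) (a : O V) (v) :
    ((derZ h l a).1 v).fst = v.1 i * pd (fstE a) (i.succAbove l) v := derZFun_fst l a v

lemma derZ_snd (h : V ≤ chart i) (l) (a : O V) (v) :
    ((derZ h l a).1 v).snd = v.1 i * pd (sndE a) (i.succAbove l) v := derZFun_snd l a v

lemma derZ_mul (h : V ≤ chart i) (l) (a b : O V) :
    derZ h l (a * b) = derZ h l a * b + a * derZ h l b := by
  have e1 := fstE_analytic a
  have e2 := fstE_analytic b
  have e3 := sndE_analytic a
  have e4 := sndE_analytic b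
  refine O.ext' (fun v => ?_) (fun v => ?_)
  · rw [O.add_fst, O.mul_fst, O.mul_fst, derZ_fst, derZ_fst, derZ_fst,
      pd_congr (g := fun w => fstE a w * fstE b w) (fun w hw => ?_) _ v.2, pd_mul e1 e2 _ v.2,
      fstE_apply, fstE_apply]
    · ring
    · rw [fstE_apply _ ⟨w, hw⟩, fstE_apply _ ⟨w, hw⟩, fstE_apply _ ⟨w, hw⟩, O.mul_fst]
  · rw [O.add_snd, O.mul_snd, O.mul_snd, derZ_snd, derZ_snd, derZ_snd, derZ_fst, derZ_fst,
      pd_congr (g := fun w => fstE a w * sndE b w + sndE a w * fstE b w) (fun w hw => ?_) _ v.2,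
      pd_add (e1.mul e4) (e3.mul e2) _ v.2, pd_mul e1 e4 _ v.2, pd_mul e3 e2 _ v.2,
      fstE_apply, fstE_apply, sndE_apply, sndE_apply]
    · ring
    · rw [fstE_apply _ ⟨w, hw⟩, fstE_apply _ ⟨w, hw⟩, sndE_apply _ ⟨w, hw⟩, sndE_apply _ ⟨w, hw⟩,
        sndE_apply _ ⟨w, hw⟩, O.mul_snd]

lemma derZ_sg (h : V ≤ chart i) (l) (a : O V) : derZ h l (sg V a) = sg V (derZ h l a) := by
  refine O.ext' (fun v => ?_) (fun v => ?_)
  · rw [sg_fst, derZ_fst, derZ_fst]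
    congr 1
    refine pd_congr (fun w hw => ?_) _ v.2
    rw [fstE_apply _ ⟨w, hw⟩, fstE_apply _ ⟨w, hw⟩, sg_fst]
  · have h1 : derZ h l (sg V a) + derZ h l a = derZ h l (sg V a + a) := (map_add ..).symm
    have h2 := congrArg (fun b : O V => (b.1 v).snd) h1
    simp only [O.add_snd] at h2
    rw [sg_snd, eq_neg_iff_add_eq_zero, h2, derZ_snd,
      pd_congr (g := fun _ => 0) (fun w hw => ?_) _ v.2]
    · simp [pd]
    · rw [sndE_apply _ ⟨w, hw⟩, O.add_snd, sg_snd, neg_add_cancel]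

lemma derZ_res {W : Opens (Pn n)} (h : V ≤ chart i) (hW : W ≤ V) (l) (a : O V) :
    resO hW (derZ h l a) = derZ (hW.trans h) l (resO hW a) := by
  refine O.ext' (fun v => ?_) (fun v => ?_)
  · rw [res_fst, derZ_fst, derZ_fst]
    congr 1
    refine pd_congr (V := W) (fun w hw => ?_) _ v.2
    rw [fstE_apply _ ⟨w, hw⟩, fstE_apply _ ⟨w, cone_mono hW hw⟩, res_fst]
  · rw [res_snd, derZ_snd, derZ_snd]
    congr 1
    refine pd_congr (V := W) (fun w hw => ?_) _ v.2
    rw [sndE_apply _ ⟨w, hw⟩, sndE_apply _ ⟨w, cone_mono hW hw⟩, res_snd]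

lemma derZ_coordT (h : V ≤ chart i) (l) : derZ h l (coordT h) = 0 := by
  refine O.ext' (fun v => ?_) (fun v => ?_)
  · rw [derZ_fst, pd_congr (g := fun _ => 0) (fun w hw => ?_) _ v.2]
    · simp [pd, O.zero_fst]
    · rw [fstE_apply _ ⟨w, hw⟩, coordT_fst]
  · rw [derZ_snd, pd_congr (g := fun w => (w i)⁻¹) (fun w hw => ?_) _ v.2, O.zero_snd, pd]
    · have hvi : v.1 i ≠ 0 := cone_ne h v.2
      have h1 : HasFDerivAt (fun w : Fin (n + 1) → ℂ => w i)
        (ContinuousLinearMap.proj (R := ℂ) (φ := fun _ => ℂ) i) v.1 :=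
        (ContinuousLinearMap.proj (R := ℂ) (φ := fun _ => ℂ) i).hasFDerivAt
      have h2 := ((hasDerivAt_inv hvi).comp_hasFDerivAt v.1 h1).fderiv
      rw [Function.comp_def] at h2
      rw [h2]
      simp
    · rw [sndE_apply _ ⟨w, hw⟩, coordT_snd, one_div]

lemma derZ_coordZ (h : V ≤ chart i) (l m) : derZ h l (coordZ h m) = if l = m then 1 else 0 := by
  refine O.ext' (fun v => ?_) (fun v => ?_)
  · rw [derZ_fst, pd_congr (g := fun w => w (i.succAbove m) * (w i)⁻¹) (fun w hw => ?_) _ v.2, pd]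
    · have hvi : v.1 i ≠ 0 := cone_ne h v.2
      have h0 : ∀ j, HasFDerivAt (fun w : Fin (n + 1) → ℂ => w j)
        (ContinuousLinearMap.proj (R := ℂ) (φ := fun _ => ℂ) j) v.1 := fun j =>
        (ContinuousLinearMap.proj (R := ℂ) (φ := fun _ => ℂ) j).hasFDerivAt
      have h2 := ((h0 (i.succAbove m)).fun_mul ((hasDerivAt_inv hvi).comp_hasFDerivAt v.1 (h0 i))).fderiv
      simp only [Function.comp_apply] at h2
      rw [h2]
      by_cases hlm : l = m
      · subst hlm
        simp [O.one_fst, hvi]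
      · simp [O.zero_fst, hlm, Ne.symm hlm]
    · rw [fstE_apply _ ⟨w, hw⟩, coordZ_fst, div_eq_mul_inv]
  · rw [derZ_snd, pd_congr (g := fun _ => 0) (fun w hw => ?_) _ v.2]
    · split_ifs <;> simp [pd, O.zero_snd, O.one_snd]
    · rw [sndE_apply _ ⟨w, hw⟩, coordZ_snd]

/-- The partial derivative `∂a/∂θ`. -/
def derTFun (i : Fin (n + 1)) (a : O V) : O V :=
  -- Since `ε = X_i θ`, the section `f + g ε` is `f + (X_i g) θ`.
  O.mk (fun v => v i * sndE a v) (fun _ => 0)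
    (by
      intro v hv
      exact ((ContinuousLinearMap.proj (R := ℂ) (φ := fun _ => ℂ) i).analyticAt v).mul
        (sndE_analytic a v hv))
    analyticOnNhd_const
    (fun v hv t ht => by
      rw [← sndE_smul a hv ht, Pi.smul_apply, smul_eq_mul]; ring)
    (fun v hv t ht => by simp)

lemma derTFun_fst (a : O V) (v) : ((derTFun i a).1 v).fst = v.1 i * (a.1 v).snd := by
  rw [← sndE_apply]
  unfold derTFun
  exact O.mk_fst ..

lemma derTFun_snd (a : O V) (v) : ((derTFun i a).1 v).snd = 0 := by
  unfold derTFun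
  exact O.mk_snd ..

/-- The coordinate derivation `∂/∂θ`. -/
def derT (_h : V ≤ chart i) : O V →ₗ[ℂ] O V where
  toFun := derTFun i
  map_add' a b := by
    refine O.ext' (fun v => ?_) (fun v => ?_)
    · rw [O.add_fst, derTFun_fst, derTFun_fst, derTFun_fst, O.add_snd, mul_add]
    · rw [O.add_snd, derTFun_snd, derTFun_snd, derTFun_snd, add_zero]
  map_smul' c a := by
    refine O.ext' (fun v => ?_) (fun v => ?_)
    · rw [RingHom.id_apply, O.smul_fst, derTFun_fst, derTFun_fst, O.smul_snd, mul_left_comm]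
    · rw [RingHom.id_apply, O.smul_snd, derTFun_snd, derTFun_snd, mul_zero]

lemma derT_fst (h : V ≤ chart i) (a : O V) (v) :
    ((derT h a).1 v).fst = v.1 i * (a.1 v).snd := derTFun_fst a v

lemma derT_snd (h : V ≤ chart i) (a : O V) (v) : ((derT h a).1 v).snd = 0 := derTFun_snd a v

lemma derT_coordZ (h : V ≤ chart i) (l) : derT h (coordZ h l) = 0 :=
  O.ext' (fun v => by rw [derT_fst, coordZ_snd, mul_zero, O.zero_fst])
    (fun v => by rw [derT_snd, O.zero_snd])

lemma derT_coordT (h : V ≤ chart i) : derT h (coordT h) = 1 :=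
  O.ext' (fun v => by
      rw [derT_fst, coordT_snd, O.one_fst, one_div, mul_inv_cancel₀ (cone_ne h v.2)])
    (fun v => by rw [derT_snd, O.one_snd])

lemma derT_res {W : Opens (Pn n)} (h : V ≤ chart i) (hW : W ≤ V) (a : O V) :
    resO hW (derT h a) = derT (hW.trans h) (resO hW a) :=
  O.ext' (fun v => by rw [res_fst, derT_fst, derT_fst, res_snd])
    (fun v => by rw [res_snd, derT_snd, derT_snd])

lemma derT_mul_of_even (h : V ≤ chart i) {a : O V} (ha : sg V a = a) (b : O V) :
    derT h (a * b) = derT h a * b + a * derT h b := by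
  rw [even_iff] at ha
  refine O.ext' (fun v => ?_) (fun v => ?_)
  · rw [derT_fst, O.add_fst, O.mul_snd, O.mul_fst, O.mul_fst, derT_fst, derT_fst, ha]
    ring
  · rw [derT_snd, O.add_snd, O.mul_snd, O.mul_snd, derT_snd, derT_snd, derT_fst, ha]
    ring

lemma derT_mul_of_odd (h : V ≤ chart i) {a : O V} (ha : sg V a = -a) (b : O V) :
    derT h (a * b) = derT h a * b + a * sg V (derT h (sg V b)) := by
  rw [odd_iff] at ha
  refine O.ext' (fun v => ?_) (fun v => ?_)
  · rw [derT_fst, O.add_fst, O.mul_snd, O.mul_fst, O.mul_fst, derT_fst, ha]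
    ring
  · rw [derT_snd, O.add_snd, O.mul_snd, O.mul_snd, derT_snd, derT_fst, sg_fst, derT_fst, sg_snd, sg_snd, ha]
    ring

/-- The ordinary product rule suffices, because the involutions in the super rule are invisible next
to an odd factor. -/
lemma derZ_mul_of_odd (h : V ≤ chart i) (l) {a : O V} (ha : sg V a = -a) (b : O V) :
    derZ h l (a * b) = derZ h l a * b + a * sg V (derZ h l (sg V b)) := by
  rw [derZ_mul, odd_mul_sg ha, derZ_sg, odd_mul_sg ha]

/-- The coordinate vector field `∂/∂z_l`. -/
def vfZ (h : V ≤ chart i) (l : Fin n) : (tangent n).obj V :=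
  (⟨fun W => derZ (W.2.trans h) l, fun W _ hU f => derZ_res (W.2.trans h) hU l f,
    fun W a b _ => derZ_mul (W.2.trans h) l a b,
    fun W _ b ha => derZ_mul_of_odd (W.2.trans h) l ha b⟩ : tangentSec V)

/-- The coordinate vector field `∂/∂θ`. -/
def vfT (h : V ≤ chart i) : (tangent n).obj V :=
  (⟨fun W => derT (W.2.trans h), fun W _ hU f => derT_res (W.2.trans h) hU f,
    fun W _ b ha => derT_mul_of_even (W.2.trans h) ha b,
    fun W _ b ha => derT_mul_of_odd (W.2.trans h) ha b⟩ : tangentSec V)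

end

/-! ### Vector fields are determined by the coordinates -/

/-- Remove the constant term of the power series and factor one argument out of the rest: `G` is the
sum of `p.shift`, which has the same radius of convergence. -/
lemma exists_linear_remainder {E : Type*} [NormedAddCommGroup E] [NormedSpace ℂ E]
    {f : E → ℂ} {x : E} (hf : AnalyticAt ℂ f x) :
    ∃ r : ENNReal, 0 < r ∧ ∃ G : E → E →L[ℂ] ℂ, AnalyticOnNhd ℂ G (Metric.eball 0 r) ∧
      ∀ y ∈ Metric.eball (0 : E) r, f (x + y) = f x + G y y := by
  obtain ⟨p, r, hp⟩ := hf
  have hr : p.shift.radius = p.radius := p.radius_shift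
  refine ⟨r, hp.r_pos, p.shift.sum, ?_, fun y hy => ?_⟩
  · have h1 := p.shift.hasFPowerSeriesOnBall (by rw [hr]; exact hp.r_pos.trans_le hp.r_le)
    exact h1.analyticOnNhd.mono (Metric.eball_subset_eball (hr ▸ hp.r_le))
  · have h1 := p.shift.hasSum (Metric.eball_subset_eball (hr ▸ hp.r_le) hy)
    have h2 := (ContinuousLinearMap.apply ℂ ℂ y).hasSum h1
    have h3 := (hasSum_nat_add_iff' 1).2 (hp.hasSum hy)
    have h4 : (fun k => (ContinuousLinearMap.apply ℂ ℂ y) (p.shift k fun _ => y)) =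
        fun k => p (k + 1) fun _ => y := by
      funext k
      change p (k + 1) (Fin.snoc (fun _ => y) y) = _
      congr 1
      funext j
      refine Fin.lastCases ?_ (fun j => ?_) j <;> simp
    have h5 := h3.unique (h4 ▸ h2)
    rw [Finset.sum_range_one, hp.coeff_zero] at h5
    exact (sub_eq_iff_eq_add'.1 h5)

/-- The open subset of projective space defined by an open set which is invariant under scaling. -/
def scaleOpen (S : Set (Fin (n + 1) → ℂ)) (hS : IsOpen S)
    (h : ∀ v ∈ S, ∀ t : ℂ, t ≠ 0 → t • v ∈ S) : Opens (Pn n) where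
  carrier := {p | ∀ (v : Fin (n + 1) → ℂ) (h : v ≠ 0), Projectivization.mk ℂ v h = p → v ∈ S}
  is_open' := by
    rw [isOpen_coinduced]
    have : (fun v : {v : Fin (n + 1) → ℂ // v ≠ 0} => Projectivization.mk ℂ v.1 v.2) ⁻¹'
        {p | ∀ (v : Fin (n + 1) → ℂ) (h : v ≠ 0), Projectivization.mk ℂ v h = p → v ∈ S}
        = Subtype.val ⁻¹' S := by
      ext ⟨v, hv⟩
      refine ⟨fun H => H v hv rfl, fun H w hw hwv => ?_⟩
      obtain ⟨c, hc⟩ := (Projectivization.mk_eq_mk_iff' ℂ w v hw hv).1 hwv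
      rw [← hc]
      refine h v H c ?_
      rintro rfl
      exact hw (by rw [← hc, zero_smul])
    rw [this]
    exact hS.preimage continuous_subtype_val

lemma mem_cone_scaleOpen {S : Set (Fin (n + 1) → ℂ)} {hS : IsOpen S}
    {h : ∀ v ∈ S, ∀ t : ℂ, t ≠ 0 → t • v ∈ S} {v : Fin (n + 1) → ℂ} :
    v ∈ cone (scaleOpen S hS h) ↔ v ≠ 0 ∧ v ∈ S := by
  constructor
  · rintro ⟨h0, hv⟩
    exact ⟨h0, hv v h0 rfl⟩
  · rintro ⟨h0, hv⟩
    refine ⟨h0, fun w hw hwv => ?_⟩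
    obtain ⟨c, hc⟩ := (Projectivization.mk_eq_mk_iff' ℂ w v hw h0).1 hwv
    rw [← hc]
    refine h v hv c ?_
    rintro rfl
    exact hw (by rw [← hc, zero_smul])

lemma mem_cone_inf {V W : Opens (Pn n)} {v : Fin (n + 1) → ℂ} (hV : v ∈ cone V)
    (hW : v ∈ cone W) : v ∈ cone (V ⊓ W) := ⟨hV.1, hV.2, hW.2⟩

/-- Hadamard's lemma. -/
lemma exists_res_eq_sum {V : Opens (Pn n)} {i : Fin (n + 1)} (h : V ≤ chart i) {f : O V}
    (hf : sg V f = f) (v₀ : cone V) :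
    ∃ (U : Opens (Pn n)) (hU : U ≤ V) (_ : v₀.1 ∈ cone U) (c : ℂ) (w g : Fin n → O U)
      (z : Fin n → ℂ),
      resO hU f = algebraMap ℂ (O U) c + ∑ l, w l * g l ∧
      (∀ l, w l = resO hU (coordZ h l) - algebraMap ℂ (O U) (z l)) ∧
      ∀ l, z l = v₀.1 (i.succAbove l) / v₀.1 i := by
  obtain ⟨r, hr, G, hG, hfG⟩ := exists_linear_remainder (fstE_analytic f v₀.1 v₀.2)
  -- Rescale `v` to have the same `i`-th coordinate as `v₀`, and take the displacement from `v₀`. It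
  -- is homogeneous of degree `0`, and its components are `v₀ᵢ` times the differences of the affine
  -- coordinates of `v` and `v₀`; hence the factor `v₀ᵢ` in the functions `g` below.
  set N : (Fin (n + 1) → ℂ) → (Fin (n + 1) → ℂ) := fun v => (v₀.1 i * (v i)⁻¹) • v - v₀.1 with hN
  have hi0 : v₀.1 i ≠ 0 := cone_ne h v₀.2
  have hNa : ∀ v, v i ≠ 0 → AnalyticAt ℂ N v := by
    intro v hv
    have h1 : AnalyticAt ℂ (fun v : Fin (n + 1) → ℂ => v i) v :=
      (ContinuousLinearMap.proj (R := ℂ) (φ := fun _ => ℂ) i).analyticAt v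
    exact ((analyticAt_const.mul (h1.inv hv)).smul analyticAt_id).sub analyticAt_const
  have hNs : ∀ (v : Fin (n + 1) → ℂ) (t : ℂ), t ≠ 0 → N (t • v) = N v := by
    intro v t ht
    simp only [hN, smul_smul, Pi.smul_apply, smul_eq_mul, mul_inv]
    congr 2
    field_simp
  have hopen : IsOpen ({v : Fin (n + 1) → ℂ | v i ≠ 0} ∩ N ⁻¹' Metric.eball 0 r) := by
    refine ContinuousOn.isOpen_inter_preimage (fun v hv => ?_)
      (isOpen_ne_fun (continuous_apply i) continuous_const) Metric.isOpen_eball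
    exact (hNa v hv).continuousAt.continuousWithinAt
  let U₀ : Opens (Pn n) := scaleOpen _ hopen (by
    rintro v ⟨h1, h2⟩ t ht
    refine ⟨mul_ne_zero ht h1, ?_⟩
    rw [Set.mem_preimage, hNs v t ht]
    exact h2)
  have hU : V ⊓ U₀ ≤ V := inf_le_left
  have hUN : ∀ v ∈ cone (V ⊓ U₀), N v ∈ Metric.eball 0 r := fun v hv =>
    (mem_cone_scaleOpen.1 (cone_mono inf_le_right hv)).2.2
  have hN0 : N v₀.1 = 0 := by
    simp [hN, hi0]
  have hmem : v₀.1 ∈ cone (V ⊓ U₀) := by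
    refine mem_cone_inf v₀.2 (mem_cone_scaleOpen.2 ⟨v₀.2.1, hi0, ?_⟩)
    rw [Set.mem_preimage, hN0]
    exact Metric.mem_eball_self hr
  have hga : ∀ l, AnalyticOnNhd ℂ
      (fun v => v₀.1 i * G (N v) (Pi.single (i.succAbove l) 1)) (cone (V ⊓ U₀)) := by
    intro l v hv
    refine analyticAt_const.mul ?_
    exact ((ContinuousLinearMap.apply ℂ ℂ
      (Pi.single (i.succAbove l) 1 : Fin (n + 1) → ℂ)).analyticAt _).comp
      ((hG _ (hUN v hv)).comp (hNa v (cone_ne (hU.trans h) hv)))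
  let g : Fin n → O (V ⊓ U₀) := fun l => O.mk
    (fun v => v₀.1 i * G (N v) (Pi.single (i.succAbove l) 1)) (fun _ => 0) (hga l)
    analyticOnNhd_const (fun v hv t ht => by rw [hNs v t ht]) (fun _ _ _ _ => mul_zero _)
  refine ⟨V ⊓ U₀, hU, hmem, fstE f v₀.1, fun l => resO hU (coordZ h l) -
    algebraMap ℂ (O _) (v₀.1 (i.succAbove l) / v₀.1 i), g,
    fun l => v₀.1 (i.succAbove l) / v₀.1 i, ?_, fun _ => rfl, fun _ => rfl⟩
  have hc1 : ∀ (c : ℂ) (v : cone (V ⊓ U₀)), ((algebraMap ℂ (O (V ⊓ U₀)) c).1 v).fst = c :=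
    fun _ _ => rfl
  have hc2 : ∀ (c : ℂ) (v : cone (V ⊓ U₀)), ((algebraMap ℂ (O (V ⊓ U₀)) c).1 v).snd = 0 :=
    fun _ _ => rfl
  refine O.ext' (fun v => ?_) (fun v => ?_)
  · have hvi : v.1 i ≠ 0 := cone_ne (hU.trans h) v.2
    have h1 := hfG (N v) (hUN v v.2)
    have h2 : v₀.1 + N v.1 = (v₀.1 i * (v.1 i)⁻¹) • v.1 := by simp [hN]
    have h4 : N v.1 i = 0 := by simp [hN, hvi]
    -- The `i`-th component of the displacement is zero, so only the `n` affine directions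
    -- contribute.
    have h3 : ∀ L : (Fin (n + 1) → ℂ) →L[ℂ] ℂ, L (N v.1) = ∑ l, N v.1 (i.succAbove l) *
        L (Pi.single (i.succAbove l) 1) := by
      intro L
      conv_lhs => rw [← Finset.univ_sum_single (N v.1), map_sum]
      rw [Fin.sum_univ_succAbove _ i, h4, Pi.single_zero, map_zero, zero_add]
      refine Finset.sum_congr rfl fun l _ => ?_
      rw [← smul_eq_mul, ← map_smul, ← Pi.single_smul', smul_eq_mul, mul_one]
    rw [h2, fstE_smul f (cone_mono hU v.2) (mul_ne_zero hi0 (inv_ne_zero hvi)), h3] at h1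
    rw [res_fst, O.add_fst, O.sum_fst, hc1, ← fstE_apply, h1]
    congr 1
    refine Finset.sum_congr rfl fun l _ => ?_
    rw [O.mul_fst, O.sub_fst, hc1, res_fst, coordZ_fst, O.mk_fst]
    simp only [hN, Pi.sub_apply, Pi.smul_apply, smul_eq_mul]
    field_simp
  · rw [res_snd, O.add_snd, O.sum_snd, hc2, even_iff.1 hf, Finset.sum_eq_zero, zero_add]
    intro l _
    rw [O.mul_snd, O.sub_snd, hc2, res_snd, coordZ_snd, O.mk_snd]
    ring

lemma act_res {V W : Opens (Pn n)} (h : W ≤ V) (D : (tangent n).obj V) (f : O V) :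
    resO h (act V D f) = act W ((tangent n).res h D) (resO h f) :=
  (show tangentSec V from D).2.1 ⟨V, le_rfl⟩ ⟨W, h⟩ h f

lemma act_mul_of_even {V : Opens (Pn n)} (D : (tangent n).obj V) {a : O V} (ha : sg V a = a)
    (b : O V) : act V D (a * b) = act V D a * b + a * act V D b :=
  (show tangentSec V from D).2.2.1 ⟨V, le_rfl⟩ a b ha

lemma act_mul_of_odd {V : Opens (Pn n)} (D : (tangent n).obj V) {a : O V} (ha : sg V a = -a)
    (b : O V) : act V D (a * b) = act V D a * b + a * sg V (act V D (sg V b)) :=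
  (show tangentSec V from D).2.2.2 ⟨V, le_rfl⟩ a b ha

lemma act_add {V : Opens (Pn n)} (D : (tangent n).obj V) (a b : O V) :
    act V D (a + b) = act V D a + act V D b :=
  map_add ((show tangentSec V from D).1 ⟨V, le_rfl⟩) a b

lemma act_smul {V : Opens (Pn n)} (D : (tangent n).obj V) (c : ℂ) (a : O V) :
    act V D (c • a) = c • act V D a :=
  map_smul ((show tangentSec V from D).1 ⟨V, le_rfl⟩) c a

lemma act_sum {V : Opens (Pn n)} (D : (tangent n).obj V) {ι : Type*} (s : Finset ι)
    (a : ι → O V) : act V D (∑ j ∈ s, a j) = ∑ j ∈ s, act V D (a j) :=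
  map_sum ((show tangentSec V from D).1 ⟨V, le_rfl⟩) a s

lemma act_algebraMap {V : Opens (Pn n)} (D : (tangent n).obj V) (c : ℂ) :
    act V D (algebraMap ℂ (O V) c) = 0 := by
  have h1 := act_mul_of_even D (map_one (sg V)) 1
  rw [mul_one, mul_one, one_mul, left_eq_add] at h1
  rw [Algebra.algebraMap_eq_smul_one, act_smul, h1, smul_zero]

lemma sg_coordZ {V : Opens (Pn n)} {i : Fin (n + 1)} (h : V ≤ chart i) (l) :
    sg V (coordZ h l) = coordZ h l := even_iff.2 fun _ => rfl

lemma sg_algebraMap {V : Opens (Pn n)} (c : ℂ) : sg V (algebraMap ℂ (O V) c) = algebraMap ℂ _ c :=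
  (sg V).commutes c

/-- The vanishing is checked at each point. Near the point, Hadamard's lemma writes `f` as a
constant plus `∑ w_l g_l`; the field kills each `w_l`, and what is left, `∑ w_l D(g_l)`, vanishes at
the point because the `w_l` do. -/
lemma act_eq_zero_of_even {V : Opens (Pn n)} {i : Fin (n + 1)} (h : V ≤ chart i)
    {D : (tangent n).obj V} (hz : ∀ l, act V D (coordZ h l) = 0) {f : O V} (hf : sg V f = f) :
    act V D f = 0 := by
  suffices H : ∀ v, (act V D f).1 v = 0 from O.ext H
  intro v
  obtain ⟨U, hU, hv, c, w, g, z, h1, h2, h3⟩ := exists_res_eq_sum h hf v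
  have hw0 : ∀ l, act U ((tangent n).res hU D) (w l) = 0 := by
    intro l
    have h4 : w l + algebraMap ℂ (O U) (z l) = resO hU (coordZ h l) := by rw [h2, sub_add_cancel]
    have h5 := congrArg (act U ((tangent n).res hU D)) h4
    rw [act_add, act_algebraMap, add_zero, ← act_res, hz, map_zero] at h5
    exact h5
  have hwe : ∀ l, sg U (w l) = w l := by
    intro l
    rw [h2, map_sub, ← res_sg, sg_coordZ, sg_algebraMap]
  have hwv : ∀ l, (w l).1 ⟨v.1, hv⟩ = 0 := by
    intro l
    refine TrivSqZeroExt.ext ?_ (even_iff.1 (hwe l) _)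
    rw [h2, O.sub_fst, res_fst, coordZ_fst, h3]
    exact sub_self _
  have h6 : (resO hU (act V D f)).1 ⟨v.1, hv⟩ = 0 := by
    rw [act_res, h1, act_add, act_algebraMap, zero_add, act_sum]
    refine TrivSqZeroExt.ext ?_ ?_
    · rw [O.sum_fst]
      refine Finset.sum_eq_zero fun l _ => ?_
      rw [act_mul_of_even _ (hwe l), hw0, zero_mul, zero_add, O.mul_fst, hwv]
      exact zero_mul _
    · rw [O.sum_snd]
      refine Finset.sum_eq_zero fun l _ => ?_
      rw [act_mul_of_even _ (hwe l), hw0, zero_mul, zero_add, O.mul_snd, hwv]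
      simp
  exact h6

lemma coordT_mul_derT {V : Opens (Pn n)} {i : Fin (n + 1)} (h : V ≤ chart i) {f : O V}
    (hf : sg V f = -f) : coordT h * derT h f = f := by
  refine O.ext' (fun v => ?_) (fun v => ?_)
  · rw [O.mul_fst, coordT_fst, zero_mul, odd_iff.1 hf]
  · have hvi : v.1 i ≠ 0 := cone_ne h v.2
    rw [O.mul_snd, coordT_fst, zero_mul, zero_add, coordT_snd, derT_fst]
    field_simp

lemma exists_even_add_odd {V : Opens (Pn n)} (f : O V) :
    ∃ a b : O V, sg V a = a ∧ sg V b = -b ∧ f = a + b := by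
  refine ⟨(1 / 2 : ℂ) • (f + sg V f), (1 / 2 : ℂ) • (f - sg V f), ?_, ?_, ?_⟩
  · rw [map_smul, map_add, sg_sg, add_comm]
  · rw [map_smul, map_sub, sg_sg, ← smul_neg, neg_sub]
  · rw [← smul_add]
    have : f + sg V f + (f - sg V f) = (2 : ℂ) • f := by rw [two_smul]; abel
    rw [this, smul_smul]
    norm_num

/-- An odd section `b` equals `θ ∂_θ b` with `∂_θ b` even, so the even case covers everything. -/
lemma act_eq_zero {V : Opens (Pn n)} {i : Fin (n + 1)} (h : V ≤ chart i)
    {D : (tangent n).obj V} (hz : ∀ l, act V D (coordZ h l) = 0) (ht : act V D (coordT h) = 0)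
    (f : O V) : act V D f = 0 := by
  obtain ⟨a, b, ha, hb, rfl⟩ := exists_even_add_odd f
  have h1 : sg V (derT h b) = derT h b := even_iff.2 fun v => derT_snd h b v
  rw [act_add, act_eq_zero_of_even h hz ha, zero_add, ← coordT_mul_derT h hb,
    act_mul_of_odd D (sg_coordT h), ht, zero_mul, zero_add, h1, act_eq_zero_of_even h hz h1,
    map_zero, mul_zero]

lemma tangent_ext {V : Opens (Pn n)} {D E : (tangent n).obj V}
    (h : ∀ W (hW : W ≤ V) (f : O W),
      act W ((tangent n).res hW D) f = act W ((tangent n).res hW E) f) : D = E := by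
  refine Subtype.ext (a1 := (show tangentSec V from D)) (a2 := (show tangentSec V from E)) ?_
  funext W
  exact LinearMap.ext fun f => h W.1 W.2 f

lemma act_vadd {V : Opens (Pn n)} (D E : (tangent n).obj V) (f : O V) :
    act V (D + E) f = act V D f + act V E f := rfl

lemma act_vsub {V : Opens (Pn n)} (D E : (tangent n).obj V) (f : O V) :
    act V (D - E) f = act V D f - act V E f := rfl

lemma act_vneg {V : Opens (Pn n)} (D : (tangent n).obj V) (f : O V) :
    act V (-D) f = -act V D f := rfl

lemma act_vsmul {V : Opens (Pn n)} (a : O V) (D : (tangent n).obj V) (f : O V) :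
    act V (a • D) f = a * act V D f := rfl

lemma act_vpar {V : Opens (Pn n)} (D : (tangent n).obj V) (f : O V) :
    act V ((tangent n).par V D) f = sg V (act V D (sg V f)) := rfl

lemma act_vsum {V : Opens (Pn n)} {ι : Type*} (s : Finset ι) (D : ι → (tangent n).obj V)
    (f : O V) : act V (∑ j ∈ s, D j) f = ∑ j ∈ s, act V (D j) f := by
  classical
  induction s using Finset.induction_on with
  | empty => rfl
  | insert j s hj ih => rw [Finset.sum_insert hj, Finset.sum_insert hj, act_vadd, ih]

lemma tangent_ext_coord {V : Opens (Pn n)} {i : Fin (n + 1)} (h : V ≤ chart i)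
    {D E : (tangent n).obj V} (hz : ∀ l, act V D (coordZ h l) = act V E (coordZ h l))
    (ht : act V D (coordT h) = act V E (coordT h)) : D = E := by
  refine tangent_ext fun W hW f => ?_
  rw [← sub_eq_zero, ← act_vsub, ← map_sub]
  refine act_eq_zero (hW.trans h) (fun l => ?_) ?_ f
  · change act W _ (resO hW (coordZ h l)) = 0
    rw [← act_res, act_vsub, hz, sub_self, map_zero]
  · change act W _ (resO hW (coordT h)) = 0
    rw [← act_res, act_vsub, ht, sub_self, map_zero]

section

variable {V : Opens (Pn n)} {i : Fin (n + 1)} (h : V ≤ chart i)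

lemma vfZ_coordZ (l m) : act V (vfZ h l) (coordZ h m) = if l = m then 1 else 0 :=
  derZ_coordZ h l m

lemma vfZ_coordT (l) : act V (vfZ h l) (coordT h) = 0 := derZ_coordT h l

lemma vfT_coordZ (m) : act V (vfT h) (coordZ h m) = 0 := derT_coordZ h m

lemma vfT_coordT : act V (vfT h) (coordT h) = 1 := derT_coordT h

lemma par_vfZ (l) : (tangent n).par V (vfZ h l) = vfZ h l := by
  refine tangent_ext_coord h (fun m => ?_) ?_
  · rw [act_vpar, sg_coordZ, vfZ_coordZ]
    split_ifs <;> simp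
  · rw [act_vpar, sg_coordT, ← neg_one_smul ℂ, act_smul, vfZ_coordT, smul_zero, map_zero]

lemma par_vfT : (tangent n).par V (vfT h) = -vfT h := by
  refine tangent_ext_coord h (fun m => ?_) ?_
  · rw [act_vpar, sg_coordZ, act_vneg, vfT_coordZ, map_zero, neg_zero]
  · rw [act_vpar, sg_coordT, ← neg_one_smul ℂ, act_smul, act_vneg, vfT_coordT, map_smul, map_one,
      neg_one_smul]

/-- Both sides agree on the coordinates, and these determine a vector field. This gives the freeness
of the tangent sheaf on a chart. -/
lemma tangent_expand (D : (tangent n).obj V) :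
    D = act V D (coordT h) • vfT h + ∑ l, act V D (coordZ h l) • vfZ h l := by
  refine tangent_ext_coord h (fun m => ?_) ?_
  · rw [act_vadd, act_vsum, act_vsmul, vfT_coordZ, mul_zero, zero_add]
    simp only [act_vsmul, vfZ_coordZ]
    simp
  · rw [act_vadd, act_vsum, act_vsmul, vfT_coordT, mul_one]
    simp only [act_vsmul, vfZ_coordT]
    simp

end

/-! ### Coordinate bases -/

lemma isSuper (F : SMod n) (V : Opens (Pn n)) : IsSuper (sg V) (F.par V) where
  σσ := sg_sg V
  ττ := F.par_par V
  τ_smul := F.par_smul V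
  odd_mul _ a hx := odd_mul_sg hx a

lemma shift_smul (F : SMod n) (V : Opens (Pn n)) (a : O V) (x : F.obj V) :
    a • pi F V x = pi F V (sg V a • x) := rfl

lemma shift_par (F : SMod n) (V : Opens (Pn n)) (x : F.obj V) :
    (shift F).par V (pi F V x) = -pi F V (F.par V x) := rfl

section

variable {V : Opens (Pn n)}

lemma pair_res {F : SMod n} {W : Opens (Pn n)} (h : W ≤ V) (φ : (dual F).obj V) (s : F.obj V) :
    resO h (pair F V φ s) = pair F W ((dual F).res h φ) (F.res h s) :=
  (show dualSec F V from φ).2 ⟨V, le_rfl⟩ ⟨W, h⟩ h s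

lemma pair_add_left {F : SMod n} (φ ψ : (dual F).obj V) (s : F.obj V) :
    pair F V (φ + ψ) s = pair F V φ s + pair F V ψ s := rfl

lemma pair_smul_left {F : SMod n} (a : O V) (φ : (dual F).obj V) (s : F.obj V) :
    pair F V (a • φ) s = a * pair F V φ s := rfl

lemma pair_sum_left {F : SMod n} {ι : Type*} (t : Finset ι) (φ : ι → (dual F).obj V)
    (s : F.obj V) : pair F V (∑ j ∈ t, φ j) s = ∑ j ∈ t, pair F V (φ j) s := by
  classical
  induction t using Finset.induction_on with
  | empty => rfl
  | insert j t hj ih => rw [Finset.sum_insert hj, Finset.sum_insert hj, pair_add_left, ih]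

lemma pair_add {F : SMod n} (φ : (dual F).obj V) (s t : F.obj V) :
    pair F V φ (s + t) = pair F V φ s + pair F V φ t :=
  map_add ((show dualSec F V from φ).1 ⟨V, le_rfl⟩) s t

lemma pair_smul {F : SMod n} (φ : (dual F).obj V) (a : O V) (s : F.obj V) :
    pair F V φ (a • s) = a * pair F V φ s :=
  map_smul ((show dualSec F V from φ).1 ⟨V, le_rfl⟩) a s

lemma pair_sum {F : SMod n} (φ : (dual F).obj V) {ι : Type*} (t : Finset ι) (s : ι → F.obj V) :
    pair F V φ (∑ j ∈ t, s j) = ∑ j ∈ t, pair F V φ (s j) :=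
  map_sum ((show dualSec F V from φ).1 ⟨V, le_rfl⟩) s t

lemma pair_par {F : SMod n} (φ : (dual F).obj V) (s : F.obj V) :
    pair F V ((dual F).par V φ) s = sg V (pair F V φ (F.par V s)) := rfl

lemma pair_diff (f : O V) (D : (tangent n).obj V) : pair (tangent n) V (diff V f) D = act V D f :=
  rfl

lemma dual_ext {F : SMod n} {φ ψ : (dual F).obj V}
    (h : ∀ W (hW : W ≤ V) (s : F.obj W),
      pair F W ((dual F).res hW φ) s = pair F W ((dual F).res hW ψ) s) : φ = ψ := by
  refine Subtype.ext (a1 := (show dualSec F V from φ)) (a2 := (show dualSec F V from ψ)) ?_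
  funext W
  exact LinearMap.ext fun s => h W.1 W.2 s

variable {i : Fin (n + 1)} (h : V ≤ chart i)

lemma vfZ_res {W : Opens (Pn n)} (hW : W ≤ V) (l) :
    (tangent n).res hW (vfZ h l) = vfZ (hW.trans h) l := rfl

lemma vfT_res {W : Opens (Pn n)} (hW : W ≤ V) :
    (tangent n).res hW (vfT h) = vfT (hW.trans h) := rfl

lemma dual_ext_coord {φ ψ : (dual (tangent n)).obj V}
    (ht : pair (tangent n) V φ (vfT h) = pair (tangent n) V ψ (vfT h))
    (hz : ∀ l, pair (tangent n) V φ (vfZ h l) = pair (tangent n) V ψ (vfZ h l)) : φ = ψ := by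
  refine dual_ext fun W hW D => ?_
  rw [tangent_expand (hW.trans h) D]
  simp only [pair_add, pair_sum, pair_smul, ← vfZ_res h hW, ← vfT_res h hW, ← pair_res, ht, hz]

lemma dual_expand (φ : (dual (tangent n)).obj V) :
    φ = pair (tangent n) V φ (vfT h) • diff V (coordT h) +
      ∑ l, pair (tangent n) V φ (vfZ h l) • diff V (coordZ h l) := by
  refine dual_ext_coord h ?_ fun l => ?_
  · simp only [pair_add_left, pair_sum_left, pair_smul_left, pair_diff, vfT_coordT, vfT_coordZ,
      mul_one, mul_zero, Finset.sum_const_zero, add_zero]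
  · simp only [pair_add_left, pair_sum_left, pair_smul_left, pair_diff, vfZ_coordT, vfZ_coordZ,
      mul_zero, zero_add, mul_ite, mul_one, Finset.sum_ite_eq, Finset.mem_univ, if_true]

lemma par_diff_coordT : (dual (tangent n)).par V (diff V (coordT h)) = -diff V (coordT h) := by
  refine dual_ext_coord h ?_ fun l => ?_
  · rw [pair_par, par_vfT, ← neg_one_smul (O V) (vfT h), ← neg_one_smul (O V) (diff V _),
      pair_smul_left, pair_smul, pair_diff, vfT_coordT, map_mul, map_neg, map_one]
  · rw [pair_par, par_vfZ, ← neg_one_smul (O V), pair_smul_left, pair_diff, vfZ_coordT, map_zero,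
      mul_zero]

lemma par_diff_coordZ (m) :
    (dual (tangent n)).par V (diff V (coordZ h m)) = diff V (coordZ h m) := by
  refine dual_ext_coord h ?_ fun l => ?_
  · rw [pair_par, par_vfT, ← neg_one_smul (O V), pair_smul, pair_diff, vfT_coordZ, mul_zero,
      map_zero]
  · rw [pair_par, par_vfZ, pair_diff, vfZ_coordZ]
    split_ifs <;> simp

/-- The basis `π∂_θ | π∂_{z_1}, …, π∂_{z_n}` of `ΠT`. -/
def basisT : SBasis (sg V) ((PiT n).par V) n where
  e := pi (tangent n) V (vfT h)
  o l := pi (tangent n) V (vfZ h l)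
  ce :=
    -- Scalars act on `ΠT` through `sg`; the outer `sg` makes the functional linear.
    { toFun := fun X => sg V (act V X (coordT h))
      map_add' := fun X Y => map_add (sg V) _ _
      map_smul' := fun a X => by
        change sg V (sg V a * act V X (coordT h)) = a * _
        rw [map_mul, sg_sg] }
  co l :=
    { toFun := fun X => sg V (act V X (coordZ h l))
      map_add' := fun X Y => map_add (sg V) _ _
      map_smul' := fun a X => by
        change sg V (sg V a * act V X (coordZ h l)) = a * _
        rw [map_mul, sg_sg] }
  expand X := by
    have h1 := congrArg (pi (tangent n) V) (tangent_expand h X)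
    rw [map_add, map_sum] at h1
    refine h1.trans (congrArg₂ (· + ·) ?_ (Finset.sum_congr rfl fun l _ => ?_))
    · exact congrArg (fun a : O V => pi (tangent n) V (a • vfT h)) (sg_sg V _).symm
    · exact congrArg (fun a : O V => pi (tangent n) V (a • vfZ h l)) (sg_sg V _).symm
  ce_e := (congrArg (sg V) (vfT_coordT h)).trans (map_one _)
  ce_o l := (congrArg (sg V) (vfZ_coordT h l)).trans (map_zero _)
  co_e l := (congrArg (sg V) (vfT_coordZ h l)).trans (map_zero _)
  co_o l m := by
    refine (congrArg (sg V) (vfZ_coordZ h m l)).trans ?_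
    by_cases hlm : l = m
    · rw [if_pos hlm, if_pos hlm.symm, map_one]
    · rw [if_neg hlm, if_neg (Ne.symm hlm), map_zero]
  τ_e := by rw [shift_par, par_vfT, map_neg, neg_neg]
  τ_o l := by rw [shift_par, par_vfZ]

/-- The basis `dθ | dz_1, …, dz_n` of `ΠT*`. -/
def basisF : SBasis (sg V) ((OneForms n).par V) n where
  e := d V (coordT h)
  o l := d V (coordZ h l)
  ce :=
    { toFun := fun φ => sg V (pair (tangent n) V φ (vfT h))
      map_add' := fun φ ψ => map_add (sg V) _ _
      map_smul' := fun a φ => by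
        change sg V (sg V a * pair (tangent n) V φ (vfT h)) = a * _
        rw [map_mul, sg_sg] }
  co l :=
    { toFun := fun φ => sg V (pair (tangent n) V φ (vfZ h l))
      map_add' := fun φ ψ => map_add (sg V) _ _
      map_smul' := fun a φ => by
        change sg V (sg V a * pair (tangent n) V φ (vfZ h l)) = a * _
        rw [map_mul, sg_sg] }
  expand φ := by
    have h1 := congrArg (pi (dual (tangent n)) V) (dual_expand h φ)
    rw [map_add, map_sum] at h1
    refine h1.trans (congrArg₂ (· + ·) ?_ (Finset.sum_congr rfl fun l _ => ?_))
    · exact congrArg (fun a : O V => pi (dual (tangent n)) V (a • diff V (coordT h)))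
        (sg_sg V _).symm
    · exact congrArg (fun a : O V => pi (dual (tangent n)) V (a • diff V (coordZ h l)))
        (sg_sg V _).symm
  ce_e := (congrArg (sg V) (vfT_coordT h)).trans (map_one _)
  ce_o l := (congrArg (sg V) (vfT_coordZ h l)).trans (map_zero _)
  co_e l := (congrArg (sg V) (vfZ_coordT h l)).trans (map_zero _)
  co_o l m := by
    refine (congrArg (sg V) (vfZ_coordZ h l m)).trans ?_
    by_cases hlm : l = m
    · rw [if_pos hlm, map_one]
    · rw [if_neg hlm, map_zero]
  τ_e := by rw [d, shift_par, par_diff_coordT, map_neg, neg_neg]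
  τ_o l := by rw [d, shift_par, par_diff_coordZ]

lemma basisF_e_mem : (basisF h).e ∈ invSet V := ⟨i, h, rfl⟩

variable {j : Fin (n + 1)} (h' : V ≤ chart j)

/-- The even coordinates of the other chart have no odd part. This is the vanishing block required
by `Compat` and by `vol_change`. -/
lemma derT_coordZ' (m) : derT h (coordZ h' m) = 0 :=
  O.ext' (fun v => by rw [derT_fst, coordZ_snd, mul_zero, O.zero_fst])
    (fun v => by rw [derT_snd, O.zero_snd])

/-- Since `θ' = (X_i / X_j) θ`, the two derivatives are `X_i / X_j` and `X_j / X_i`. -/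
lemma derT_mul_derT : derT h (coordT h') * derT h' (coordT h) = 1 := by
  refine O.ext' (fun v => ?_) (fun v => ?_)
  · have h1 : v.1 i ≠ 0 := cone_ne h v.2
    have h2 : v.1 j ≠ 0 := cone_ne h' v.2
    rw [O.mul_fst, derT_fst, derT_fst, coordT_snd, coordT_snd, O.one_fst]
    field_simp
  · rw [O.mul_snd, derT_snd, derT_snd, O.one_snd]
    ring

lemma basisF_ce_e : (basisF h).ce (basisF h').e = sg V (derT h (coordT h')) := rfl

lemma basisF_ce_mul : (basisF h).ce (basisF h').e * (basisF h').ce (basisF h).e = 1 := by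
  rw [basisF_ce_e, basisF_ce_e, ← map_mul, derT_mul_derT, map_one]

/-- On an overlap the forms `dθ` of the charts differ by unit coefficients, up to odd terms, so
inverting several of them yields the same monomials as inverting one. -/
lemma basisF_ce_isUnit : ∀ s ∈ invSet V, IsUnit ((basisF h).ce s) := by
  rintro _ ⟨k, hk, rfl⟩
  exact IsUnit.of_mul_eq_one _ (basisF_ce_mul h hk)

lemma basisF_ce_o (m) : (basisF h).ce ((basisF h').o m) = 0 :=
  (congrArg (sg V) (derT_coordZ' h h' m)).trans (map_zero _)

/-- The expansion of the differentials `dz', dθ'` and that of the old coordinate fields in the new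
ones have the same entries, the derivatives of new coordinates along old fields; hence most fields
hold by definition. -/
lemma compat_basis : SBasis.Compat (basisF h) (basisF h') (basisT h) (basisT h') where
  ee := rfl
  eo _ := rfl
  oe m := (congrArg (sg V) (derT_coordZ' h h' m)).trans (map_zero _)
  oe' m := basisF_ce_o h h' m
  oo _ _ := rfl

end

/-! ### Frames and the Berezinian sheaf -/

section

variable {F : SMod n} {p q : ℕ} {V : Opens (Pn n)}

/-- The frame `e'` is obtained from `e` by the supermatrix `g`. -/
def IsChange (e e' : Frame F p q V) (g : SuperGL p q V) : Prop :=
  ∀ i, Sum.elim e'.ev e'.od i = ∑ j, g.mat i j • Sum.elim e.ev e.od j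

lemma Frame.indep_self (e : Frame F p q V) : LinearIndependent (O V) (Sum.elim e.ev e.od) := by
  have := e.indep V le_rfl
  simpa only [F.res_self] using this

lemma Frame.span_self (e : Frame F p q V) :
    Submodule.span (O V) (Set.range (Sum.elim e.ev e.od)) = ⊤ := by
  have := e.span V le_rfl
  simpa only [F.res_self] using this

lemma Frame.coeff_ext (e : Frame F p q V) {a b : Fin p ⊕ Fin q → O V}
    (h : ∑ j, a j • Sum.elim e.ev e.od j = ∑ j, b j • Sum.elim e.ev e.od j) : a = b := by
  have h1 := Fintype.linearIndependent_iff.1 e.indep_self (fun j => a j - b j)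
    (by simp only [sub_smul, Finset.sum_sub_distrib, h, sub_self])
  funext j
  exact sub_eq_zero.1 (h1 j)

lemma Frame.exists_coeff (e : Frame F p q V) (x : F.obj V) :
    ∃ a : Fin p ⊕ Fin q → O V, x = ∑ j, a j • Sum.elim e.ev e.od j := by
  have h1 : x ∈ Submodule.span (O V) (Set.range (Sum.elim e.ev e.od)) := by
    rw [e.span_self]; trivial
  obtain ⟨a, ha⟩ := (Submodule.mem_span_range_iff_exists_fun (O V)).1 h1
  exact ⟨a, ha.symm⟩

/-- The sign of a basis vector. -/
def signOf : Fin p ⊕ Fin q → O V := Sum.elim (fun _ => 1) (fun _ => -1)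

lemma Frame.par_elim (e : Frame F p q V) (j) :
    F.par V (Sum.elim e.ev e.od j) = (signOf j : O V) • Sum.elim e.ev e.od j := by
  rcases j with j | j
  · exact (e.par_ev j).trans (one_smul _ _).symm
  · exact (e.par_od j).trans (neg_one_smul _ _).symm

lemma Frame.exists_matrix (e e' : Frame F p q V) :
    ∃ m : Matrix (Fin p ⊕ Fin q) (Fin p ⊕ Fin q) (O V),
      (∀ i, Sum.elim e'.ev e'.od i = ∑ j, m i j • Sum.elim e.ev e.od j) ∧
      ∀ i j, signOf i * m i j = sg V (m i j) * signOf j := by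
  choose m hm using fun i => e.exists_coeff (Sum.elim e'.ev e'.od i)
  refine ⟨m, hm, fun i j => ?_⟩
  have h1 := e'.par_elim i
  rw [hm i, map_sum, Finset.smul_sum] at h1
  simp only [F.par_smul, e.par_elim, smul_smul] at h1
  exact (congrFun (e.coeff_ext h1) j).symm

lemma odd_mul_odd {x y : O V} (hx : sg V x = -x) (hy : sg V y = -y) : x * y = 0 :=
  O.ext' (fun v => by rw [O.mul_fst, odd_iff.1 hx, zero_mul, O.zero_fst])
    (fun v => by rw [O.mul_snd, odd_iff.1 hx, odd_iff.1 hy, zero_mul, mul_zero, add_zero,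
      O.zero_snd])

/-- The matrices in the two directions are inverse to each other. Products of odd blocks vanish, so
the diagonal blocks are inverse to each other as well, which is the invertibility demanded by
`SuperGL`. -/
lemma exists_isChange (e e' : Frame F p q V) : ∃ g : SuperGL p q V, IsChange e e' g := by
  obtain ⟨m, hm, hs⟩ := e.exists_matrix e'
  obtain ⟨m', hm', hs'⟩ := e'.exists_matrix e
  have h12 : ∀ (m : Matrix (Fin p ⊕ Fin q) (Fin p ⊕ Fin q) (O V)),
      (∀ i j, signOf i * m i j = sg V (m i j) * signOf j) →
      ∀ i j, sg V (m (.inl i) (.inr j)) = -m (.inl i) (.inr j) := by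
    intro m hs i j
    have := hs (.inl i) (.inr j)
    simp only [signOf, Sum.elim_inl, Sum.elim_inr, one_mul, mul_neg, mul_one] at this
    rw [eq_neg_iff_add_eq_zero, add_comm, ← eq_neg_iff_add_eq_zero]
    exact this
  have h21 : ∀ (m : Matrix (Fin p ⊕ Fin q) (Fin p ⊕ Fin q) (O V)),
      (∀ i j, signOf i * m i j = sg V (m i j) * signOf j) →
      ∀ i j, sg V (m (.inr i) (.inl j)) = -m (.inr i) (.inl j) := by
    intro m hs i j
    have := hs (.inr i) (.inl j)
    simp only [signOf, Sum.elim_inl, Sum.elim_inr, neg_mul, one_mul, mul_one] at this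
    exact this.symm
  have hmul : m * m' = 1 := by
    refine Matrix.ext fun i j => ?_
    refine congrFun (e'.coeff_ext (a := fun j => (m * m') i j)
      (b := fun j => (1 : Matrix _ _ (O V)) i j) ?_) j
    simp only [Matrix.one_apply, ite_smul, one_smul, zero_smul, Finset.sum_ite_eq, Finset.mem_univ,
      if_true, Matrix.mul_apply, Finset.sum_smul]
    rw [Finset.sum_comm, hm i]
    refine Finset.sum_congr rfl fun j _ => ?_
    rw [hm' j, Finset.smul_sum]
    simp only [smul_smul]
  have hb := hmul
  rw [← Matrix.fromBlocks_toBlocks m, ← Matrix.fromBlocks_toBlocks m', Matrix.fromBlocks_multiply,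
    ← Matrix.fromBlocks_one, Matrix.fromBlocks_inj] at hb
  have hBC : m.toBlocks₁₂ * m'.toBlocks₂₁ = 0 := by
    refine Matrix.ext fun i j => ?_
    rw [Matrix.mul_apply]
    exact Finset.sum_eq_zero fun k _ => odd_mul_odd (h12 m hs i k) (h21 m' hs' k j)
  have hCB : m.toBlocks₂₁ * m'.toBlocks₁₂ = 0 := by
    refine Matrix.ext fun i j => ?_
    rw [Matrix.mul_apply]
    exact Finset.sum_eq_zero fun k _ => odd_mul_odd (h21 m hs i k) (h12 m' hs' k j)
  obtain ⟨hA, -, -, hD⟩ := hb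
  rw [hBC, add_zero] at hA
  rw [hCB, zero_add] at hD
  refine ⟨⟨m, fun i j => ?_, h12 m hs, h21 m hs, fun i j => ?_, ?_, ?_⟩, hm⟩
  · have := hs (.inl i) (.inl j)
    simp only [signOf, Sum.elim_inl, one_mul, mul_one] at this
    exact this.symm
  · have := hs (.inr i) (.inr j)
    simp only [signOf, Sum.elim_inr, neg_mul, one_mul, mul_neg, mul_one, neg_inj] at this
    exact this.symm
  · exact IsUnit.of_mul_eq_one _ (by rw [← Matrix.det_mul, hA, Matrix.det_one])
  · exact IsUnit.of_mul_eq_one _ (by rw [← Matrix.det_mul, hD, Matrix.det_one])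

/-- The correction `B D⁻¹ C` contains the product of two odd blocks and is zero. -/
lemma SuperGL.ber_eq (g : SuperGL p q V) :
    g.ber = g.mat.toBlocks₁₁.det * Ring.inverse g.mat.toBlocks₂₂.det := by
  have : g.mat.toBlocks₁₂ * g.mat.toBlocks₂₂⁻¹ * g.mat.toBlocks₂₁ = 0 := by
    refine Matrix.ext fun i j => ?_
    rw [Matrix.mul_apply]
    refine Finset.sum_eq_zero fun k _ => ?_
    rw [Matrix.mul_apply, Finset.sum_mul]
    change _ = (0 : O V)
    refine Finset.sum_eq_zero fun l _ => ?_
    rw [mul_right_comm]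
    exact (congrArg (· * _) (odd_mul_odd (g.odd₁₂ i l) (g.odd₂₁ k j))).trans (zero_mul _)
  rw [SuperGL.ber, this, sub_zero]

lemma IsChange.mat_eq {e e' : Frame F p q V} {g g' : SuperGL p q V} (h : IsChange e e' g)
    (h' : IsChange e e' g') : g.mat = g'.mat := by
  refine Matrix.ext fun i j => ?_
  exact congrFun (e.coeff_ext ((h i).symm.trans (h' i))) j

lemma IsChange.ber_eq {e e' : Frame F p q V} {g g' : SuperGL p q V} (h : IsChange e e' g)
    (h' : IsChange e e' g') : g.ber = g'.ber := by
  rw [g.ber_eq, g'.ber_eq, h.mat_eq h']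

/-- Without products of odd blocks, the diagonal blocks multiply separately, and so do their
determinants. -/
lemma IsChange.ber_mul {e e' e'' : Frame F p q V} {g g' g'' : SuperGL p q V}
    (h : IsChange e e' g) (h' : IsChange e' e'' g') (h'' : IsChange e e'' g'') :
    g''.ber = g'.ber * g.ber := by
  have hm : g''.mat = g'.mat * g.mat := by
    refine Matrix.ext fun i j => ?_
    refine congrFun (e.coeff_ext ((h'' i).symm.trans ?_)) j
    rw [h' i]
    simp only [Matrix.mul_apply, Finset.sum_smul]
    rw [Finset.sum_comm]
    refine Finset.sum_congr rfl fun j _ => ?_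
    rw [h j, Finset.smul_sum]
    simp only [smul_smul]
  rw [← Matrix.fromBlocks_toBlocks g''.mat, ← Matrix.fromBlocks_toBlocks g'.mat,
    ← Matrix.fromBlocks_toBlocks g.mat, Matrix.fromBlocks_multiply, Matrix.fromBlocks_inj] at hm
  obtain ⟨hA, -, -, hD⟩ := hm
  have hBC : g'.mat.toBlocks₁₂ * g.mat.toBlocks₂₁ = 0 := by
    refine Matrix.ext fun i j => ?_
    rw [Matrix.mul_apply]
    exact Finset.sum_eq_zero fun k _ => odd_mul_odd (g'.odd₁₂ i k) (g.odd₂₁ k j)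
  have hCB : g'.mat.toBlocks₂₁ * g.mat.toBlocks₁₂ = 0 := by
    refine Matrix.ext fun i j => ?_
    rw [Matrix.mul_apply]
    exact Finset.sum_eq_zero fun k _ => odd_mul_odd (g'.odd₂₁ i k) (g.odd₁₂ k j)
  rw [hBC, add_zero] at hA
  rw [hCB, zero_add] at hD
  rw [g.ber_eq, g'.ber_eq, g''.ber_eq, hA, hD, Matrix.det_mul, Matrix.det_mul,
    Ring.mul_inverse_rev]
  ring

/-- Restriction of supermatrices. -/
def SuperGL.res {W : Opens (Pn n)} (h : W ≤ V) (g : SuperGL p q V) : SuperGL p q W where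
  mat := g.mat.map (resO h)
  even₁₁ i j := by rw [Matrix.map_apply, ← res_sg, g.even₁₁]
  odd₁₂ i j := by rw [Matrix.map_apply, ← res_sg, g.odd₁₂, map_neg]
  odd₂₁ i j := by rw [Matrix.map_apply, ← res_sg, g.odd₂₁, map_neg]
  even₂₂ i j := by rw [Matrix.map_apply, ← res_sg, g.even₂₂]
  unit₁₁ := by
    have h1 := g.unit₁₁.map (resO h)
    rwa [AlgHom.map_det] at h1
  unit₂₂ := by
    have h1 := g.unit₂₂.map (resO h)
    rwa [AlgHom.map_det] at h1

lemma SuperGL.ber_res {W : Opens (Pn n)} (h : W ≤ V) (g : SuperGL p q V) :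
    (g.res h).ber = resO h g.ber := by
  rw [SuperGL.ber_eq, SuperGL.ber_eq, map_mul, AlgHom.map_det]
  congr 1
  have h1 : (g.res h).mat.toBlocks₂₂.det = resO h g.mat.toBlocks₂₂.det := by
    rw [AlgHom.map_det]; rfl
  have h2 := congrArg (resO h) (Ring.mul_inverse_cancel _ g.unit₂₂)
  rw [map_mul, map_one] at h2
  rw [h1]
  rw [← mul_one (Ring.inverse _), ← h2, ← mul_assoc,
    Ring.inverse_mul_cancel _ (IsUnit.of_mul_eq_one _ h2), one_mul]

lemma IsChange.res {W : Opens (Pn n)} (h : W ≤ V) {e e' : Frame F p q V} {g : SuperGL p q V}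
    (hg : IsChange e e' g) : IsChange (e.res h) (e'.res h) (g.res h) := by
  have hr : ∀ (f : Frame F p q V) i,
      Sum.elim (f.res h).ev (f.res h).od i = F.res h (Sum.elim f.ev f.od i) := by
    rintro f (i | i) <;> rfl
  intro i
  rw [hr, hg i, map_sum]
  refine Finset.sum_congr rfl fun j _ => ?_
  rw [F.res_smul, hr]
  rfl

/-- The Berezinian of the change of frames. -/
def berOf (e e' : Frame F p q V) : O V := (exists_isChange e e').choose.ber

lemma IsChange.berOf_eq {e e' : Frame F p q V} {g : SuperGL p q V} (h : IsChange e e' g) :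
    berOf e e' = g.ber := (exists_isChange e e').choose_spec.ber_eq h

/-- The section of `(Ber F)*` dual to the generator `[e]`. -/
def berGen (e : Frame F p q V) : (berDual F p q).obj V :=
  (⟨fun W e' => berOf (e.res W.2) e', by
    refine ⟨fun W U h e' => ?_, fun W e' e'' g hg => ?_⟩
    · have h1 := (exists_isChange (e.res W.2) e').choose_spec
      change resO h (SuperGL.ber _) = berOf (e.res U.2) (e'.res h)
      rw [← SuperGL.ber_res, ← (h1.res h).berOf_eq]
      congr 1
      simp only [Frame.res, F.res_res]
    · have h1 := (exists_isChange (e.res W.2) e').choose_spec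
      have h2 := (exists_isChange (e.res W.2) e'').choose_spec
      exact h1.ber_mul (g' := g) hg h2⟩ : berDualSec F p q V)

lemma Frame.res_self (e : Frame F p q V) : e.res le_rfl = e := by
  simp only [Frame.res, F.res_self]

/-- The value of a section of `(Ber F)*` on the generator `[e]`. -/
def berEval (D : (berDual F p q).obj V) (e : Frame F p q V) : O V :=
  (show berDualSec F p q V from D).1 ⟨V, le_rfl⟩ e

lemma berEval_change (D : (berDual F p q).obj V) {e e' : Frame F p q V} {g : SuperGL p q V}
    (h : IsChange e e' g) : berEval D e' = g.ber * berEval D e :=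
  (show berDualSec F p q V from D).2.2 ⟨V, le_rfl⟩ e e' g h

lemma berEval_res {W : Opens (Pn n)} (h : W ≤ V) (D : (berDual F p q).obj V)
    (e : Frame F p q V) : resO h (berEval D e) = berEval ((berDual F p q).res h D) (e.res h) :=
  (show berDualSec F p q V from D).2.1 ⟨V, le_rfl⟩ ⟨W, h⟩ h e

lemma berEval_smul (a : O V) (D : (berDual F p q).obj V) (e : Frame F p q V) :
    berEval (a • D) e = a * berEval D e := rfl

lemma berEval_add (D E : (berDual F p q).obj V) (e : Frame F p q V) :
    berEval (D + E) e = berEval D e + berEval E e := rfl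

lemma berEval_par (D : (berDual F p q).obj V) (e : Frame F p q V) :
    berEval ((berDual F p q).par V D) e = (-1) ^ (p + q) * sg V (berEval D e) := rfl

lemma isChange_self (e : Frame F p q V) {g : SuperGL p q V} (h : IsChange e e g) : g.ber = 1 := by
  have h1 : g.mat = 1 := by
    refine Matrix.ext fun i j => ?_
    refine congrFun (e.coeff_ext (b := fun j => (1 : Matrix _ _ (O V)) i j) ((h i).symm.trans ?_)) j
    simp only [Matrix.one_apply, ite_smul, one_smul, zero_smul, Finset.sum_ite_eq, Finset.mem_univ,
      if_true]
  rw [← Matrix.fromBlocks_toBlocks g.mat, ← Matrix.fromBlocks_one, Matrix.fromBlocks_inj] at h1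
  rw [g.ber_eq, h1.1, h1.2.2.2, Matrix.det_one, Matrix.det_one, Ring.inverse_one, mul_one]

lemma berEval_berGen (e : Frame F p q V) : berEval (berGen e) e = 1 := by
  change berOf (e.res le_rfl) e = 1
  rw [e.res_self]
  exact isChange_self e (exists_isChange e e).choose_spec

/-- Any frame over a smaller open set is a change of the restriction of `e`, and the change
determines the value. -/
lemma berDual_ext {D E : (berDual F p q).obj V} (e : Frame F p q V)
    (h : berEval D e = berEval E e) : D = E := by
  refine Subtype.ext (a1 := (show berDualSec F p q V from D))
    (a2 := (show berDualSec F p q V from E)) ?_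
  funext W e'
  change berEval ((berDual F p q).res W.2 D) e' = berEval ((berDual F p q).res W.2 E) e'
  obtain ⟨g, hg⟩ := exists_isChange (e.res W.2) e'
  rw [berEval_change _ hg, berEval_change _ hg, ← berEval_res, ← berEval_res, h]

lemma eq_berEval_smul_berGen (D : (berDual F p q).obj V) (e : Frame F p q V) :
    D = berEval D e • berGen e :=
  berDual_ext e (by rw [berEval_smul, berEval_berGen, mul_one])

end

section

variable {V : Opens (Pn n)} {i : Fin (n + 1)} (h : V ≤ chart i)

/-- The frame `dθ | dz_1, …, dz_n`. -/
def chartFrame : Frame (OneForms n) 1 n V where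
  ev _ := (basisF h).e
  od := (basisF h).o
  par_ev _ := (basisF h).τ_e
  par_od := (basisF h).τ_o
  indep W hW := by
    convert (basisF (hW.trans h)).linearIndependent using 1
    funext l
    rcases l with l | l <;> rfl
  span W hW := by
    convert (basisF (hW.trans h)).span_eq_top using 3
    funext l
    rcases l with l | l <;> rfl

/-- The coordinate frames of the chart. -/
def localFrames : LocalFrames h where
  pz := vfZ h
  pt := vfT h
  pz_z := vfZ_coordZ h
  pz_t := vfZ_coordT h
  pt_z := vfT_coordZ h
  pt_t := vfT_coordT h
  frame := chartFrame h
  frame_ev _ := rfl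
  frame_od _ := rfl
  gen := berGen (chartFrame h)
  gen_frame := berEval_berGen _

variable {j : Fin (n + 1)} (h' : V ≤ chart j)

/-- The upper left block is the single entry `∂θ'/∂θ`, up to `sg`; the lower right block is the
Jacobian of the even coordinates. -/
lemma berOf_chartFrame :
    berOf (chartFrame h) (chartFrame h') =
      (basisF h).ce (basisF h').e *
        Ring.inverse (SBasis.oddMatrix (basisF h) (basisF h')).det ∧
      IsUnit (SBasis.oddMatrix (basisF h) (basisF h')).det := by
  obtain ⟨g, hg⟩ := exists_isChange (chartFrame h) (chartFrame h')
  have h1 : ∀ x : (OneForms n).obj V, ∑ k, (Sum.elim (fun _ : Fin 1 => (basisF h).ce x)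
      (fun l => (basisF h).co l x)) k •
        Sum.elim (chartFrame h).ev (chartFrame h).od k = x := by
    intro x
    rw [Fintype.sum_sum_type, Fin.sum_univ_one]
    exact ((basisF h).expand x).symm
  have h2 : ∀ k, g.mat k = Sum.elim
      (fun _ : Fin 1 => (basisF h).ce (Sum.elim (chartFrame h').ev (chartFrame h').od k))
      (fun l => (basisF h).co l (Sum.elim (chartFrame h').ev (chartFrame h').od k)) := fun k =>
    (chartFrame h).coeff_ext ((hg k).symm.trans (h1 _).symm)
  have h3 : g.mat.toBlocks₂₂ = SBasis.oddMatrix (basisF h) (basisF h') := by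
    refine Matrix.ext fun m l => ?_
    exact congrFun (h2 (.inr m)) (.inr l)
  have h4 : g.mat.toBlocks₁₁.det = (basisF h).ce (basisF h').e := by
    rw [Matrix.det_fin_one]
    exact congrFun (h2 (.inl 0)) (.inl 0)
  refine ⟨?_, h3 ▸ g.unit₂₂⟩
  rw [hg.berOf_eq, g.ber_eq, h3, h4]

end

/-! ### The contraction of integral forms on the charts -/

section

variable {V : Opens (Pn n)} {i : Fin (n + 1)} (h : V ≤ chart i)

/-- The contraction of an extended form with a polyvector field. -/
def contrF (P : FAlg (PiT n) (fun _ => ∅) V) :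
    FAlg (OneForms n) invSet V →ₗ[ℂ] FAlg (OneForms n) invSet V :=
  (basisF h).contr (basisT h) (isSuper (OneForms n) V) (isSuper (PiT n) V) (invSet_even V) P

/-- The volume form `dz_1 ⋯ dz_n / dθ`. -/
def volF : FAlg (OneForms n) invSet V := (basisF h).vol (basisF_e_mem h)

/-- The extended form that represents a section of the Berezinian sheaf. -/
def kappa (D : (Ber n).obj V) : FAlg (OneForms n) invSet V :=
  sg V (berEval D (chartFrame h)) • volF h

/-- The parity involution of the extended forms. -/
abbrev parF (V : Opens (Pn n)) : FAlg (OneForms n) invSet V →ₐ[ℂ] FAlg (OneForms n) invSet V :=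
  parForm (OneForms n) invSet invSet_even V

/-- The parity involution of the polyvector fields. -/
abbrev parP (V : Opens (Pn n)) :
    FAlg (PiT n) (fun _ => ∅) V →ₐ[ℂ] FAlg (PiT n) (fun _ => ∅) V :=
  parForm (PiT n) (fun _ => ∅) (fun _ _ h => h.elim) V

lemma contrF_smul (P : FAlg (PiT n) (fun _ => ∅) V) (a : O V) (w) :
    contrF h P (a • w) = a • contrF h P w :=
  (basisF h).contr_scal_mul (basisT h) (isSuper (OneForms n) V) (isSuper (PiT n) V)
    (invSet_even V) P a w

lemma contrF_smul_left (P : FAlg (PiT n) (fun _ => ∅) V) (a : O V) (w) :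
    contrF h (a • P) w = contrF h P (w * FormAlg.scal _ _ _ a) :=
  (basisF h).contr_smul_left (basisT h) (isSuper (OneForms n) V) (isSuper (PiT n) V)
    (invSet_even V) P a w

lemma contrF_add_left (P Q : FAlg (PiT n) (fun _ => ∅) V) (w) :
    contrF h (P + Q) w = contrF h P w + contrF h Q w :=
  (basisF h).contr_add (basisT h) (isSuper (OneForms n) V) (isSuper (PiT n) V)
    (invSet_even V) P Q w

lemma parF_contrF (P : FAlg (PiT n) (fun _ => ∅) V) (w) :
    parF V (contrF h P w) = contrF h (parP V P) (parF V w) :=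
  (basisF h).par_contr (basisT h) (isSuper (OneForms n) V) (isSuper (PiT n) V)
    (invSet_even V) P w

lemma contrF_eq {j : Fin (n + 1)} (h' : V ≤ chart j) (P : FAlg (PiT n) (fun _ => ∅) V) (w) :
    contrF h P w = contrF h' P w :=
  (compat_basis h h').contr_eq (isSuper (OneForms n) V) (isSuper (PiT n) V) (invSet_even V) P w

/-- Passing to the other chart multiplies the value of `D` by the Berezinian, coefficient of `dθ'`
over determinant, and multiplies the volume form by the inverse. The outer `sg` is harmless since
the Berezinian is even. -/
lemma kappa_eq {j : Fin (n + 1)} (h' : V ≤ chart j) (D : (Ber n).obj V) :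
    kappa h' D = kappa h D := by
  obtain ⟨h1, h2⟩ := berOf_chartFrame h h'
  have h3 : berEval D (chartFrame h') =
      berOf (chartFrame h) (chartFrame h') * berEval D (chartFrame h) :=
    berEval_change D (exists_isChange _ _).choose_spec
  have h4 : sg V (berOf (chartFrame h) (chartFrame h')) =
      berOf (chartFrame h) (chartFrame h') := SuperGL.sg_ber _
  have h5 : volF h' = ((SBasis.oddMatrix (basisF h) (basisF h')).det *
      (basisF h').ce (basisF h).e) • volF h :=
    SBasis.vol_change (basisF h) (basisF h') (isSuper (OneForms n) V) (invSet_even V)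
      (basisF_ce_o h h') (basisF_e_mem h) (basisF_e_mem h') (basisF_ce_mul h h')
  rw [kappa, kappa, h3, h5, smul_smul, map_mul, h4, h1]
  congr 1
  have h6 := Ring.inverse_mul_cancel _ h2
  have h7 := basisF_ce_mul h h'
  linear_combination (sg V (berEval D (chartFrame h)) * (basisF h).ce (basisF h').e *
    (basisF h').ce (basisF h).e) * h6 + sg V (berEval D (chartFrame h)) * h7

lemma kappa_add (D E : (Ber n).obj V) : kappa h (D + E) = kappa h D + kappa h E := by
  rw [kappa, berEval_add, map_add, add_smul]; rfl

lemma kappa_smul (a : O V) (D : (Ber n).obj V) : kappa h (a • D) = sg V a • kappa h D := by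
  rw [kappa, berEval_smul, map_mul, mul_smul]; rfl

lemma parF_smul (a : O V) (w : FAlg (OneForms n) invSet V) :
    parF V (a • w) = sg V a • parF V w := FormAlg.map_smul _ _ _ _ _ _ a w

lemma parF_volF : parF V (volF h) = (-1 : O V) ^ n • volF h := by
  have h1 : parF V (volF h) = FormAlg.parAlg (isSuper (OneForms n) V) (invSet_even V)
    ((basisF h).vol (basisF_e_mem h)) := rfl
  rw [h1, SBasis.vol, map_mul, SBasis.par_word, FormAlg.parAlg_inv, List.length_finRange, mul_assoc,
    FormAlg.smul_def, map_pow, map_neg, map_one]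
  rfl

/-- The generator of the Berezinian sheaf has parity `n + 1` and the volume form has parity `n`.
This mismatch is why `Θ` is odd. -/
lemma kappa_par (D : (Ber n).obj V) : kappa h ((Ber n).par V D) = -parF V (kappa h D) := by
  rw [kappa, kappa, berEval_par, parF_smul, parF_volF, map_mul, map_pow, map_neg, map_one, smul_smul,
    ← neg_smul]
  congr 1
  ring

/-- Together with `kappa_mul_odd` this matches the relations of the tensor product: a scalar moved
from `D` to `P` acts on the form from the right. -/
lemma kappa_mul_even {a : O V} (ha : sg V a = a) (D : (Ber n).obj V) :
    kappa h D * FormAlg.scal _ _ _ a = kappa h (a • D) := by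
  rw [kappa_smul, ha, FormAlg.smul_def]
  exact (FormAlg.scal_even_comm (isSuper (OneForms n) V) (invSet_even V) ha _).symm

lemma kappa_mul_odd {a : O V} (ha : sg V a = -a) (D : (Ber n).obj V) :
    kappa h D * FormAlg.scal _ _ _ a = kappa h (a • (Ber n).par V D) := by
  rw [kappa_smul, ha, kappa_par, smul_neg, neg_smul, neg_neg, FormAlg.smul_def]
  have h1 := FormAlg.scal_odd_comm (isSuper (OneForms n) V) (invSet_even V) ha (parF V (kappa h D))
  refine Eq.trans ?_ h1.symm
  congr 1
  exact (FormAlg.parAlg_parAlg (isSuper (OneForms n) V) (invSet_even V) (kappa h D)).symm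

variable {W : Opens (Pn n)} (hW : W ≤ V)

/-- Restriction of extended forms. -/
abbrev resF (hW : W ≤ V) : FAlg (OneForms n) invSet V →ₐ[ℂ] FAlg (OneForms n) invSet W :=
  resForm (OneForms n) invSet invSet_res hW

/-- Restriction of polyvector fields. -/
abbrev resP (hW : W ≤ V) : FAlg (PiT n) (fun _ => ∅) V →ₐ[ℂ] FAlg (PiT n) (fun _ => ∅) W :=
  resForm (PiT n) (fun _ => ∅) (fun _ _ h => h.elim) hW

lemma resF_contrF (P : FAlg (PiT n) (fun _ => ∅) V) (w) :
    resF hW (contrF h P w) = contrF (hW.trans h) (resP hW P) (resF hW w) :=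
  SBasis.map_contr (basisF h) (basisT h) (isSuper (OneForms n) V) (isSuper (PiT n) V)
    (invSet_even V) (basisF (hW.trans h)) (basisT (hW.trans h)) (isSuper (OneForms n) W)
    (isSuper (PiT n) W) (invSet_even W) (resO hW) ((OneForms n).res hW) ((PiT n).res hW)
    (res_sg hW) ((OneForms n).res_par hW) ((PiT n).res_par hW) ((OneForms n).res_smul hW)
    ((PiT n).res_smul hW) (invSet_res hW)
    (fun φ => (congrArg (sg W) (pair_res hW φ (vfT h))).symm)
    (fun l φ => (congrArg (sg W) (pair_res hW φ (vfZ h l))).symm)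
    (fun X => (congrArg (sg W) (act_res hW X (coordT h))).symm)
    (fun l X => (congrArg (sg W) (act_res hW X (coordZ h l))).symm) P w

lemma resF_smul (a : O V) (w : FAlg (OneForms n) invSet V) :
    resF hW (a • w) = resO hW a • resF hW w := FormAlg.map_smul _ _ _ _ _ _ a w

lemma resF_volF : resF hW (volF h) = volF (hW.trans h) :=
  SBasis.map_vol (basisF h) (basisF (hW.trans h)) (resO hW) ((OneForms n).res hW) (res_sg hW)
    ((OneForms n).res_par hW) ((OneForms n).res_smul hW) (invSet_res hW) (basisF_e_mem h)
    (basisF_e_mem (hW.trans h)) rfl (fun _ => rfl)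

lemma resF_kappa (D : (Ber n).obj V) :
    resF hW (kappa h D) = kappa (hW.trans h) ((Ber n).res hW D) := by
  rw [kappa, resF_smul, resF_volF, res_sg, berEval_res]
  rfl

/-- The section `Θ(D ⊗ P)`. -/
def heav (hV : ∃ i, V ≤ chart i) (D : (Ber n).obj V) (P : FAlg (PiT n) (fun _ => ∅) V) :
    FAlg (OneForms n) invSet V :=
  contrF hV.choose_spec P (kappa hV.choose_spec D)

lemma heav_eq (D : (Ber n).obj V) (P : FAlg (PiT n) (fun _ => ∅) V) :
    heav ⟨i, h⟩ D P = contrF h P (kappa h D) := by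
  rw [heav, kappa_eq h, contrF_eq _ h]

variable (hV : ∃ i, V ≤ chart i)

lemma heav_add_left (D E : (Ber n).obj V) (P : FAlg (PiT n) (fun _ => ∅) V) :
    heav hV (D + E) P = heav hV D P + heav hV E P := by
  rw [heav, kappa_add, map_add]; rfl

lemma heav_add_right (D : (Ber n).obj V) (P Q : FAlg (PiT n) (fun _ => ∅) V) :
    heav hV D (P + Q) = heav hV D P + heav hV D Q := contrF_add_left ..

lemma heav_smul (a : O V) (D : (Ber n).obj V) (P : FAlg (PiT n) (fun _ => ∅) V) :
    heav hV (a • D) P = sg V a • heav hV D P := by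
  rw [heav, kappa_smul, contrF_smul]; rfl

lemma heav_even {a : O V} (ha : sg V a = a) (D : (Ber n).obj V)
    (P : FAlg (PiT n) (fun _ => ∅) V) : heav hV (a • D) P = heav hV D (a • P) := by
  rw [heav, heav, contrF_smul_left, kappa_mul_even _ ha]

lemma heav_odd {a : O V} (ha : sg V a = -a) (D : (Ber n).obj V)
    (P : FAlg (PiT n) (fun _ => ∅) V) :
    heav hV (a • (Ber n).par V D) P = heav hV D (a • P) := by
  rw [heav, heav, contrF_smul_left, kappa_mul_odd _ ha]

lemma heav_par (D : (Ber n).obj V) (P : FAlg (PiT n) (fun _ => ∅) V) :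
    heav hV ((Ber n).par V D) (parP V P) = -parF V (heav hV D P) := by
  rw [heav, heav, kappa_par, map_neg, parF_contrF]

lemma heav_res (hW' : ∃ i, W ≤ chart i) (D : (Ber n).obj V) (P : FAlg (PiT n) (fun _ => ∅) V) :
    resF hW (heav hV D P) = heav hW' ((Ber n).res hW D) (resP hW P) := by
  obtain ⟨i, h⟩ := hV
  -- The two proofs that `W` lies in a chart are equal, so the chart of `V` may be used for `W` as
  -- well.
  have h1 : heav hW' ((Ber n).res hW D) (resP hW P) =
    heav ⟨i, hW.trans h⟩ ((Ber n).res hW D) (resP hW P) := rfl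
  rw [h1, heav_eq h, heav_eq (hW.trans h), resF_contrF, resF_kappa]

lemma heav_mem_grade (k : ℤ) (D : (Ber n).obj V) {P : FAlg (PiT n) (fun _ => ∅) V}
    (hP : P ∈ FormAlg.grade (sg V) ((PiT n).par V) ∅ (n - k)) :
    heav hV D P ∈ FormAlg.grade (sg V) ((OneForms n).par V) (invSet V) (k - 1) := by
  obtain ⟨i, h⟩ := hV
  rw [heav_eq h, kappa, contrF_smul]
  exact Submodule.smul_mem _ _ ((basisF h).contr_vol_mem_grade (basisT h)
    (isSuper (OneForms n) V) (isSuper (PiT n) V) (invSet_even V) (basisF_e_mem h) k hP)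

lemma heav_berGen (P : FAlg (PiT n) (fun _ => ∅) V) :
    heav ⟨i, h⟩ (berGen (chartFrame h)) P = contrF h P (volF h) := by
  rw [heav_eq, kappa, berEval_berGen, map_one, one_smul]

end

/-! ### Homomorphisms out of tensor products -/

section

open TensorProduct

section

variable {F G : SMod n} {V : Opens (Pn n)} {X : Type} [AddCommGroup X] [Module (O V) X]
  (ρ : O V →+* O V) (β : F.obj V →+ G.obj V →+ X) (hρ : ∀ a x y, β (a • x) y = ρ a • β x y)

/-- Semilinear maps out of the tensor product over the integers. -/
def intTensorLift : (F.obj V ⊗[ℤ] G.obj V) →ₛₗ[ρ] X where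
  toFun := TensorProduct.liftAddHom (R := ℤ) β (fun z x y => by simp)
  map_add' := map_add _
  map_smul' a t := by
    induction t with
    | zero => simp
    | tmul x y => simp [TensorProduct.smul_tmul', hρ]
    | add x y hx hy => rw [smul_add, map_add, map_add, smul_add, hx, hy]

lemma intTensorLift_tmul (x y) : intTensorLift ρ β hρ (x ⊗ₜ[ℤ] y) = β x y := rfl

variable (he : ∀ (a : O V) x y, sg V a = a → β (a • x) y = β x (a • y))
  (ho : ∀ (a : O V) x y, sg V a = -a → β (a • F.par V x) y = β x (a • y))

include he ho in
lemma tensorRel_le_ker : tensorRel F G V ≤ LinearMap.ker (intTensorLift ρ β hρ) :=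
  Submodule.span_le.2 (by
    rintro _ ⟨a, x, y, ⟨ha, rfl⟩ | ⟨ha, rfl⟩⟩
    · rw [SetLike.mem_coe, LinearMap.mem_ker, map_sub, intTensorLift_tmul, intTensorLift_tmul,
        he a x y ha, sub_self]
    · rw [SetLike.mem_coe, LinearMap.mem_ker, map_sub, intTensorLift_tmul, intTensorLift_tmul,
        ho a x y ha, sub_self])

/-- Semilinear maps out of the tensor product of supermodules. -/
def tensorLift : (tensor F G).obj V →+ X :=
  ((tensorRel F G V).liftQ (intTensorLift ρ β hρ)
    (tensorRel_le_ker ρ β hρ he ho)).toAddMonoidHom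

lemma tensorLift_smul (a : O V) (t) :
    tensorLift ρ β hρ he ho (a • t) = ρ a • tensorLift ρ β hρ he ho t :=
  ((tensorRel F G V).liftQ (intTensorLift ρ β hρ)
    (tensorRel_le_ker ρ β hρ he ho)).map_smulₛₗ a t

end

lemma tensor_induction {F G : SMod n} {V : Opens (Pn n)} {p : (tensor F G).obj V → Prop}
    (h0 : p 0) (hadd : ∀ s t, p s → p t → p (s + t)) (h : ∀ x y, p (tmul F G V x y)) (t) : p t := by
  obtain ⟨t, rfl⟩ := Submodule.Quotient.mk_surjective _ t
  induction t with
  | zero => exact h0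
  | tmul x y => exact h x y
  | add x y hx hy => exact hadd _ _ hx hy

section

variable {F G : SMod n} {V : Opens (Pn n)}

lemma tmul_add_left (x x' : F.obj V) (y : G.obj V) :
    tmul F G V (x + x') y = tmul F G V x y + tmul F G V x' y :=
  congrArg (Submodule.Quotient.mk (p := tensorRel F G V)) (TensorProduct.add_tmul x x' y)

lemma tmul_add_right (x : F.obj V) (y y' : G.obj V) :
    tmul F G V x (y + y') = tmul F G V x y + tmul F G V x y' :=
  congrArg (Submodule.Quotient.mk (p := tensorRel F G V)) (TensorProduct.tmul_add x y y')

lemma tmul_neg_left (x : F.obj V) (y : G.obj V) : tmul F G V (-x) y = tmul F G V x (-y) :=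
  congrArg (Submodule.Quotient.mk (p := tensorRel F G V))
    ((TensorProduct.neg_tmul x y).trans (TensorProduct.tmul_neg x y).symm)

lemma tmul_zero_right (x : F.obj V) : tmul F G V x 0 = 0 :=
  congrArg (Submodule.Quotient.mk (p := tensorRel F G V)) (TensorProduct.tmul_zero _ x)

lemma tmul_even {a : O V} (ha : sg V a = a) (x : F.obj V) (y : G.obj V) :
    tmul F G V (a • x) y = tmul F G V x (a • y) :=
  (Submodule.Quotient.eq _).2 (Submodule.subset_span ⟨a, x, y, Or.inl ⟨ha, rfl⟩⟩)

lemma tmul_odd {a : O V} (ha : sg V a = -a) (x : F.obj V) (y : G.obj V) :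
    tmul F G V (a • F.par V x) y = tmul F G V x (a • y) :=
  (Submodule.Quotient.eq _).2 (Submodule.subset_span ⟨a, x, y, Or.inr ⟨ha, rfl⟩⟩)

/-- If `F` is generated by a homogeneous section `x`, every section of `F ⊗ G` is of the form
`x ⊗ y`. -/
lemma exists_eq_tmul {x : F.obj V} (hx : ∀ z, ∃ a : O V, z = a • x)
    (hp : F.par V x = x ∨ F.par V x = -x) (t : (tensor F G).obj V) :
    ∃ y, t = tmul F G V x y := by
  refine tensor_induction (p := fun t => ∃ y, t = tmul F G V x y)
    ⟨0, (tmul_zero_right x).symm⟩ ?_ ?_ t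
  · rintro _ _ ⟨y, rfl⟩ ⟨y', rfl⟩
    exact ⟨y + y', (tmul_add_right x y y').symm⟩
  · intro z y
    obtain ⟨a, rfl⟩ := hx z
    -- The tensor relations concern homogeneous scalars only. The odd part crosses the tensor sign
    -- together with the parity of `x`, which is a sign because `x` is homogeneous.
    obtain ⟨b, c, hb, hc, rfl⟩ := exists_even_add_odd a
    have h1 : ∃ y', tmul F G V (c • x) y = tmul F G V x y' := by
      rcases hp with hp | hp
      · exact ⟨c • y, by rw [← tmul_odd hc, hp]⟩
      · refine ⟨-(c • y), ?_⟩
        rw [← tmul_neg_left, ← tmul_odd hc, map_neg, hp, neg_neg]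
    obtain ⟨y', hy'⟩ := h1
    exact ⟨b • y + y', by rw [add_smul, tmul_add_left, tmul_even hb, hy', tmul_add_right]⟩

end

end

/-! ### Homomorphisms of glued sheaves -/

/-- A compatible family of homomorphisms over the open subsets of the charts. -/
structure ChartHom (F G : SMod n) where
  app : ∀ V : Opens (Pn n), (∃ i, V ≤ chart i) → F.obj V →+ G.obj V
  app_res : ∀ {V W : Opens (Pn n)} (h : W ≤ V) (hV hW) (s : F.obj V),
    app W hW (F.res h s) = G.res h (app V hV s)

namespace ChartHom

variable {F F' G : SMod n} (φ : ChartHom F G)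

/-- The induced homomorphism on sections of the glued sheaves. -/
def glueApp (V : Opens (Pn n)) : (glue F).obj V →+ (glue G).obj V :=
  AddMonoidHom.mk' (fun s => (⟨fun W => φ.app W.1 W.2.2 ((show glueSec F V from s).1 W),
    fun W U h => by
      rw [← φ.app_res h W.2.2 U.2.2, (show glueSec F V from s).2 W U h]⟩ : glueSec G V))
    (fun s t => Subtype.ext (a1 := (show glueSec G V from _)) (a2 := (show glueSec G V from _))
      (funext fun W => map_add (φ.app W.1 W.2.2) _ _))

lemma glue_ext {V : Opens (Pn n)} {s t : (glue F).obj V}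
    (h : ∀ W : SubC V, (show glueSec F V from s).1 W = (show glueSec F V from t).1 W) : s = t :=
  Subtype.ext (a1 := (show glueSec F V from s)) (a2 := (show glueSec F V from t)) (funext h)

lemma glueApp_toGlue (V : Opens (Pn n)) (s : F.obj V) (t : G.obj V)
    (h : ∀ W : SubC V, φ.app W.1 W.2.2 (F.res W.2.1 s) = G.res W.2.1 t) :
    φ.glueApp V (toGlue F V s) = toGlue G V t := glue_ext h

/-- The even homomorphism of glued sheaves. -/
def evenHom (hs : ∀ V hV (a : O V) s, φ.app V hV (a • s) = a • φ.app V hV s)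
    (hp : ∀ V hV s, φ.app V hV (F.par V s) = G.par V (φ.app V hV s)) :
    EvenHom (glue F) (glue G) where
  app := φ.glueApp
  app_smul _ _ _ := glue_ext fun W => hs W.1 W.2.2 _ _
  app_par _ _ := glue_ext fun W => hp W.1 W.2.2 _
  app_res _ _ := rfl

/-- The odd homomorphism of glued sheaves. -/
def oddHom (hs : ∀ V hV (a : O V) s, φ.app V hV (a • s) = sg V a • φ.app V hV s)
    (hp : ∀ V hV s, φ.app V hV (F.par V s) = -G.par V (φ.app V hV s)) :
    OddHom (glue F) (glue G) where
  app := φ.glueApp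
  app_smul _ _ _ := glue_ext fun W => hs W.1 W.2.2 _ _
  app_par _ _ := glue_ext fun W => hp W.1 W.2.2 _
  app_res _ _ := rfl

lemma glueApp_injective (h : ∀ V hV, Function.Injective (φ.app V hV)) (V : Opens (Pn n)) :
    Function.Injective (φ.glueApp V) := fun s t hst => glue_ext fun W => by
  refine h W.1 W.2.2 ?_
  exact congrArg (fun x => (show glueSec G V from x).1 W) hst

/-- Preimages are chosen over each open set separately; injectivity over the smaller set forces them
to be compatible. -/
lemma glueApp_bijective (h : ∀ V hV, Function.Bijective (φ.app V hV)) (V : Opens (Pn n)) :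
    Function.Bijective (φ.glueApp V) := by
  refine ⟨φ.glueApp_injective (fun V hV => (h V hV).1) V, fun t => ?_⟩
  choose s hs using fun W : SubC V => (h W.1 W.2.2).2 ((show glueSec G V from t).1 W)
  refine ⟨(⟨s, fun W U hWU => (h U.1 U.2.2).1 ?_⟩ : glueSec F V), glue_ext hs⟩
  rw [φ.app_res hWU W.2.2, hs, hs, (show glueSec G V from t).2 W U hWU]

/-- The sum of two families of homomorphisms. -/
def coprod (ψ : ChartHom F' G) : ChartHom (SuperProj.sum F F') G where
  app V hV := (φ.app V hV).coprod (ψ.app V hV)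
  app_res h hV hW s := by
    change φ.app _ hW (F.res h s.1) + ψ.app _ hW (F'.res h s.2) =
      G.res h (φ.app _ hV s.1 + ψ.app _ hV s.2)
    rw [φ.app_res h hV, ψ.app_res h hV, map_add]

/-- The even homomorphism from the sum of two glued sheaves. -/
def evenHomSum (ψ : ChartHom F' G) (hs : ∀ V hV (a : O V) s, φ.app V hV (a • s) = a • φ.app V hV s)
    (hp : ∀ V hV s, φ.app V hV (F.par V s) = G.par V (φ.app V hV s))
    (hs' : ∀ V hV (a : O V) s, ψ.app V hV (a • s) = a • ψ.app V hV s)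
    (hp' : ∀ V hV s, ψ.app V hV (F'.par V s) = G.par V (ψ.app V hV s)) :
    EvenHom (SuperProj.sum (glue F) (glue F')) (glue G) where
  app V := (φ.glueApp V).coprod (ψ.glueApp V)
  app_smul V a s := by
    change φ.glueApp V (a • s.1) + ψ.glueApp V (a • s.2) =
      a • (φ.glueApp V s.1 + ψ.glueApp V s.2)
    rw [smul_add]
    exact congrArg₂ (· + ·) ((φ.evenHom hs hp).app_smul V a s.1)
      ((ψ.evenHom hs' hp').app_smul V a s.2)
  app_par V s := by
    change φ.glueApp V ((glue F).par V s.1) + ψ.glueApp V ((glue F').par V s.2) =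
      (glue G).par V (φ.glueApp V s.1 + ψ.glueApp V s.2)
    rw [map_add]
    exact congrArg₂ (· + ·) ((φ.evenHom hs hp).app_par V s.1) ((ψ.evenHom hs' hp').app_par V s.2)
  app_res h s := rfl

/-- A section of the glued direct sum is a pair of glued sections, so bijectivity is transported
from the glued sum. -/
lemma evenHomSum_bijective (ψ : ChartHom F' G) (hs hp hs' hp')
    (h : ∀ V hV, Function.Bijective ((φ.coprod ψ).app V hV)) (V : Opens (Pn n)) :
    Function.Bijective ((φ.evenHomSum ψ hs hp hs' hp').app V) := by
  obtain ⟨h1, h2⟩ := (φ.coprod ψ).glueApp_bijective h V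
  refine ⟨fun s t hst => ?_, fun x => ?_⟩
  · let p : (glue F).obj V × (glue F').obj V → (glue (SuperProj.sum F F')).obj V := fun s =>
      (⟨fun W => ((show glueSec F V from s.1).1 W, (show glueSec F' V from s.2).1 W),
        fun W U h => Prod.ext ((show glueSec F V from s.1).2 W U h)
          ((show glueSec F' V from s.2).2 W U h)⟩ : glueSec (SuperProj.sum F F') V)
    have h3 : p s = p t := h1 hst
    refine Prod.ext (glue_ext fun W => ?_) (glue_ext fun W => ?_)
    · exact congrArg (fun x => ((show glueSec (SuperProj.sum F F') V from x).1 W).1) h3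
    · exact congrArg (fun x => ((show glueSec (SuperProj.sum F F') V from x).1 W).2) h3
  · obtain ⟨y, rfl⟩ := h2 x
    let y' := (show glueSec (SuperProj.sum F F') V from y)
    exact ⟨((⟨fun W => (y'.1 W).1, fun W U h => congrArg Prod.fst (y'.2 W U h)⟩ : glueSec F V),
      (⟨fun W => (y'.1 W).2, fun W U h => congrArg Prod.snd (y'.2 W U h)⟩ : glueSec F' V)), rfl⟩

end ChartHom

/-! ### The Heaviside homomorphisms -/

section

variable (k : ℤ)

/-- The extended form `Θ(D ⊗ P)` as a section of the sheaf of extended forms. -/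
def heavSec {V : Opens (Pn n)} (hV : ∃ i, V ≤ chart i) (D : (Ber n).obj V)
    (P : (Sym (PiT n) (n - k)).obj V) : (Ext n (k - 1)).obj V :=
  (⟨heav hV D (symVal P), heav_mem_grade hV k D
    (show FormAlg.grade (sg V) ((PiT n).par V) ∅ (n - k) from P).2⟩ :
    FormAlg.grade (sg V) ((OneForms n).par V) (invSet V) (k - 1))

lemma ext_ext {d : ℤ} {V : Opens (Pn n)} {x y : (Ext n d).obj V} (h : extVal x = extVal y) :
    x = y :=
  Subtype.ext (a1 := (show FormAlg.grade (sg V) ((OneForms n).par V) (invSet V) d from x))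
    (a2 := (show FormAlg.grade (sg V) ((OneForms n).par V) (invSet V) d from y)) h

lemma sym_ext {F : SMod n} {d : ℤ} {V : Opens (Pn n)} {x y : (Sym F d).obj V}
    (h : symVal x = symVal y) : x = y :=
  Subtype.ext (a1 := (show FormAlg.grade (sg V) (F.par V) ∅ d from x))
    (a2 := (show FormAlg.grade (sg V) (F.par V) ∅ d from y)) h

/-- `Θ(D ⊗ P)` as a biadditive map. -/
def heavHom {V : Opens (Pn n)} (hV : ∃ i, V ≤ chart i) :
    (Ber n).obj V →+ (Sym (PiT n) (n - k)).obj V →+ (Ext n (k - 1)).obj V :=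
  AddMonoidHom.mk' (fun D => AddMonoidHom.mk' (heavSec k hV D)
      (fun P Q => ext_ext (heav_add_right hV D (symVal P) (symVal Q))))
    (fun D E => AddMonoidHom.ext fun P => ext_ext (heav_add_left hV D E (symVal P)))

variable {V : Opens (Pn n)} (hV : ∃ i, V ≤ chart i)

lemma heavHom_smul (a : O V) (D : (Ber n).obj V) (P : (Sym (PiT n) (n - k)).obj V) :
    heavHom k hV (a • D) P = sg V a • heavHom k hV D P :=
  ext_ext (heav_smul hV a D (symVal P))

lemma heavHom_even (a : O V) (D : (Ber n).obj V) (P : (Sym (PiT n) (n - k)).obj V)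
    (ha : sg V a = a) : heavHom k hV (a • D) P = heavHom k hV D (a • P) :=
  ext_ext (heav_even hV ha D (symVal P))

lemma heavHom_odd (a : O V) (D : (Ber n).obj V) (P : (Sym (PiT n) (n - k)).obj V)
    (ha : sg V a = -a) : heavHom k hV (a • (Ber n).par V D) P = heavHom k hV D (a • P) :=
  ext_ext (heav_odd hV ha D (symVal P))

lemma heavHom_par (D : (Ber n).obj V) (P : (Sym (PiT n) (n - k)).obj V) :
    heavHom k hV ((Ber n).par V D) ((Sym (PiT n) (n - k)).par V P) =
      -(Ext n (k - 1)).par V (heavHom k hV D P) :=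
  ext_ext (heav_par hV D (symVal P))

lemma heavHom_res {W : Opens (Pn n)} (h : W ≤ V) (hW : ∃ i, W ≤ chart i) (D : (Ber n).obj V)
    (P : (Sym (PiT n) (n - k)).obj V) :
    heavHom k hW ((Ber n).res h D) ((Sym (PiT n) (n - k)).res h P) =
      (Ext n (k - 1)).res h (heavHom k hV D P) :=
  ext_ext (heav_res h hV hW D (symVal P)).symm

/-- The homomorphism `Θ` on `Ber ⊗ Sym ΠT` over the open subsets of the charts. -/
def thetaApp : (tensor (Ber n) (Sym (PiT n) (n - k))).obj V →+ (Ext n (k - 1)).obj V :=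
  tensorLift (sg V).toRingHom (heavHom k hV) (heavHom_smul k hV) (heavHom_even k hV)
    (heavHom_odd k hV)

/-- `Θ(D ⊗ P)` as a biadditive map in `πD` and `P`. -/
def piHeavHom :
    (shift (Ber n)).obj V →+ (Sym (PiT n) (n - k)).obj V →+ (Ext n (k - 1)).obj V :=
  heavHom k hV

/-- A scalar acts on the shifted sheaf through `sg`, which cancels the `sg` in the linearity of the
odd map: the parity shift makes it even and linear. -/
lemma piHeavHom_smul (a : O V) (D : (shift (Ber n)).obj V) (P : (Sym (PiT n) (n - k)).obj V) :
    piHeavHom k hV (a • D) P = RingHom.id (O V) a • piHeavHom k hV D P := by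
  have h1 := heavHom_smul k hV (sg V a) D P
  rw [sg_sg] at h1
  exact h1

lemma piHeavHom_even (a : O V) (D : (shift (Ber n)).obj V) (P : (Sym (PiT n) (n - k)).obj V)
    (ha : sg V a = a) : piHeavHom k hV (a • D) P = piHeavHom k hV D (a • P) := by
  have h1 := heavHom_even k hV a D P ha
  nth_rw 1 [← ha] at h1
  exact h1

lemma piHeavHom_odd (a : O V) (D : (shift (Ber n)).obj V) (P : (Sym (PiT n) (n - k)).obj V)
    (ha : sg V a = -a) :
    piHeavHom k hV (a • (shift (Ber n)).par V D) P = piHeavHom k hV D (a • P) := by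
  have h1 := heavHom_odd k hV a D P ha
  have h2 : a • (Ber n).par V D = sg V a • -(Ber n).par V D := by
    rw [ha, neg_smul, smul_neg, neg_neg]
  rw [h2] at h1
  exact h1

lemma piHeavHom_par (D : (shift (Ber n)).obj V) (P : (Sym (PiT n) (n - k)).obj V) :
    piHeavHom k hV ((shift (Ber n)).par V D) ((Sym (PiT n) (n - k)).par V P) =
      (Ext n (k - 1)).par V (piHeavHom k hV D P) := by
  have h1 := congrArg Neg.neg (heavHom_par k hV D P)
  rw [neg_neg, ← AddMonoidHom.neg_apply, ← map_neg] at h1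
  exact h1

/-- The homomorphism `Θ ∘ π⁻¹` on `ΠBer ⊗ Sym ΠT` over the open subsets of the charts. -/
def phiApp : (tensor (shift (Ber n)) (Sym (PiT n) (n - k))).obj V →+ (Ext n (k - 1)).obj V :=
  tensorLift (RingHom.id (O V)) (piHeavHom k hV) (piHeavHom_smul k hV) (piHeavHom_even k hV)
    (piHeavHom_odd k hV)

lemma thetaApp_tmul (D : (Ber n).obj V) (P : (Sym (PiT n) (n - k)).obj V) :
    thetaApp k hV (tmul _ _ V D P) = heavHom k hV D P := rfl

lemma phiApp_tmul (D : (Ber n).obj V) (P : (Sym (PiT n) (n - k)).obj V) :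
    phiApp k hV (tmul (shift (Ber n)) _ V (pi (Ber n) V D) P) = heavHom k hV D P := rfl

end

/-- One naturality statement with two uses: restriction in `inclForm_res` and the parity involution
in `inclHom_par`. -/
lemma incl_map {A B : Type} [CommRing A] [Algebra ℂ A] [CommRing B] [Algebra ℂ B]
    {M N : Type} [AddCommGroup M] [Module A M] [AddCommGroup N] [Module B N]
    {σ : A →ₐ[ℂ] A} {τ : M →+ M} {S : Set M} {σ' : B →ₐ[ℂ] B} {τ' : N →+ N} {S' : Set N}
    (f : A →ₐ[ℂ] B) (g : M →+ N) (hf : ∀ a, f (σ a) = σ' (f a)) (hg : ∀ x, g (τ x) = τ' (g x))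
    (hfg : ∀ a x, g (a • x) = f a • g x) (hS : ∀ x ∈ S, g x ∈ S') (h0) (w : FormAlg σ τ (∅ : Set M)) :
    SBasis.incl σ' τ' S' (FormAlg.map f g hf hg hfg h0 w) =
      FormAlg.map f g hf hg hfg hS (SBasis.incl σ τ S w) := by
  have hs : ∀ a, SBasis.incl σ τ S (FormAlg.scal σ τ ∅ a) = FormAlg.scal σ τ S a :=
    fun a => FormAlg.map_scal ..
  have hs' : ∀ a, SBasis.incl σ' τ' S' (FormAlg.scal σ' τ' ∅ a) = FormAlg.scal σ' τ' S' a :=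
    fun a => FormAlg.map_scal ..
  have hv : ∀ a, SBasis.incl σ τ S (FormAlg.vec σ τ ∅ a) = FormAlg.vec σ τ S a :=
    fun a => FormAlg.map_vec ..
  have hv' : ∀ a, SBasis.incl σ' τ' S' (FormAlg.vec σ' τ' ∅ a) = FormAlg.vec σ' τ' S' a :=
    fun a => FormAlg.map_vec ..
  induction w using FormAlg.induction with
  | hs a => rw [FormAlg.map_scal, hs', hs, FormAlg.map_scal]
  | hv x => rw [FormAlg.map_vec, hv', hv, FormAlg.map_vec]
  | hi s => exact s.2.elim
  | hadd x y hx hy => simp only [map_add, hx, hy]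
  | hmul x y hx hy => simp only [map_mul, hx, hy]

section

variable (k : ℤ)

/-- The homomorphisms `Θ` over the open subsets of the charts. -/
def thetaHom : ChartHom (tensor (Ber n) (Sym (PiT n) (n - k))) (Ext n (k - 1)) where
  app _ hV := thetaApp k hV
  app_res {V W} h hV hW s := tensor_induction
    (p := fun s => thetaApp k hW ((tensor (Ber n) (Sym (PiT n) (n - k))).res h s) =
      (Ext n (k - 1)).res h (thetaApp k hV s))
    (by simp only [map_zero]) (fun s t hs ht => by simp only [map_add, hs, ht])
    (fun D P => heavHom_res k hV h hW D P) s

/-- The homomorphisms `Θ ∘ π⁻¹` over the open subsets of the charts. -/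
def phiHom : ChartHom (tensor (shift (Ber n)) (Sym (PiT n) (n - k))) (Ext n (k - 1)) where
  app _ hV := phiApp k hV
  app_res {V W} h hV hW s := tensor_induction
    (p := fun s => phiApp k hW ((tensor (shift (Ber n)) (Sym (PiT n) (n - k))).res h s) =
      (Ext n (k - 1)).res h (phiApp k hV s))
    (by simp only [map_zero]) (fun s t hs ht => by simp only [map_add, hs, ht])
    (fun D P => heavHom_res k hV h hW D P) s

lemma symVal_mem {F : SMod n} {d : ℤ} {V : Opens (Pn n)} (x : (Sym F d).obj V) :
    symVal x ∈ FormAlg.grade (sg V) (F.par V) ∅ d :=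
  (show FormAlg.grade (sg V) (F.par V) ∅ d from x).2

lemma extVal_mem {d : ℤ} {V : Opens (Pn n)} (x : (Ext n d).obj V) :
    extVal x ∈ FormAlg.grade (sg V) ((OneForms n).par V) (invSet V) d :=
  (show FormAlg.grade (sg V) ((OneForms n).par V) (invSet V) d from x).2

lemma inclForm_res (d : ℤ) {V W : Opens (Pn n)} (h : W ≤ V) (ω : (Sym (OneForms n) d).obj V) :
    inclForm n d W ((Sym (OneForms n) d).res h ω) = (Ext n d).res h (inclForm n d V ω) :=
  ext_ext (incl_map (resO h) ((OneForms n).res h) (res_sg h) ((OneForms n).res_par h)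
    ((OneForms n).res_smul h) (invSet_res h) (fun _ h => h.elim) (symVal ω))

/-- The inclusion of the superforms. -/
def inclHom (d : ℤ) : ChartHom (Sym (OneForms n) d) (Ext n d) where
  app V _ := AddMonoidHom.mk' (inclForm n d V)
    (fun x y => ext_ext (map_add (inclAlg V) (symVal x) (symVal y)))
  app_res h _ _ ω := inclForm_res d h ω

lemma inclHom_smul (d : ℤ) (V : Opens (Pn n)) (hV) (a : O V) (s) :
    (inclHom d).app V hV (a • s) = a • (inclHom d).app V hV s :=
  ext_ext (FormAlg.map_smul _ _ _ _ _ _ a (symVal s))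

lemma inclHom_par (d : ℤ) (V : Opens (Pn n)) (hV) (s) :
    (inclHom d).app V hV ((Sym (OneForms n) d).par V s) =
      (Ext n d).par V ((inclHom d).app V hV s) :=
  ext_ext (incl_map (sg V) ((OneForms n).par V) (fun _ => rfl) (fun _ => rfl)
    ((OneForms n).par_smul V) (fun x hx => by rwa [invSet_even V x hx]) (fun _ h => h.elim)
    (symVal s))

variable {V : Opens (Pn n)} (hV : ∃ i, V ≤ chart i)

lemma thetaHom_smul (a : O V) (s) :
    (thetaHom k).app V hV (a • s) = sg V a • (thetaHom k).app V hV s :=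
  tensorLift_smul (sg V).toRingHom (heavHom k hV) (heavHom_smul k hV) (heavHom_even k hV)
    (heavHom_odd k hV) a s

lemma phiHom_smul (a : O V) (s) : (phiHom k).app V hV (a • s) = a • (phiHom k).app V hV s :=
  tensorLift_smul (RingHom.id (O V)) (piHeavHom k hV) (piHeavHom_smul k hV) (piHeavHom_even k hV)
    (piHeavHom_odd k hV) a s

lemma thetaHom_par (s) : (thetaHom k).app V hV ((tensor (Ber n) (Sym (PiT n) (n - k))).par V s) =
    -(Ext n (k - 1)).par V ((thetaHom k).app V hV s) :=
  tensor_induction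
    (p := fun s => thetaApp k hV ((tensor (Ber n) (Sym (PiT n) (n - k))).par V s) =
      -(Ext n (k - 1)).par V (thetaApp k hV s))
    (by simp only [map_zero, neg_zero]) (fun s t hs ht => by simp only [map_add, hs, ht, neg_add])
    (fun D P => heavHom_par k hV D P) s

lemma phiHom_par (s) :
    (phiHom k).app V hV ((tensor (shift (Ber n)) (Sym (PiT n) (n - k))).par V s) =
      (Ext n (k - 1)).par V ((phiHom k).app V hV s) :=
  tensor_induction
    (p := fun s => phiApp k hV ((tensor (shift (Ber n)) (Sym (PiT n) (n - k))).par V s) =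
      (Ext n (k - 1)).par V (phiApp k hV s))
    (by simp only [map_zero]) (fun s t hs ht => by simp only [map_add, hs, ht])
    (fun D P => piHeavHom_par k hV D P) s

/-! ### Bijectivity over the charts -/

lemma par_berGen {i : Fin (n + 1)} (h : V ≤ chart i) :
    (Ber n).par V (berGen (chartFrame h)) = berGen (chartFrame h) ∨
      (Ber n).par V (berGen (chartFrame h)) = -berGen (chartFrame h) := by
  rcases neg_one_pow_eq_or (O V) (1 + n) with h1 | h1
  · left
    refine berDual_ext (chartFrame h) ?_
    rw [berEval_par, berEval_berGen, map_one, mul_one, h1]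
  · right
    refine berDual_ext (chartFrame h) ?_
    rw [berEval_par, berEval_berGen, map_one, mul_one, h1]
    exact congrArg Neg.neg (berEval_berGen _).symm

lemma exists_eq_gen_tmul {i : Fin (n + 1)} (h : V ≤ chart i)
    (t : (tensor (Ber n) (Sym (PiT n) (n - k))).obj V) :
    ∃ P, t = tmul _ _ V (berGen (chartFrame h)) P :=
  exists_eq_tmul (fun D => ⟨_, eq_berEval_smul_berGen D _⟩) (par_berGen h) t

lemma exists_eq_pi_gen_tmul {i : Fin (n + 1)} (h : V ≤ chart i)
    (t : (tensor (shift (Ber n)) (Sym (PiT n) (n - k))).obj V) :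
    ∃ P, t = tmul _ _ V (pi (Ber n) V (berGen (chartFrame h))) P := by
  refine exists_eq_tmul (F := shift (Ber n)) (x := pi (Ber n) V (berGen (chartFrame h)))
    (fun D => ⟨sg V (berEval (show (Ber n).obj V from D) (chartFrame h)), ?_⟩)
    ?_ t
  · rw [shift_smul, sg_sg]
    exact eq_berEval_smul_berGen (show (Ber n).obj V from D) _
  · rw [shift_par]
    rcases par_berGen h with h1 | h1
    · right
      rw [h1]
    · left
      rw [h1, map_neg, neg_neg]

/-- On the generator the Heaviside map is the contraction of the volume form, so the algebraic
statement applies. Sections `gen ⊗ P` are all sections of the tensor product, hence no independent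
proof that it is free is needed. -/
lemma gen_incl_injective {i : Fin (n + 1)} (h : V ≤ chart i) {P : (Sym (PiT n) (n - k)).obj V}
    {w : (Sym (OneForms n) (k - 1)).obj V}
    (hs : heavHom k ⟨i, h⟩ (berGen (chartFrame h)) P + (inclHom (k - 1)).app V ⟨i, h⟩ w = 0) :
    P = 0 ∧ w = 0 := by
  have h1 := congrArg extVal hs
  have h2 : contrF h (symVal P) (volF h) + inclAlg V (symVal w) = 0 := by
    rw [← heav_berGen]
    exact h1
  obtain ⟨h3, h4⟩ := (basisF h).contr_vol_add_incl_eq_zero (basisT h) (isSuper (OneForms n) V)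
    (isSuper (PiT n) V) (invSet_even V) (basisF_e_mem h) (basisF_ce_isUnit h) k (symVal_mem P)
    (symVal_mem w) h2
  exact ⟨sym_ext h3, sym_ext h4⟩

lemma exists_gen_incl {i : Fin (n + 1)} (h : V ≤ chart i) (x : (Ext n (k - 1)).obj V) :
    ∃ (P : (Sym (PiT n) (n - k)).obj V) (w : (Sym (OneForms n) (k - 1)).obj V),
      heavHom k ⟨i, h⟩ (berGen (chartFrame h)) P + (inclHom (k - 1)).app V ⟨i, h⟩ w = x := by
  obtain ⟨P, hP, w, hw, hx⟩ := (basisF h).exists_contr_vol_add_incl (basisT h)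
    (isSuper (OneForms n) V) (isSuper (PiT n) V) (invSet_even V) (basisF_e_mem h)
    (basisF_ce_isUnit h) k (extVal_mem x)
  refine ⟨(⟨P, hP⟩ : FormAlg.grade (sg V) ((PiT n).par V) ∅ (n - k)),
    (⟨w, hw⟩ : FormAlg.grade (sg V) ((OneForms n).par V) ∅ (k - 1)), ext_ext ?_⟩
  refine Eq.trans ?_ hx
  exact congrArg (· + inclAlg V w) (heav_berGen h P)

/-- With nothing inverted, the degree is the length of a list of vectors. -/
lemma sym_eq_zero {F : SMod n} {d : ℤ} (hd : d < 0) (x : (Sym F d).obj V) : x = 0 := by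
  refine sym_ext ?_
  have h1 : FormAlg.grade (sg V) (F.par V) ∅ d = ⊥ := by
    rw [FormAlg.grade, Submodule.span_eq_bot]
    rintro _ ⟨l, t, hl, -⟩
    rcases t with _ | ⟨s, t⟩
    · simp at hl
      omega
    · exact s.2.elim
  have h2 := symVal_mem x
  rw [h1, Submodule.mem_bot] at h2
  exact h2

/-- This holds for every `k`; the three ranges of the theorem differ only in which summand vanishes.
-/
lemma phi_incl_bijective :
    Function.Bijective (((phiHom (n := n) k).coprod (inclHom (k - 1))).app V hV) := by
  obtain ⟨i, h⟩ := hV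
  refine ⟨(injective_iff_map_eq_zero _).2 ?_, fun x => ?_⟩
  · rintro ⟨t, w⟩ hs
    obtain ⟨P, rfl⟩ := exists_eq_pi_gen_tmul k h t
    obtain ⟨rfl, rfl⟩ := gen_incl_injective k h (P := P) (w := w) hs
    exact Prod.ext (tmul_zero_right _) rfl
  · obtain ⟨P, w, rfl⟩ := exists_gen_incl k h x
    exact ⟨(tmul _ _ V (pi (Ber n) V (berGen (chartFrame h))) P, w), rfl⟩

lemma theta_injective : Function.Injective ((thetaHom (n := n) k).app V hV) := by
  obtain ⟨i, h⟩ := hV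
  refine (injective_iff_map_eq_zero _).2 fun t hs => ?_
  obtain ⟨P, rfl⟩ := exists_eq_gen_tmul k h t
  obtain ⟨rfl, -⟩ := gen_incl_injective k h (P := P) (w := 0) (by
    rw [map_zero, add_zero]
    exact hs)
  exact tmul_zero_right _

/-- For `k ≤ 0` the degree `k - 1` is negative, so there is no superform summand. -/
lemma theta_bijective (hk : k ≤ 0) : Function.Bijective ((thetaHom (n := n) k).app V hV) := by
  refine ⟨theta_injective k hV, fun x => ?_⟩
  obtain ⟨i, h⟩ := hV
  obtain ⟨P, w, rfl⟩ := exists_gen_incl k h x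
  refine ⟨tmul _ _ V (berGen (chartFrame h)) P, ?_⟩
  rw [sym_eq_zero (by omega) w, map_zero, add_zero]
  rfl

lemma phi_bijective (hk : k ≤ 0) : Function.Bijective ((phiHom (n := n) k).app V hV) := by
  obtain ⟨h1, h2⟩ := phi_incl_bijective k hV
  constructor
  · intro s t hst
    exact congrArg Prod.fst (@h1 (s, 0) (t, 0) (congrArg (· + (inclHom (k - 1)).app V hV 0) hst))
  · intro x
    obtain ⟨⟨s, w⟩, rfl⟩ := h2 x
    refine ⟨s, ?_⟩
    rw [sym_eq_zero (by omega) w]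
    exact ((congrArg (_ + ·) (map_zero ((inclHom (k - 1)).app V hV))).trans (add_zero _)).symm

/-- For `k > n` the degree `n - k` is negative, so there are no polyvectors and the superforms
exhaust the extended forms. -/
lemma incl_bijective (hk : n < k) : Function.Bijective ((inclHom (n := n) (k - 1)).app V hV) := by
  obtain ⟨i, h⟩ := hV
  refine ⟨(injective_iff_map_eq_zero _).2 fun w hw => ?_, fun x => ?_⟩
  · exact (gen_incl_injective k h (P := 0) (w := w) (by rw [map_zero, zero_add, hw])).2
  · obtain ⟨P, w, rfl⟩ := exists_gen_incl k h x
    refine ⟨w, ?_⟩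
    rw [sym_eq_zero (by omega) P, map_zero, zero_add]

end

/-! ### The theorem -/

/-- The morphism `Θ` from integral forms to extended forms. -/
def theta (k : ℤ) : OddHom (IntegralForms n k) (ExtForms n (k - 1)) :=
  (thetaHom k).oddHom (fun _ hV => thetaHom_smul k hV) (fun _ hV => thetaHom_par k hV)

/-- The morphism `Θ ∘ π⁻¹`. -/
def phi (k : ℤ) : EvenHom (PiBerSym n k) (ExtForms n (k - 1)) :=
  (phiHom k).evenHom (fun _ hV => phiHom_smul k hV) (fun _ hV => phiHom_par k hV)

/-- The inclusion of the superforms in the extended forms. -/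
def inclusion (d : ℤ) : EvenHom (SuperForms n d) (ExtForms n d) :=
  (inclHom d).evenHom (inclHom_smul d) (inclHom_par d)

/-- The sum of `Θ ∘ π⁻¹` and the inclusion of the superforms. -/
def phiSum (k : ℤ) : EvenHom (SuperProj.sum (PiBerSym n k) (SuperForms n (k - 1)))
    (ExtForms n (k - 1)) :=
  (phiHom k).evenHomSum (inclHom (k - 1)) (fun _ hV => phiHom_smul k hV)
    (fun _ hV => phiHom_par k hV) (inclHom_smul (k - 1)) (inclHom_par (k - 1))

lemma phi_mkPiBerSym (k : ℤ) (V : Opens (Pn n)) (D : (Ber n).obj V)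
    (P : (Sym (PiT n) (n - k)).obj V) :
    (phi k).app V (mkPiBerSym D P) = (theta k).app V (mkIntegral D P) :=
  ChartHom.glue_ext fun W => (phiApp_tmul k W.2.2 ((Ber n).res W.2.1 D)
    ((Sym (PiT n) (n - k)).res W.2.1 P)).trans (thetaApp_tmul k W.2.2 ((Ber n).res W.2.1 D)
    ((Sym (PiT n) (n - k)).res W.2.1 P)).symm

lemma inclusion_mkSuper (d : ℤ) (V : Opens (Pn n)) (ω : (Sym (OneForms n) d).obj V) :
    (inclusion d).app V (mkSuper ω) = mkExt (inclForm n d V ω) :=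
  (inclHom d).glueApp_toGlue V ω (inclForm n d V ω) fun W =>
    inclForm_res d W.2.1 ω

lemma localFrames_poly {V : Opens (Pn n)} {i : Fin (n + 1)} (h : V ≤ chart i)
    (τ : Equiv.Perm (Fin n)) (s a : ℕ) : (localFrames h).poly τ s a =
      (basisT h).word ∅ (((List.finRange n).drop s).map τ).reverse *
        FormAlg.vec (sg V) ((PiT n).par V) ∅ (basisT h).e ^ a := by
  rw [LocalFrames.poly, SBasis.word, ← List.map_reverse, List.map_map]
  rfl

lemma invForm_eq {V : Opens (Pn n)} {i : Fin (n + 1)} (h : V ≤ chart i)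
    (τ : Equiv.Perm (Fin n)) (s b : ℕ) : invForm h τ s b =
      (basisF h).word (invSet V) (((List.finRange n).take s).map τ) *
        FormAlg.inv (sg V) ((OneForms n).par V) (invSet V) ⟨(basisF h).e, basisF_e_mem h⟩ ^ b := by
  rw [invForm, SBasis.word, List.map_map]
  rfl

/-- On the coordinate generator `Θ` is the contraction of the volume form, so the formula is
`SBasis.contr_vol` for the coordinate bases; restriction to smaller opens is compatible by
naturality. -/
lemma theta_isHeaviside : IsHeaviside (n := n) theta := by
  intro i V h
  refine ⟨localFrames h, ?_⟩
  intro τ s a _ k hk P ω hP hω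
  refine (thetaHom k).glueApp_toGlue V _ ω fun W => ?_
  rw [(thetaHom k).app_res W.2.1 ⟨i, h⟩]
  congr 1
  refine ext_ext ?_
  change heav ⟨i, h⟩ (berGen (chartFrame h)) (symVal P) = extVal ω
  rw [heav_berGen, hP, hω, localFrames_poly, invForm_eq]
  exact (basisF h).contr_vol (basisT h) (isSuper (OneForms n) V) (isSuper (PiT n) V)
    (invSet_even V) (basisF_e_mem h) τ s a

end SuperProj

end

theorem mainTheorem3 (n : ℕ) :
    ∃ Θ : ∀ k : ℤ, SuperProj.OddHom (SuperProj.IntegralForms n k) (SuperProj.ExtForms n (k - 1)),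
      SuperProj.IsHeaviside Θ ∧
      (∀ k : ℤ, k ≤ 0 → ∀ V, Function.Bijective ((Θ k).app V)) ∧
      (∀ k : ℤ, 0 < k → k ≤ n → ∀ V, Function.Injective ((Θ k).app V)) ∧
      (∀ k : ℤ, n < k →
        ∃ Φ : SuperProj.EvenHom (SuperProj.SuperForms n (k - 1)) (SuperProj.ExtForms n (k - 1)),
          (∀ V, Function.Bijective (Φ.app V)) ∧
          ∀ V (ω : (SuperProj.Sym (SuperProj.OneForms n) (k - 1)).obj V),
            Φ.app V (SuperProj.mkSuper ω) =
              SuperProj.mkExt (SuperProj.inclForm n (k - 1) V ω)) ∧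
      (∀ k : ℤ, 0 < k → k ≤ n →
        ∃ Φ : SuperProj.EvenHom
            (SuperProj.sum (SuperProj.PiBerSym n k) (SuperProj.SuperForms n (k - 1)))
            (SuperProj.ExtForms n (k - 1)),
          (∀ V, Function.Bijective (Φ.app V)) ∧
          ∀ V (D : (SuperProj.Ber n).obj V)
            (P : (SuperProj.Sym (SuperProj.PiT n) (n - k)).obj V)
            (ω : (SuperProj.Sym (SuperProj.OneForms n) (k - 1)).obj V),
            Φ.app V (SuperProj.mkPiBerSym D P, SuperProj.mkSuper ω) =
              (Θ k).app V (SuperProj.mkIntegral D P) +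
                SuperProj.mkExt (SuperProj.inclForm n (k - 1) V ω)) ∧
      (∀ k : ℤ, k ≤ 0 →
        ∃ Φ : SuperProj.EvenHom (SuperProj.PiBerSym n k) (SuperProj.ExtForms n (k - 1)),
          (∀ V, Function.Bijective (Φ.app V)) ∧
          ∀ V (D : (SuperProj.Ber n).obj V)
            (P : (SuperProj.Sym (SuperProj.PiT n) (n - k)).obj V),
            Φ.app V (SuperProj.mkPiBerSym D P) = (Θ k).app V (SuperProj.mkIntegral D P)) := by
  open SuperProj in
  exact ⟨theta, theta_isHeaviside,
    fun k hk => (thetaHom k).glueApp_bijective fun _ hV => theta_bijective k hV hk,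
    fun k _ _ => (thetaHom k).glueApp_injective fun _ hV => theta_injective k hV,
    fun k hk => ⟨inclusion (k - 1),
      (inclHom (k - 1)).glueApp_bijective fun _ hV => incl_bijective k hV hk,
      inclusion_mkSuper (k - 1)⟩,
    fun k _ _ => ⟨phiSum k,
      (phiHom k).evenHomSum_bijective (inclHom (k - 1)) _ _ _ _
        fun _ hV => phi_incl_bijective k hV,
      fun V D P ω => congrArg₂ (· + ·) (phi_mkPiBerSym k V D P) (inclusion_mkSuper (k - 1) V ω)⟩,
    fun k hk => ⟨phi k, (phiHom k).glueApp_bijective fun _ hV => phi_bijective k hV hk,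
      phi_mkPiBerSym k⟩⟩
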